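/- **Trees.** A *tree* is a partial order in which every set $\{y : y\le x\}$ is linearly ordered. Its *leaves* are its maximal elements, its *nodes* are the other elements; $L$ and $N$ denote the sets of leaves and of nodes. A nonempty tree is *good* if any two elements have a meet $x\wedge y$, every element is below a leaf, and every node is the meet of two distinct leaves. The *predecessor* $p(x)$ of $x$, if it exists, is the largest element $<x$. A *cone* at a node $x$ is a set $\{t : x< t\wedge y\}$ with $y>x$. **One-colored good trees.** For $m,\mu\in\mathbb N\cup\{\infty\}$ with $m+\mu\ge 2$, a good tree is *$1$-colored of color $(m,\mu)$* if: type (0), $\mu=0$: it has exactly one node and $m$ leaves; type (1.a), $m=0$: for each leaf $\alpha$ the interval $]-\infty,\alpha[$ is nonempty, densely ordered and without first element, and at each node there are exactly $\mu$ cones, all infinite; type (1.b), $m,\mu\ge1$: each leaf $\alpha$ has a predecessor, $]-\infty,p(\alpha)]$ is densely ordered without first element, and at each node there are exactly $m$ leaves having it as predecessor and exactly $\mu$ infinite cones. $\Sigma_{m,\mu}$ is the theory of these trees in $\mathcal L_1=\{L,N,\le,\wedge\}$. **Extension.** Let $\mathcal L_{n}=\mathcal L_1\cup\{e_i,E_i,E_{\ge,i}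 : 1\le i<n\}$, with $e_i$ a partial unary function of domain $E_{\ge,i}$ and image $E_i$. Given an $\mathcal L_n$-tree $T$ and a $1$-colored good tree $T_0$, the $\mathcal L_{n+1}$-tree $T\rtimes T_0$ is obtained by replacing each leaf of $T$ by a copy of $T_0$: its underlying set is $N_T\sqcup (L_T\times T_0)$ with the obvious order. Here $e_n(\alpha,t)$ is $(\alpha,r_0)$ if $T_0$ has a root $r_0$, and $p(\alpha)$ otherwise; $E_n$ is the set of these values, $E_{\ge,n}=\{x : \exists y\in E_n\ y\le x\}$, and $e_n$ is the identity on $E_n$. For $i<n$, $e_i$ is unchanged on $N_T$, $e_i(\alpha,t)=e_i(\alpha)$, $E_i$ is unchanged, and $E_{\ge,i}$ becomes $(E_{\ge,i}\cap N_T)\sqcup(L_T\times T_0)$. A *colored good tree of length $n$* is a tree isomorphic to some $(\cdots(T_1\rtimes T_2)\rtimes\cdots)\rtimes T_n$, where the $T_i$ are $1$-colored good trees (of color $(m_i,\mu_i)$) and $T_{i+1}$ is of type (0) whenever $T_i$ is of type (1.a). It is *$n$-colored* if moreover it is not a colored good tree of length $j$ for any $j<n$. **Theories.** If $\Sigma$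 is an $\mathcal L_n$-theory and $\Sigma_0$ an $\mathcal L_1$-theory, $\Sigma\rtimes\Sigma_0$ is the $\mathcal L_{n+1}$-theory (closed under consequence) whose models are the good trees $\Lambda$ with additional symbols such that, writing $e,E,E_\ge$ for $e_n,E_n,E_{\ge,n}$: - $E$ is convex, $E_\ge=\{x:\exists y\in E\ y\le x\}$ is the domain and $E$ the image of $e$, $L\subseteq E_\ge\setminus E$, and for each $x\in E_\ge$, $e(x)$ is the greatest element of $\{y\in E : y\le x\}$; - say that $\Lambda$ is in the *rooted case* if every leaf has a predecessor and never $p(\alpha)<p(\beta)$ for leaves $\alpha,\beta$. Let $x\sim y$ iff $x=y$, or $x,y\in E_\ge$, $e(x)=e(y)$ and, outside of the rooted case, $e(x)<x\wedge y$. For $x\in E_\ge$ (for $x\in E_\ge\setminus E$ outside of the rooted case) the $\sim$-class of $x$, as a pure tree, is a model of $\Sigma_0$; - the quotient $\Lambda/{\sim}$, with the induced order and the induced $e_i,E_i,E_{\ge,i}$ ($i<n$), is a model of $\Sigma$; outside of the rooted case all leaves of the quotient have predecessors, and these predecessors form the image of $E$; - for $i<n$, $e_i$ maps $(\Lambda\setminus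 E_\ge)\cup E$ (where it is defined) into itself, and for $x\in E_\ge$, $e_i(x)$ is defined iff $e_i(e(x))$ is, and then they are equal. For $n\ge1$, $S_n$ is the set of all $\mathcal L_n$-theories $(\cdots(\Sigma_{m_1,\mu_1}\rtimes\Sigma_{m_2,\mu_2})\rtimes\cdots)\rtimes\Sigma_{m_n,\mu_n}$ for which there are trees $T_1,\dots,T_n$ of colors $(m_i,\mu_i)$ as above with $(\cdots(T_1\rtimes T_2)\rtimes\cdots)\rtimes T_n$ an $n$-colored good tree. **Theorem.** For every integer $n\ge1$: 1. every theory in $S_n$ is complete (and so is its restriction to $\mathcal L_1$), and it eliminates quantifiers in $\mathcal L_n\cup\{p,D,F\}$, where $p$ is the partial predecessor function, $D$ its domain and $F$ its image; 2. $S_n$ is exactly the set of complete $\mathcal L_n$-theories of the $n$-colored good trees $(\cdots(T_1\rtimes T_2)\rtimes\cdots)\rtimes T_n$; and the restrictions to $\mathcal L_1$ of the theories in $S_n$ are exactly the complete $\mathcal L_1$-theories of the $n$-colored good trees. -/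

import Mathlib

open FirstOrder FirstOrder.Language

namespace GoodTrees

/-! ### Trees as partial orders -/

section Order

variable {α : Type} [PartialOrder α]

open Classical in
/-- The meet of two elements (the default value `x` is never used in a meet semi-lattice). -/
noncomputable def meet (x y : α) : α :=
  if h : ∃ z, IsGLB {x, y} z then h.choose else x

/-- Good trees. The leaves are the maximal elements, the nodes are the other elements. -/
structure IsGoodTree (α : Type) [PartialOrder α] : Prop where
  nonempty : Nonempty α
  linear_below : ∀ x y z : α, y ≤ x → z ≤ x → y ≤ z ∨ z ≤ y
  has_meets : ∀ x y : α, ∃ z, IsGLB {x, y} z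
  leaves_everywhere : ∀ x : α, ∃ y, x ≤ y ∧ IsMax y
  node_eq_meet : ∀ x : α, ¬ IsMax x → ∃ a b : α, IsMax a ∧ IsMax b ∧ a ≠ b ∧ IsGLB {a, b} x

/-- The cone of `y` at `x`, for `x < y`. -/
def cone (x y : α) : Set α := {t | x < meet t y}

/-- The set of all cones at `x`. -/
def conesAt (x : α) : Set (Set α) := {C | ∃ y, x < y ∧ C = cone x y}

/-- The set of leaves that have `x` as predecessor. -/
def leavesAt (x : α) : Set α := {a | IsMax a ∧ x ⋖ a}

/-- A nonempty, densely ordered set without a first element (an interval that is open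
on the left, at `-∞`). -/
def IsLeftOpenDense (s : Set α) : Prop :=
  s.Nonempty ∧ (∀ x ∈ s, ∃ y ∈ s, y < x) ∧ ∀ x ∈ s, ∀ y ∈ s, x < y → ∃ z ∈ s, x < z ∧ z < y

/-- Type (0): a unique node, with `m` leaves. -/
def IsType0 (m : ℕ∞) (α : Type) [PartialOrder α] : Prop :=
  (∃! r : α, ¬ IsMax r) ∧ {a : α | IsMax a}.encard = m

/-- Type (1.a). -/
def IsType1a (μ : ℕ∞) (α : Type) [PartialOrder α] : Prop :=
  (∀ a : α, IsMax a → IsLeftOpenDense (Set.Iio a)) ∧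
  ∀ x : α, ¬ IsMax x → (conesAt x).encard = μ ∧ ∀ C ∈ conesAt x, C.Infinite

/-- Type (1.b). -/
def IsType1b (m μ : ℕ∞) (α : Type) [PartialOrder α] : Prop :=
  (∀ a : α, IsMax a → ∃ x, x ⋖ a ∧ IsLeftOpenDense (Set.Iic x)) ∧
  ∀ x : α, ¬ IsMax x → (leavesAt x).encard = m ∧ {C ∈ conesAt x | C.Infinite}.encard = μ

/-- One-colored good trees (not reduced to a single leaf) of branching color `(m, μ)`, where
`m` and `μ` are integers or `∞`. The type is (0) iff `μ = 0`, it is (1.a) iff `m = 0`, and (1.b)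
iff `m, μ ≥ 1`. -/
def IsOneColored (m μ : ℕ∞) (α : Type) [PartialOrder α] : Prop :=
  IsGoodTree α ∧
  ((2 ≤ m ∧ μ = 0 ∧ IsType0 m α) ∨ (m = 0 ∧ 2 ≤ μ ∧ IsType1a μ α) ∨
    (1 ≤ m ∧ 1 ≤ μ ∧ IsType1b m μ α))

end Order

/-! ### Languages

`treeLang k` is the language with `k` additional function symbols, `{L, N, ≤, ∧}` together with
`e_1, …, e_k`, `E_1, …, E_k`, `E_{≥,1}, …, E_{≥,k}`: this is the language of trees with
`n = k + 1` colors. Partial functions are made total: outside its domain, which is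
always named by a predicate, a function takes the value `x` at `x`. -/

inductive TreeFunc (k : ℕ) : ℕ → Type
  | meet : TreeFunc k 2
  | e (i : Fin k) : TreeFunc k 1

inductive TreeRel (k : ℕ) : ℕ → Type
  | le : TreeRel k 2
  | leaf : TreeRel k 1
  | node : TreeRel k 1
  | E (i : Fin k) : TreeRel k 1
  | Ege (i : Fin k) : TreeRel k 1

def treeLang (k : ℕ) : FirstOrder.Language.{0, 0} := ⟨TreeFunc k, TreeRel k⟩

/-- The symbols `p` (predecessor), `D` (its domain), `F` (its image). -/
inductive PredFunc : ℕ → Type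
  | p : PredFunc 1

inductive PredRel : ℕ → Type
  | D : PredRel 1
  | F : PredRel 1

def predLang : FirstOrder.Language.{0, 0} := ⟨PredFunc, PredRel⟩

/-- The language `treeLang k` together with `p, D, F`. -/
abbrev treeLangPlus (k : ℕ) : FirstOrder.Language.{0, 0} := (treeLang k).sum predLang

/-- The inclusion of the language `{L, N, ≤, ∧}` in `treeLang k`. -/
def inclLang (k : ℕ) : treeLang 0 →ᴸ treeLang k where
  onFunction := fun _ f => match f with
    | .meet => TreeFunc.meet
    | .e i => i.elim0
  onRelation := fun _ r => match r with
    | .le => TreeRel.le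
    | .leaf => TreeRel.leaf
    | .node => TreeRel.node
    | .E i => i.elim0
    | .Ege i => i.elim0

/-- A partial order with an interpretation of the symbols `e_i`, `E_i`, `E_{≥,i}`. -/
structure ETree (k : ℕ) where
  carrier : Type
  [order : PartialOrder carrier]
  e : Fin k → carrier → carrier
  E : Fin k → Set carrier
  Ege : Fin k → Set carrier

attribute [instance] ETree.order

/-- A partial order as a structure without additional symbols. -/
def pureTree (α : Type) [PartialOrder α] : ETree 0 where
  carrier := α
  e := fun i => i.elim0
  E := fun i => i.elim0
  Ege := fun i => i.elim0

/-- The natural interpretation of `treeLang k`. -/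
noncomputable instance treeStructure {k : ℕ} (T : ETree k) : (treeLang k).Structure T.carrier where
  funMap := fun f v => match f with
    | .meet => meet (v 0) (v 1)
    | .e i => T.e i (v 0)
  RelMap := fun r v => match r with
    | .le => v 0 ≤ v 1
    | .leaf => IsMax (v 0)
    | .node => ¬ IsMax (v 0)
    | .E i => v 0 ∈ T.E i
    | .Ege i => v 0 ∈ T.Ege i

/-- `y` is the predecessor of `x`, in terms of the relation `≤` of a structure. -/
def IsPred (k : ℕ) {M : Type} [(treeLang k).Structure M] (y x : M) : Prop :=
  let le : M → M → Prop := fun a b => Structure.RelMap (L := treeLang k) TreeRel.le ![a, b]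
  (le y x ∧ y ≠ x) ∧ ∀ z, ¬ ((le y z ∧ y ≠ z) ∧ (le z x ∧ z ≠ x))

open Classical in
/-- The interpretation of `p, D, F` in a structure. -/
@[reducible] noncomputable def predStructure (k : ℕ) (M : Type) [(treeLang k).Structure M] :
    predLang.Structure M where
  funMap := fun f v => match f with
    | .p => if h : ∃ y, IsPred k y (v 0) then h.choose else v 0
  RelMap := fun r v => match r with
    | .D => ∃ y, IsPred k y (v 0)
    | .F => ∃ x, IsPred k (v 0) x

/-- `S` eliminates quantifiers in `treeLang k ∪ {p, D, F}`: every formula of this language is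
equivalent to a quantifier free one in all models of `S`. -/
def EliminatesQuantifiers {k : ℕ} (S : (treeLang k).Theory) : Prop :=
  ∀ (j : ℕ) (φ : (treeLangPlus k).Formula (Fin j)),
    ∃ ψ : (treeLangPlus k).Formula (Fin j), BoundedFormula.IsQF ψ ∧
      ∀ (M : Type) [(treeLang k).Structure M], M ⊨ S →
        letI : predLang.Structure M := predStructure k M
        ∀ v : Fin j → M, φ.Realize v ↔ ψ.Realize v

/-- The restriction of a theory to the language `{L, N, ≤, ∧}`. -/
def pureRestriction {k : ℕ} (S : (treeLang k).Theory) : (treeLang 0).Theory :=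
  {φ | S ⊨ᵇ (inclLang k).onSentence φ}

/-! ### The extension `T ⋊ T₀` -/

section Extension

variable {k : ℕ} (T : ETree k) (T₀ : ETree 0)

/-- The disjoint union of the set of nodes of `T` and of (leaves of `T`) × `T₀`. -/
abbrev ExtCarrier : Type :=
  {x : T.carrier // ¬ IsMax x} ⊕ ({x : T.carrier // IsMax x} × T₀.carrier)

def extLE : ExtCarrier T T₀ → ExtCarrier T T₀ → Prop
  | .inl x, .inl y => x.1 ≤ y.1
  | .inl x, .inr b => x.1 ≤ b.1.1
  | .inr _, .inl _ => False
  | .inr a, .inr b => a.1 = b.1 ∧ a.2 ≤ b.2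

@[reducible] def extOrder : PartialOrder (ExtCarrier T T₀) where
  le := extLE T T₀
  lt := fun a b => extLE T T₀ a b ∧ ¬ extLE T T₀ b a
  lt_iff_le_not_ge := fun _ _ => Iff.rfl
  le_refl := by
    rintro (x | a)
    · exact le_refl x.1
    · exact ⟨rfl, le_refl a.2⟩
  le_trans := by
    rintro (x | a) (y | b) (z | c) h₁ h₂
    · exact le_trans (α := T.carrier) h₁ h₂
    · exact le_trans (α := T.carrier) h₁ h₂
    · exact h₂.elim
    · have h₁' : x.1 ≤ b.1.1 := h₁
      have h₂' : b.1 = c.1 ∧ b.2 ≤ c.2 := h₂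
      show x.1 ≤ c.1.1
      rw [← h₂'.1]
      exact h₁'
    · exact h₁.elim
    · exact h₁.elim
    · exact h₂.elim
    · exact ⟨h₁.1.trans h₂.1, h₁.2.trans h₂.2⟩
  le_antisymm := by
    rintro (x | a) (y | b) h₁ h₂
    · exact congrArg Sum.inl (Subtype.ext (le_antisymm (α := T.carrier) h₁ h₂))
    · exact h₂.elim
    · exact h₁.elim
    · exact congrArg Sum.inr (Prod.ext h₁.1 (le_antisymm h₁.2 h₂.2))

open Classical in
/-- The new function `e`: it sends `(α, t)` to `(α, r₀)` if `T₀` has a root `r₀`, and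
to the predecessor of `α` if `T₀` has no root; it is the identity on the nodes of `T`. -/
noncomputable def extNewE : ExtCarrier T T₀ → ExtCarrier T T₀
  | .inl x => .inl x
  | .inr a =>
    if h : ∃ r : T₀.carrier, IsBot r then .inr (a.1, h.choose)
    else if h' : ∃ y : T.carrier, y ⋖ a.1.1 then
      .inl ⟨h'.choose, not_isMax_of_lt h'.choose_spec.lt⟩
    else .inr a

/-- The image of the (leaves of `T`) × `T₀` under the new function `e`. -/
def extNewImage : Set (ExtCarrier T T₀) := {y | ∃ a, extNewE T T₀ (.inr a) = y}

open Classical in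
/-- An old function `f`, extended by `f (α, t) = f α`. -/
noncomputable def extOldE (f : T.carrier → T.carrier) : ExtCarrier T T₀ → ExtCarrier T T₀
  | .inl x => if h : ¬ IsMax (f x.1) then .inl ⟨f x.1, h⟩ else .inl x
  | .inr a => if h : ¬ IsMax (f a.1.1) then .inl ⟨f a.1.1, h⟩ else .inr a

/-- The tree `T ⋊ T₀`; the new symbols have the last index. -/
noncomputable def ext : ETree (k + 1) where
  carrier := ExtCarrier T T₀
  order := extOrder T T₀
  e := Fin.lastCases (extNewE T T₀) (fun i => extOldE T T₀ (T.e i))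
  E := Fin.lastCases (extNewImage T T₀) (fun i => {y | ∃ x, x.1 ∈ T.E i ∧ y = .inl x})
  Ege := Fin.lastCases {x | ∃ y ∈ extNewImage T T₀, extLE T T₀ y x}
    (fun i => {y | (∃ x, x.1 ∈ T.Ege i ∧ y = .inl x) ∨ ∃ a, y = .inr a})

end Extension

/-! ### Colored good trees -/

/-- The tree `(…(T_1 ⋊ T_2) ⋊ …) ⋊ T_{k+1}`. -/
noncomputable def iterExt : (k : ℕ) → (Fin (k + 1) → ETree 0) → ETree k
  | 0, T => T 0
  | k + 1, T => ext (iterExt k (fun i => T i.castSucc)) (T (Fin.last (k + 1)))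

/-- The tree `T_i` is one-colored of branching color `c i`, and every tree of type (1.a) is
followed by a tree of type (0). -/
def IsColoredSeq (k : ℕ) (c : Fin (k + 1) → ℕ∞ × ℕ∞) (T : Fin (k + 1) → ETree 0) : Prop :=
  (∀ i, IsOneColored (c i).1 (c i).2 (T i).carrier) ∧
  ∀ i : Fin k, (c i.castSucc).1 = 0 → (c i.succ).2 = 0

/-- A colored good tree that is an iterated extension of `k + 1` one-colored good trees. -/
def IsIterExt (k : ℕ) (X : Type) [PartialOrder X] : Prop :=
  ∃ c T, IsColoredSeq k c T ∧ Nonempty (X ≃o (iterExt k T).carrier)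

/-- The `(k+1)`-colored good trees: the iterated extensions of `k + 1` one-colored good trees that
are not an iterated extension of fewer ones. -/
def IsColored (k : ℕ) (X : Type) [PartialOrder X] : Prop :=
  IsIterExt k X ∧ ∀ j < k, ¬ IsIterExt j X

/-! ### The theories `Σ_{m,μ}` and `Σ ⋊ Σ₀`

Each theory is given with all its consequences, as the set of the sentences true in all
structures which satisfy the axioms. -/

/-- The theory `Σ_{m,μ}` of one-colored good trees of branching color `(m, μ)`. -/
def oneTheory (c : ℕ∞ × ℕ∞) : (treeLang 0).Theory :=
  {φ | ∀ T : ETree 0, IsOneColored c.1 c.2 T.carrier → T.carrier ⊨ φ}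

section ExtTheory

variable {k : ℕ} (Λ : ETree (k + 1))

/-- The two sentences expressing in `T ⋊ T₀` that `T₀` has a root: every leaf has a predecessor, and
the predecessors of leaves form an antichain. -/
def Rooted : Prop :=
  (∀ a : Λ.carrier, IsMax a → ∃ x, x ⋖ a) ∧
  ∀ a b x y : Λ.carrier, IsMax a → IsMax b → x ⋖ a → y ⋖ b → ¬ x < y

abbrev lastE : Λ.carrier → Λ.carrier := Λ.e (Fin.last k)
abbrev lastIm : Set Λ.carrier := Λ.E (Fin.last k)
abbrev lastDom : Set Λ.carrier := Λ.Ege (Fin.last k)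

/-- `E_≤`, the union of `E` and of the complement of `E_≥`. -/
def lastLe : Set Λ.carrier := {x | x ∉ lastDom Λ ∨ x ∈ lastIm Λ}

/-- The equivalence relation `∼`. -/
def Sim (x y : Λ.carrier) : Prop :=
  x = y ∨ (x ∈ lastDom Λ ∧ y ∈ lastDom Λ ∧ lastE Λ x = lastE Λ y ∧
    (¬ Rooted Λ → lastE Λ x < meet x y))

/-- The basic axioms on the tree and on `e, E, E_≥`. -/
structure BaseAxioms : Prop where
  good : IsGoodTree Λ.carrier
  convex : ∀ x y z : Λ.carrier, x ∈ lastIm Λ → z ∈ lastIm Λ → x < y → y < z → y ∈ lastIm Λ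
  dom_eq : lastDom Λ = {x | ∃ y ∈ lastIm Λ, y ≤ x}
  im_eq : lastIm Λ = lastE Λ '' lastDom Λ
  eq_self : ∀ x, x ∉ lastDom Λ → lastE Λ x = x
  leaf_mem : ∀ a : Λ.carrier, IsMax a → a ∈ lastDom Λ ∧ a ∉ lastIm Λ
  le_self : ∀ x ∈ lastDom Λ, lastE Λ x ≤ x
  greatest : ∀ x ∈ lastDom Λ, IsGreatest (lastIm Λ ∩ Set.Iic x) (lastE Λ x)

/-- `Q`, with the projection `π`, is the quotient of `Λ` modulo `∼`, with the order induced by the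
one of `Λ`, and the old functions, their images and their domains on `Q` are those induced by `Λ`. -/
structure IsQuotient (Q : ETree k) (π : Λ.carrier → Q.carrier) : Prop where
  surj : Function.Surjective π
  eq_iff : ∀ x y, π x = π y ↔ Sim Λ x y
  lt_iff : ∀ a b, a < b ↔ a ≠ b ∧ ∃ u v, π u = a ∧ π v = b ∧ u < v
  dom_iff : ∀ (i : Fin k) x, π x ∈ Q.Ege i ↔ x ∈ Λ.Ege i.castSucc
  im_iff : ∀ (i : Fin k) x, π x ∈ Q.E i ↔ x ∈ Λ.E i.castSucc
  map_e : ∀ (i : Fin k), ∀ x ∈ Λ.Ege i.castSucc, π (Λ.e i.castSucc x) = Q.e i (π x)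

/-- `Λ` is a model of the axioms of `S ⋊ S₀`. -/
structure IsExtModel (S : (treeLang k).Theory) (S₀ : (treeLang 0).Theory) : Prop where
  base : BaseAxioms Λ
  /-- The classes modulo `∼` are, as pure trees, models of `S₀`. -/
  classes : ∀ x ∈ lastDom Λ, (Rooted Λ ∨ x ∉ lastIm Λ) →
    (pureTree {y : Λ.carrier // Sim Λ x y}).carrier ⊨ S₀
  /-- The quotient modulo `∼` is a model of `S`; in the case without root its leaves
  have predecessors and the image of `E` is the set of these predecessors. -/
  quot : ∃ (Q : ETree k) (π : Λ.carrier → Q.carrier), IsQuotient Λ Q π ∧ Q.carrier ⊨ S ∧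
    (¬ Rooted Λ → (∀ a : Q.carrier, IsMax a → ∃ y, y ⋖ a) ∧
      π '' lastIm Λ = {y | ∃ a, IsMax a ∧ y ⋖ a})
  /-- The old functions are the identity outside of their domain, -/
  old_eq_self : ∀ (i : Fin k) x, x ∉ Λ.Ege i.castSucc → Λ.e i.castSucc x = x
  /-- they map `E_≤` to `E_≤`, -/
  old_le : ∀ (i : Fin k), ∀ x ∈ lastLe Λ, x ∈ Λ.Ege i.castSucc → Λ.e i.castSucc x ∈ lastLe Λ
  /-- and they are given on `E_≥` by `f x = f (e x)`. -/
  old_ge : ∀ (i : Fin k), ∀ x ∈ lastDom Λ,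
    (x ∈ Λ.Ege i.castSucc ↔ lastE Λ x ∈ Λ.Ege i.castSucc) ∧
    (x ∈ Λ.Ege i.castSucc → Λ.e i.castSucc x = Λ.e i.castSucc (lastE Λ x))

end ExtTheory

/-- The theory `S ⋊ S₀`. -/
def extTheory {k : ℕ} (S : (treeLang k).Theory) (S₀ : (treeLang 0).Theory) :
    (treeLang (k + 1)).Theory :=
  {φ | ∀ Λ : ETree (k + 1), IsExtModel Λ S S₀ → Λ.carrier ⊨ φ}

/-- The theory `(…(Σ_{m_1,μ_1} ⋊ Σ_{m_2,μ_2}) ⋊ …) ⋊ Σ_{m_{k+1},μ_{k+1}}`. -/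
def iterTheory : (k : ℕ) → (Fin (k + 1) → ℕ∞ × ℕ∞) → (treeLang k).Theory
  | 0, c => oneTheory (c 0)
  | k + 1, c => extTheory (iterTheory k (fun i => c i.castSucc)) (oneTheory (c (Fin.last (k + 1))))

/-- The set `S_{k+1}`: the theories `Σ_{m_1,μ_1} ⋊ … ⋊ Σ_{m_{k+1},μ_{k+1}}`, for all
`(k+1)`-colored good trees `(…(T_1 ⋊ T_2) ⋊ …) ⋊ T_{k+1}` with `T_i` of branching color `(m_i,μ_i)`. -/
def coloredTheories (k : ℕ) : Set (treeLang k).Theory :=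
  {S | ∃ c T, IsColoredSeq k c T ∧ IsColored k (iterExt k T).carrier ∧ S = iterTheory k c}

end GoodTrees

open GoodTrees

/-! All trees in question can be cut into levels. In an iterated extension the nodes coming from one
factor form a level and the leaves form the top level. Each node x of level i sees two kinds of
cones: inner ones, which still contain elements of the level of x, and border ones, which leave it
at once. They number μ and m respectively, where (m, μ) is the color `c i`. `IsLeveled` records this
local picture together with density, absence of a first element when μ ≠ 0, and existence of a last
element of the level below any higher point when m ≠ 0. This last element is given by `low`.

Completeness and quantifier elimination come from one back-and-forth argument. Between two leveled
trees with the same colors, consider finite partial isomorphisms that preserve levels and are closed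
under meets and under `low` (`IsMatching`). Closing a finite set under these operations keeps it
finite, so a new element can be reached by adding missing points from the bottom up. A missing point
may lie below the domain; then it sits in a gap, and the target has a point of the same level in the
matching gap (`IsMatching.exists_insert_below`). Otherwise it opens a new cone at the greatest
domain point below it, and equality of the cone counts yields a free cone of the same kind in the
target (`IsMatching.exists_insert_above`).

In a flat structure (`IsFlat`) the symbols are read off from the levels: `e_j` is `low` at level
`eLevel c j`. With p added, every required value of `low` is the value of a term of bounded shape.
Hence finite partial isomorphisms of the expanded language are exactly finite matchings, and
finitely many terms exhaust the substructure generated by a tuple. So flat structures with the same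
colors satisfy the same sentences and eliminate quantifiers uniformly.

What remains is to place the theories. Flatness is first order (`axiomatizable_rawFlat`), so it is
enough to check it on the structures that define the theories. There the quotient map replaces the
leaves of a leveled tree by trees with one level, which gives a leveled tree
(`IsLeafFibration.isLeveled`, `IsExtModel.exists_isFlatTree`). Conversely, an iterated extension
satisfies the axioms (`isExtModel_ext`). Thus each theory is the complete theory of any
corresponding extension (`iterTheory_eq_completeTheory`), and both parts of the theorem follow. -/

namespace GoodTrees

/-! ### Leveled trees -/

section Leveled

variable {X : Type} [PartialOrder X]

/-- The cone of `y` at `x`, described without meets. -/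
def coneOf (x y : X) : Set X := {t | ∃ z, x < z ∧ z ≤ t ∧ z ≤ y}

theorem mem_coneOf_self {x y : X} (hxy : x < y) : y ∈ coneOf x y := ⟨y, hxy, le_rfl, le_rfl⟩

/-- Two elements below the same point are comparable, so the lower of two witnesses serves for both
memberships. Thus the cones at x partition what lies above x. -/
theorem coneOf_eq_of_mem (hlin : ∀ x y z : X, y ≤ x → z ≤ x → y ≤ z ∨ z ≤ y) {x y t : X}
    (ht : t ∈ coneOf x y) : coneOf x t = coneOf x y := by
  obtain ⟨z, hxz, hzt, hzy⟩ := ht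
  ext s
  constructor
  · rintro ⟨w, hw, hws, hwt⟩
    rcases hlin t z w hzt hwt with h1 | h1
    · exact ⟨z, hxz, h1.trans hws, hzy⟩
    · exact ⟨w, hw, hws, h1.trans hzy⟩
  · rintro ⟨w, hw, hws, hwy⟩
    rcases hlin y z w hzy hwy with h1 | h1
    · exact ⟨z, hxz, h1.trans hws, hzt⟩
    · exact ⟨w, hw, hws, h1.trans hzt⟩

/-- The elements above `x` whose cone at `x` leaves the level of `x` immediately. -/
def borderAbove (lev : X → ℕ) (x : X) : Set X :=
  {y | x < y ∧ ∀ z, x < z → z ≤ y → lev z ≠ lev x}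

/-- The elements above `x` on the level of `x`. -/
def innerAbove (lev : X → ℕ) (x : X) : Set X := {y | x < y ∧ lev y = lev x}

/-- A tree cut into `n` levels of nodes, the leaves being of level `n`, where the part of
level `i` looks like a one-colored tree of branching color `c i`. -/
structure IsLeveled (n : ℕ) (c : ℕ → ℕ∞ × ℕ∞) (lev : X → ℕ) : Prop where
  nonempty : Nonempty X
  linear_below : ∀ x y z : X, y ≤ x → z ≤ x → y ≤ z ∨ z ≤ y
  has_meets : ∀ x y : X, ∃ z, IsGLB {x, y} z
  le_leaf : ∀ x : X, ∃ y, x ≤ y ∧ IsMax y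
  mono : ∀ x y : X, x ≤ y → lev x ≤ lev y
  lev_le : ∀ x, lev x ≤ n
  max_iff : ∀ x, IsMax x ↔ lev x = n
  below : ∀ x i, i < lev x → ∃ y ≤ x, lev y = i
  no_first : ∀ x, lev x < n → (c (lev x)).2 ≠ 0 → ∃ y < x, lev y = lev x
  dense : ∀ x y, lev x < n → (c (lev x)).2 ≠ 0 → lev y = lev x → x < y → ∃ z, x < z ∧ z < y
  last : ∀ x i, i < lev x → (c i).1 ≠ 0 → ∃ y, IsGreatest {z | z ≤ x ∧ lev z = i} y
  border_count : ∀ x, lev x < n → (coneOf x '' borderAbove lev x).encard = (c (lev x)).1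
  inner_count : ∀ x, lev x < n → (coneOf x '' innerAbove lev x).encard = (c (lev x)).2

/-- The condition on the sequences of branching colors under which levels are determined. -/
structure IsValidSeq (n : ℕ) (c : ℕ → ℕ∞ × ℕ∞) : Prop where
  ne_zero : ∀ i < n, (c i).2 = 0 → (c i).1 ≠ 0
  succ : ∀ i, i + 1 < n → (c i).1 = 0 → (c (i + 1)).2 = 0

open Classical in
/-- The greatest element of level `i` below `x`, and `x` if there is none. -/
noncomputable def low (lev : X → ℕ) (i : ℕ) (x : X) : X :=
  if h : ∃ y, IsGreatest {z | z ≤ x ∧ lev z = i} y then h.choose else x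

theorem low_eq {lev : X → ℕ} {i : ℕ} {x y : X} (h : IsGreatest {z | z ≤ x ∧ lev z = i} y) :
    low lev i x = y := by
  have h' : ∃ y, IsGreatest {z | z ≤ x ∧ lev z = i} y := ⟨y, h⟩
  rw [low, dif_pos h']
  exact h'.choose_spec.unique h

theorem low_le (lev : X → ℕ) (i : ℕ) (x : X) : low lev i x ≤ x := by
  by_cases h : ∃ y, IsGreatest {z | z ≤ x ∧ lev z = i} y
  · rw [low, dif_pos h]; exact h.choose_spec.1.1
  · rw [low, dif_neg h]

theorem low_of_level (lev : X → ℕ) (x : X) : low lev (lev x) x = x :=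
  low_eq ⟨⟨le_rfl, rfl⟩, fun _ h => h.1⟩

/-! ### Meets, levels and cones in a leveled tree -/

namespace IsLeveled

variable {n : ℕ} {c : ℕ → ℕ∞ × ℕ∞} {lev : X → ℕ} (h : IsLeveled n c lev)

include h

theorem meet_isGLB (x y : X) : IsGLB {x, y} (meet x y) := by
  have := h.has_meets x y
  rw [meet, dif_pos this]; exact this.choose_spec

theorem le_meet_iff {x y z : X} : z ≤ meet x y ↔ z ≤ x ∧ z ≤ y := by
  rw [le_isGLB_iff (h.meet_isGLB x y)]; simp

theorem meet_le_left (x y : X) : meet x y ≤ x := (h.le_meet_iff.1 le_rfl).1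

theorem meet_le_right (x y : X) : meet x y ≤ y := (h.le_meet_iff.1 le_rfl).2

theorem meet_comm (x y : X) : meet x y = meet y x :=
  eq_of_forall_le_iff fun z => by rw [h.le_meet_iff, h.le_meet_iff, and_comm]

theorem meet_self (x : X) : meet x x = x :=
  eq_of_forall_le_iff fun z => by rw [h.le_meet_iff, and_self]

theorem meet_eq_left {x y : X} (hxy : x ≤ y) : meet x y = x :=
  eq_of_forall_le_iff fun z => by
    rw [h.le_meet_iff]; exact ⟨fun h => h.1, fun h => ⟨h, h.trans hxy⟩⟩

/-- Below a common bound any two elements are comparable and levels are monotone, so a strict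
difference of levels decides the order. -/
theorem level_lt {x y z : X} (hx : x ≤ z) (hy : y ≤ z) (hl : lev x < lev y) : x < y := by
  rcases h.linear_below z x y hx hy with h1 | h1
  · exact lt_of_le_of_ne h1 (by rintro rfl; exact hl.ne rfl)
  · exact absurd (h.mono _ _ h1) (by omega)

theorem level_lt_of_lt {x y : X} (hxy : x < y) : lev x < n := by
  refine lt_of_le_of_ne (h.lev_le x) fun e => ?_
  exact ((h.max_iff x).2 e).not_lt hxy

theorem low_eq_self {i : ℕ} {x : X} (hi : lev x ≤ i) : low lev i x = x := by
  rcases hi.eq_or_lt with rfl | hi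
  · exact low_of_level lev x
  · rw [low, dif_neg]
    rintro ⟨y, hy⟩
    have := h.mono _ _ hy.1.1
    have := hy.1.2
    omega

theorem low_isGreatest {i : ℕ} {x : X} (hi : i ≤ lev x) (hc : (c i).1 ≠ 0) :
    IsGreatest {z | z ≤ x ∧ lev z = i} (low lev i x) := by
  rcases hi.eq_or_lt with rfl | hi
  · rw [low_of_level]; exact ⟨⟨le_rfl, rfl⟩, fun _ h => h.1⟩
  · obtain ⟨y, hy⟩ := h.last x i hi hc
    rwa [low_eq hy]

/-- An element of level i below x is automatically below z, because z has a higher level. So x and z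
see the same elements of level i beneath them. -/
theorem low_eq_of_le {i : ℕ} {x z : X} (hzx : z ≤ x) (hi : i < lev z) (hc : (c i).1 ≠ 0) :
    low lev i z = low lev i x := by
  have hx := h.low_isGreatest (hi.le.trans (h.mono _ _ hzx)) hc
  refine low_eq ⟨⟨(h.level_lt hx.1.1 hzx ?_).le, hx.1.2⟩, fun w hw => hx.2 ⟨hw.1.trans hzx, hw.2⟩⟩
  rw [hx.1.2]; exact hi

theorem lev_low {i : ℕ} {x : X} (hi : i ≤ lev x) (hc : (c i).1 ≠ 0) : lev (low lev i x) = i :=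
  (h.low_isGreatest hi hc).1.2

/-- Both z and the meet of b and d lie below b, hence are comparable. This dichotomy is what keeps
closures under meets and `low` finite. -/
theorem meet_of_le {b z d : X} (hz : z ≤ b) : meet z d = z ∨ meet z d = meet b d := by
  rcases h.linear_below b z (meet b d) hz (h.meet_le_left b d) with h1 | h1
  · exact Or.inl (h.meet_eq_left (h1.trans (h.meet_le_right b d)))
  · refine Or.inr (eq_of_forall_le_iff fun w => ?_)
    rw [h.le_meet_iff]
    refine ⟨fun hw => h.le_meet_iff.2 ⟨hw.1.trans hz, hw.2⟩, fun hw => ⟨hw.trans h1, ?_⟩⟩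
    exact hw.trans (h.meet_le_right b d)

/-- On a level without inner cones there are no comparable elements. -/
theorem not_lt_of_level_eq {x y : X} (hx : (c (lev x)).2 = 0) (hxy : x < y) : lev y ≠ lev x := by
  intro e
  have h1 := h.inner_count x (h.level_lt_of_lt hxy)
  rw [hx, Set.encard_eq_zero, Set.image_eq_empty] at h1
  exact Set.notMem_empty y (h1 ▸ ⟨hxy, e⟩)

/-- If there are no border cones, every cone contains elements of the same level. -/
theorem exists_level_eq {x y : X} (hx : (c (lev x)).1 = 0) (hxy : x < y) :
    ∃ z, x < z ∧ z ≤ y ∧ lev z = lev x := by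
  by_contra! hc
  have h1 := h.border_count x (h.level_lt_of_lt hxy)
  rw [hx, Set.encard_eq_zero, Set.image_eq_empty] at h1
  exact Set.notMem_empty y (h1 ▸ ⟨hxy, hc⟩)

theorem exists_above {x : X} {l : ℕ} (hl : lev x < l) (hn : l ≤ n) : ∃ y, x < y ∧ lev y = l := by
  obtain ⟨a, hxa, ha⟩ := h.le_leaf x
  have ha' := (h.max_iff a).1 ha
  rcases hn.eq_or_lt with rfl | hn
  · exact ⟨a, lt_of_le_of_ne hxa (by rintro rfl; omega), ha'⟩
  · obtain ⟨y, hy, hyl⟩ := h.below a l (by omega)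
    exact ⟨y, h.level_lt hxa hy (by omega), hyl⟩

theorem exists_level {l : ℕ} (hn : l ≤ n) : ∃ y, lev y = l := by
  obtain ⟨x⟩ := h.nonempty
  obtain ⟨a, hxa, ha⟩ := h.le_leaf x
  have ha' := (h.max_iff a).1 ha
  rcases hn.eq_or_lt with rfl | hn
  · exact ⟨a, ha'⟩
  · obtain ⟨y, hy, hyl⟩ := h.below a l (by omega)
    exact ⟨y, hyl⟩

theorem coneOf_eq {x y t : X} (ht : t ∈ coneOf x y) : coneOf x t = coneOf x y :=
  coneOf_eq_of_mem h.linear_below ht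

theorem mem_coneOf_iff {x y t : X} : t ∈ coneOf x y ↔ x < meet t y := by
  constructor
  · rintro ⟨z, hxz, hzt, hzy⟩
    exact hxz.trans_le (h.le_meet_iff.2 ⟨hzt, hzy⟩)
  · exact fun hx => ⟨_, hx, h.meet_le_left t y, h.meet_le_right t y⟩

theorem coneOf_eq_iff {x y t : X} (ht : x < t) : coneOf x t = coneOf x y ↔ t ∈ coneOf x y :=
  ⟨fun e => e ▸ mem_coneOf_self ht, h.coneOf_eq⟩

/-- A cone leaves the level of x at once exactly when x is the last element of its level below y.
This expresses the kind of a cone by levels and `low`, which matchings preserve. -/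
theorem border_iff {x y : X} (hxy : x < y) :
    y ∈ borderAbove lev x ↔ lev y ≠ lev x ∧ (c (lev x)).1 ≠ 0 ∧ low lev (lev x) y = x := by
  have hl := h.mono _ _ hxy.le
  constructor
  · intro hy
    have h1 : (c (lev x)).1 ≠ 0 := fun h0 => by
      obtain ⟨z, h1, h2, h3⟩ := h.exists_level_eq h0 hxy
      exact hy.2 z h1 h2 h3
    refine ⟨hy.2 y hxy le_rfl, h1, low_eq ⟨⟨hxy.le, rfl⟩, fun z hz => ?_⟩⟩
    rcases h.linear_below y z x hz.1 hxy.le with h2 | h2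
    · exact h2
    · rcases h2.eq_or_lt with rfl | h2
      · exact le_rfl
      · exact absurd hz.2 (hy.2 z h2 hz.1)
  · rintro ⟨h1, h2, h3⟩
    refine ⟨hxy, fun z hz hzy e => ?_⟩
    have := (h.low_isGreatest hl h2).2 ⟨hzy, e⟩
    rw [h3] at this
    exact absurd hz this.not_gt

end IsLeveled

end Leveled

/-! ### Matchings between leveled trees -/

section Matching

variable {X Y : Type} [PartialOrder X] [PartialOrder Y]

/-- The graph of an isomorphism between subsets of two leveled trees that are closed under meets
and under taking the last element of a level. -/
structure IsMatching (n : ℕ) (c : ℕ → ℕ∞ × ℕ∞) (lev : X → ℕ) (lev' : Y → ℕ)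
    (P : X → Y → Prop) : Prop where
  level : ∀ a a', P a a' → lev a = lev' a'
  le_iff : ∀ a a' b b', P a a' → P b b' → (a ≤ b ↔ a' ≤ b')
  meet : ∀ a a' b b', P a a' → P b b' → P (meet a b) (meet a' b')
  low : ∀ a a' i, P a a' → i < n → (c i).1 ≠ 0 → P (low lev i a) (low lev' i a')

namespace IsMatching

variable {n : ℕ} {c : ℕ → ℕ∞ × ℕ∞} {lev : X → ℕ} {lev' : Y → ℕ} {P : X → Y → Prop}

theorem symm (hP : IsMatching n c lev lev' P) :
    IsMatching n c lev' lev (fun a a' => P a' a) where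
  level _ _ h := (hP.level _ _ h).symm
  le_iff _ _ _ _ h h' := (hP.le_iff _ _ _ _ h h').symm
  meet _ _ _ _ h h' := hP.meet _ _ _ _ h h'
  low _ _ i h := hP.low _ _ i h

theorem eq_iff (hP : IsMatching n c lev lev' P) {a b : X} {a' b' : Y} (h : P a a')
    (h' : P b b') : a = b ↔ a' = b' := by
  rw [le_antisymm_iff, le_antisymm_iff, hP.le_iff _ _ _ _ h h', hP.le_iff _ _ _ _ h' h]

theorem lt_iff (hP : IsMatching n c lev lev' P) {a b : X} {a' b' : Y} (h : P a a')
    (h' : P b b') : a < b ↔ a' < b' := by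
  rw [lt_iff_le_not_ge, lt_iff_le_not_ge, hP.le_iff _ _ _ _ h h', hP.le_iff _ _ _ _ h' h]

theorem finite_range (hP : IsMatching n c lev lev' P) (hfin : {a | ∃ a', P a a'}.Finite) :
    {a' | ∃ a, P a a'}.Finite := by
  have := hfin.to_subtype
  refine (Set.finite_range fun a : {a | ∃ a', P a a'} => a.2.choose).subset ?_
  rintro a' ⟨a, ha⟩
  have h : ∃ a', P a a' := ⟨a', ha⟩
  exact ⟨⟨a, h⟩, (hP.eq_iff h.choose_spec ha).1 rfl⟩

/-- A sufficient condition for extending a matching by one pair. -/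
theorem insert (hX : IsLeveled n c lev) (hY : IsLeveled n c lev') (hP : IsMatching n c lev lev' P)
    {x : X} {x' : Y} (hl : lev x = lev' x')
    (h1 : ∀ a a', P a a' → (x ≤ a ↔ x' ≤ a')) (h2 : ∀ a a', P a a' → (a ≤ x ↔ a' ≤ x'))
    (h3 : ∀ a a', P a a' → P (GoodTrees.meet x a) (GoodTrees.meet x' a') ∨
      GoodTrees.meet x a = x ∧ GoodTrees.meet x' a' = x')
    (h4 : ∀ i < n, (c i).1 ≠ 0 → i < lev x →
      P (GoodTrees.low lev i x) (GoodTrees.low lev' i x')) :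
    IsMatching n c lev lev' (fun a a' => P a a' ∨ a = x ∧ a' = x') where
  level := by
    rintro a a' (h | ⟨rfl, rfl⟩)
    · exact hP.level _ _ h
    · exact hl
  le_iff := by
    rintro a a' b b' (h | ⟨rfl, rfl⟩) (h' | ⟨rfl, rfl⟩)
    · exact hP.le_iff _ _ _ _ h h'
    · exact h2 _ _ h
    · exact h1 _ _ h'
    · simp
  meet := by
    rintro a a' b b' (h | ⟨rfl, rfl⟩) (h' | ⟨rfl, rfl⟩)
    · exact Or.inl (hP.meet _ _ _ _ h h')
    · rw [hX.meet_comm, hY.meet_comm]; exact h3 _ _ h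
    · exact h3 _ _ h'
    · right; rw [hX.meet_self, hY.meet_self]; simp
  low := by
    rintro a a' i (h | ⟨rfl, rfl⟩) hi hc
    · exact Or.inl (hP.low _ _ i h hi hc)
    · rcases lt_or_ge i (lev a) with h5 | h5
      · exact Or.inl (h4 i hi hc h5)
      · rw [hX.low_eq_self h5, hY.low_eq_self (hl ▸ h5)]; simp

theorem border_iff (hX : IsLeveled n c lev) (hY : IsLeveled n c lev')
    (hP : IsMatching n c lev lev' P) {y a : X} {y' a' : Y} (hy : P y y') (ha : P a a')
    (hya : y < a) : a ∈ borderAbove lev y ↔ a' ∈ borderAbove lev' y' := by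
  rw [hX.border_iff hya, hY.border_iff ((hP.lt_iff hy ha).1 hya), ← hP.level _ _ hy,
    ← hP.level _ _ ha]
  have hn := hX.level_lt_of_lt hya
  constructor
  · rintro ⟨h1, h2, h3⟩
    exact ⟨h1, h2, (hP.eq_iff (hP.low _ _ _ ha hn h2) hy).1 h3⟩
  · rintro ⟨h1, h2, h3⟩
    exact ⟨h1, h2, (hP.eq_iff (hP.low _ _ _ ha hn h2) hy).2 h3⟩

/-- If there is a cone of a set of cones that avoids the domain of a matching, and the corresponding
set of cones has the same size, then it contains a cone that avoids the range. -/
theorem exists_fresh (hX : IsLeveled n c lev) (hY : IsLeveled n c lev')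
    (hP : IsMatching n c lev lev' P) (hfin : {a | ∃ a', P a a'}.Finite) {y x : X} {y' : Y}
    (hy : P y y') (K : Set X) (K' : Set Y)
    (hcard : (coneOf y '' K).encard = (coneOf y' '' K').encard)
    (hKK : ∀ a a', P a a' → y < a → coneOf y' a' ∈ coneOf y' '' K' →
      coneOf y a ∈ coneOf y '' K)
    (hx : coneOf y x ∈ coneOf y '' K) (hfresh : ∀ a a', P a a' → a ∉ coneOf y x) :
    ∃ w ∈ K', ∀ a a', P a a' → a' ∉ coneOf y' w := by
  by_contra! hc
  -- `A` consists of the cones of `K` that the domain touches; it is finite. If every cone of `K'`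
  -- met the range, `K'` would have at most as many cones as `A`, while the untouched cone of x
  -- makes `K` strictly larger.
  set A : Set (Set X) := {C | C ∈ coneOf y '' K ∧ ∃ a a', P a a' ∧ a ∈ C} with hA
  have hAfin : A.Finite := by
    refine (hfin.image (coneOf y)).subset ?_
    rintro C ⟨⟨b, hb, rfl⟩, a, a', haa, ha⟩
    exact ⟨a, ⟨a', haa⟩, hX.coneOf_eq ha⟩
  have hxA : coneOf y x ∉ A := fun ⟨_, a, a', haa, ha⟩ => hfresh a a' haa ha
  have h1 : (Insert.insert (coneOf y x) A).encard ≤ (coneOf y '' K).encard :=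
    Set.encard_le_encard (Set.insert_subset hx fun C hC => hC.1)
  rw [Set.encard_insert_of_notMem hxA] at h1
  have h2 : (coneOf y' '' K').encard ≤ A.encard := by
    have key : ∀ C ∈ coneOf y' '' K', ∃ a a', P a a' ∧ y < a ∧ coneOf y' a' = C ∧
        coneOf y a ∈ A := by
      rintro C ⟨w, hw, rfl⟩
      obtain ⟨a, a', haa, ha⟩ := hc w hw
      have hya' : y' < a' := by
        obtain ⟨z, h1, h2, -⟩ := ha
        exact h1.trans_le h2
      have hya := (hP.lt_iff hy haa).2 hya'
      have he := hY.coneOf_eq ha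
      exact ⟨a, a', haa, hya, he, hKK a a' haa hya ⟨w, hw, he.symm⟩, a, a', haa,
        mem_coneOf_self hya⟩
    have : Nonempty X := ⟨y⟩
    have : Nonempty Y := ⟨y'⟩
    choose! f f' hff hyf hcone hmem using key
    refine Set.encard_le_encard_of_injOn (f := fun C => coneOf y (f C)) hmem ?_
    intro C hC D hD hCD
    have hCD' : f C ∈ coneOf y (f D) := (hX.coneOf_eq_iff (hyf C hC)).1 hCD
    rw [hX.mem_coneOf_iff, hP.lt_iff hy (hP.meet _ _ _ _ (hff C hC) (hff D hD)),
      ← hY.mem_coneOf_iff] at hCD'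
    rw [← hcone C hC, ← hcone D hD]
    exact hY.coneOf_eq hCD'
  rw [hcard] at h1
  have h3 := h1.trans h2
  obtain ⟨q, hq⟩ := ENat.ne_top_iff_exists.1 (Set.encard_ne_top_iff.2 hAfin)
  rw [← hq] at h3
  norm_cast at h3
  omega

/-- Extension of a matching to an element below its domain. -/
theorem exists_insert_below (hc : IsValidSeq n c) (hX : IsLeveled n c lev)
    (hY : IsLeveled n c lev') (hP : IsMatching n c lev lev' P)
    (hfin : {a | ∃ a', P a a'}.Finite) {x : X} (hx : ∀ a', ¬ P x a')
    (hmeet : ∀ a a', P a a' → GoodTrees.meet x a = x ∨ ∃ b', P (GoodTrees.meet x a) b')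
    (hlow : ∀ i < n, (c i).1 ≠ 0 → GoodTrees.low lev i x = x ∨ ∃ b', P (GoodTrees.low lev i x) b')
    (hex : ∃ a a', P a a' ∧ x ≤ a) :
    ∃ x', IsMatching n c lev lev' (fun a a' => P a a' ∨ a = x ∧ a' = x') := by
  obtain ⟨a₀, ⟨⟨a₀', h0⟩, hxa₀⟩, hmin⟩ : ∃ m, Minimal (· ∈ {a | (∃ a', P a a') ∧ x ≤ a}) m := by
    refine (hfin.subset fun a ha => ha.1).exists_minimal ?_
    obtain ⟨a, a', h, h'⟩ := hex
    exact ⟨a, ⟨a', h⟩, h'⟩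
  -- Closure under meets upgrades minimality to being least among the domain points above x.
  have hmin' : ∀ a a', P a a' → x ≤ a → a₀ ≤ a := fun a a' haa hxa =>
    (hmin (y := GoodTrees.meet a a₀) ⟨⟨_, hP.meet _ _ _ _ haa h0⟩, hX.le_meet_iff.2 ⟨hxa, hxa₀⟩⟩
      (hX.meet_le_right _ _)).trans (hX.meet_le_left _ _)
  have hlt : x < a₀ := lt_of_le_of_ne hxa₀ (by rintro rfl; exact hx _ h0)
  have hln := hX.level_lt_of_lt hlt
  have hlevel := hX.mono _ _ hxa₀
  have hx_low : ∀ i < lev x, i < n → (c i).1 ≠ 0 → GoodTrees.low lev i x = GoodTrees.low lev i a₀ :=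
    fun i hi _ hci => hX.low_eq_of_le hxa₀ hi hci
  -- the part of level `lev x` below `a₀` has no greatest element
  have hkind : lev a₀ = lev x ∨ (c (lev x)).1 = 0 := by
    by_contra! hcon
    have hg := hX.low_isGreatest hlevel hcon.2
    have := hmin' _ _ (hP.low _ _ _ h0 hln hcon.2) (hg.2 ⟨hxa₀, rfl⟩)
    exact hcon.1 (le_antisymm ((hX.mono _ _ this).trans hg.1.2.le) hlevel)
  -- With μ = 0 the level is an antichain, which excludes the first alternative; validity of the
  -- colors excludes the second.
  have hμ : (c (lev x)).2 ≠ 0 := by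
    intro h2
    rcases hkind with h3 | h3
    · exact hX.not_lt_of_level_eq h2 hlt h3
    · exact hc.ne_zero _ hln h2 h3
  have hl0 := hP.level _ _ h0
  obtain ⟨x', hx'lt, hx'l, hx'a⟩ : ∃ x' < a₀', lev' x' = lev x ∧
      ∀ a a', P a a' → a < x → a' < x' := by
    have hsome : ∃ x' < a₀', lev' x' = lev x := by
      rcases hlevel.eq_or_lt with h2 | h2
      · have h3 : lev' a₀' = lev x := by rw [← hl0, h2]
        obtain ⟨z, hz, hz'⟩ := hY.no_first a₀' (by rwa [h3]) (by rwa [h3])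
        exact ⟨z, hz, hz'.trans h3⟩
      · obtain ⟨z, hz, hz'⟩ := hY.below a₀' (lev x) (by rwa [← hl0])
        refine ⟨z, lt_of_le_of_ne hz ?_, hz'⟩
        rintro rfl
        omega
    by_cases hne : ∃ a a', P a a' ∧ a < x
    · obtain ⟨a₁, ⟨⟨a₁', h1⟩, ha₁x⟩, hmax⟩ : ∃ m, Maximal (· ∈ {a | (∃ a', P a a') ∧ a < x}) m := by
        refine (hfin.subset fun a ha => ha.1).exists_maximal ?_
        obtain ⟨a, a', h, h'⟩ := hne
        exact ⟨a, ⟨a', h⟩, h'⟩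
      have hmax' : ∀ a a', P a a' → a < x → a ≤ a₁ := fun a a' haa hax => by
        rcases hX.linear_below x a a₁ hax.le ha₁x.le with h2 | h2
        · exact h2
        · exact hmax ⟨⟨a', haa⟩, hax⟩ h2
      have hl1 := hP.level _ _ h1
      have hle1 := hX.mono _ _ ha₁x.le
      have h10 := (hP.lt_iff h1 h0).1 (ha₁x.trans hlt)
      obtain ⟨x', hx'1, hx'2, hx'3⟩ : ∃ x' < a₀', lev' x' = lev x ∧ a₁' < x' := by
        -- If `a₁` is on the level of x, room above its image comes from density when `a₀` is on
        -- that level as well, and otherwise from the absence of border cones. If `a₁` is on a lower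
        -- level, every point of the right level below `a₀'` will do.
        rcases hle1.eq_or_lt with h2 | h2
        · rcases hlevel.eq_or_lt with h4 | h4
          · obtain ⟨z, hz1, hz2⟩ := hY.dense a₁' a₀' (by rw [← hl1, h2]; exact hln)
              (by rw [← hl1, h2]; exact hμ) (by rw [← hl1, ← hl0, h2, h4]) h10
            refine ⟨z, hz2, le_antisymm ?_ ?_, hz1⟩
            · rw [h4, hl0]; exact hY.mono _ _ hz2.le
            · rw [← h2, hl1]; exact hY.mono _ _ hz1.le
          · have h5 : (c (lev x)).1 = 0 := hkind.resolve_left h4.ne'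
            obtain ⟨z, hz1, hz2, hz3⟩ := hY.exists_level_eq (by rw [← hl1, h2]; exact h5) h10
            refine ⟨z, lt_of_le_of_ne hz2 ?_, by rw [hz3, ← hl1, h2], hz1⟩
            rintro rfl
            omega
        · obtain ⟨x', hx'1, hx'2⟩ := hsome
          exact ⟨x', hx'1, hx'2, hY.level_lt h10.le hx'1.le (by omega)⟩
      refine ⟨x', hx'1, hx'2, fun a a' haa hax => ?_⟩
      exact ((hP.le_iff _ _ _ _ haa h1).1 (hmax' a a' haa hax)).trans_lt hx'3
    · obtain ⟨x', hx'1, hx'2⟩ := hsome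
      exact ⟨x', hx'1, hx'2, fun a a' haa hax => absurd ⟨a, a', haa, hax⟩ hne⟩
  have hup : ∀ a a', P a a' → x ≤ a → x' < a' := fun a a' haa hxa =>
    hx'lt.trans_le ((hP.le_iff _ _ _ _ h0 haa).1 (hmin' a a' haa hxa))
  -- For a not above x, the branching of a from `a₀` happens below x, so x and `a₀` have the same
  -- meet with a; the same holds for the images.
  have hside : ∀ a a', P a a' → ¬ x ≤ a → P (GoodTrees.meet x a) (GoodTrees.meet x' a') := by
    intro a a' haa hxa
    have hm := hP.meet _ _ _ _ h0 haa
    have h2 : GoodTrees.meet a₀ a ≤ x := by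
      rcases hX.linear_below a₀ _ x (hX.meet_le_left a₀ a) hxa₀ with h2 | h2
      · exact h2
      · exact absurd (h2.trans (hX.meet_le_right _ _)) hxa
    have h2' : GoodTrees.meet a₀ a < x := lt_of_le_of_ne h2 (by
      intro e; rw [e] at hm; exact hx _ hm)
    have h3 : GoodTrees.meet x a = GoodTrees.meet a₀ a := le_antisymm
      (hX.le_meet_iff.2 ⟨(hX.meet_le_left _ _).trans hxa₀, hX.meet_le_right _ _⟩)
      (hX.le_meet_iff.2 ⟨h2, hX.meet_le_right _ _⟩)
    have h4 : GoodTrees.meet x' a' = GoodTrees.meet a₀' a' := le_antisymm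
      (hY.le_meet_iff.2 ⟨(hY.meet_le_left _ _).trans hx'lt.le, hY.meet_le_right _ _⟩)
      (hY.le_meet_iff.2 ⟨(hx'a _ _ hm h2').le, hY.meet_le_right _ _⟩)
    rwa [h3, h4]
  refine ⟨x', hP.insert hX hY hx'l.symm ?_ ?_ ?_ ?_⟩
  · intro a a' haa
    refine ⟨fun h2 => (hup a a' haa h2).le, fun h2 => ?_⟩
    by_contra hcon
    have h3 := hside a a' haa hcon
    rw [hY.meet_eq_left h2] at h3
    rcases hmeet a a' haa with h4 | ⟨b', h4⟩
    · exact hcon (h4 ▸ hX.meet_le_right x a)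
    · have h5 : GoodTrees.meet x a < x := lt_of_le_of_ne (hX.meet_le_left _ _) (by
        intro e; rw [e] at h4; exact hx _ h4)
      exact lt_irrefl _ (hx'a _ _ h3 h5)
  · intro a a' haa
    constructor
    · intro h2
      exact (hx'a a a' haa (lt_of_le_of_ne h2 (by rintro rfl; exact hx _ haa))).le
    · intro h2
      have h3 : a ≤ a₀ := (hP.le_iff _ _ _ _ haa h0).2 (h2.trans hx'lt.le)
      rcases hX.linear_below a₀ a x h3 hxa₀ with h4 | h4
      · exact h4
      · exact absurd h2 (hup a a' haa h4).not_ge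
  · intro a a' haa
    by_cases h2 : x ≤ a
    · exact Or.inr ⟨hX.meet_eq_left h2, hY.meet_eq_left (hup a a' haa h2).le⟩
    · exact Or.inl (hside a a' haa h2)
  · intro i hi hci hil
    rw [hX.low_eq_of_le hxa₀ hil hci, hY.low_eq_of_le hx'lt.le (by omega) hci]
    exact hP.low _ _ i h0 hi hci

end IsMatching

end Matching

/-! ### Extension of matchings to new cones and to finite closures -/

section Matching

variable {X Y : Type} [PartialOrder X] [PartialOrder Y]

namespace IsMatching

variable {n : ℕ} {c : ℕ → ℕ∞ × ℕ∞} {lev : X → ℕ} {lev' : Y → ℕ} {P : X → Y → Prop}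

/-- Extension of a matching to an element that opens a new cone. -/
theorem exists_insert_above (hX : IsLeveled n c lev)
    (hY : IsLeveled n c lev') (hP : IsMatching n c lev lev' P)
    (hfin : {a | ∃ a', P a a'}.Finite) {x : X} (hx : ∀ a', ¬ P x a')
    (hmeet : ∀ a a', P a a' → GoodTrees.meet x a = x ∨ ∃ b', P (GoodTrees.meet x a) b')
    (hlow : ∀ i < n, (c i).1 ≠ 0 → GoodTrees.low lev i x = x ∨ ∃ b', P (GoodTrees.low lev i x) b')
    (hnot : ∀ a a', P a a' → ¬ x ≤ a) (hne : ∃ a a', P a a') :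
    ∃ x', IsMatching n c lev lev' (fun a a' => P a a' ∨ a = x ∧ a' = x') := by
  have hmeet' : ∀ a a', P a a' → (∃ b', P (GoodTrees.meet x a) b') ∧ GoodTrees.meet x a < x := by
    intro a a' haa
    have h1 : GoodTrees.meet x a ≠ x := fun e => hnot a a' haa (e ▸ hX.meet_le_right x a)
    exact ⟨(hmeet a a' haa).resolve_left h1, lt_of_le_of_ne (hX.meet_le_left _ _) h1⟩
  obtain ⟨y, ⟨⟨y', hy⟩, hyx⟩, hmax⟩ : ∃ m, Maximal (· ∈ {a | (∃ a', P a a') ∧ a < x}) m := by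
    refine (hfin.subset fun a ha => ha.1).exists_maximal ?_
    obtain ⟨a, a', h⟩ := hne
    exact ⟨_, (hmeet' a a' h).1, (hmeet' a a' h).2⟩
  have hmax' : ∀ a a', P a a' → a ≤ x → a ≤ y := fun a a' haa hax => by
    rcases hX.linear_below x a y hax hyx.le with h2 | h2
    · exact h2
    · exact hmax ⟨⟨a', haa⟩, lt_of_le_of_ne hax (by rintro rfl; exact hx _ haa)⟩ h2
  have hmxy : ∀ a a', P a a' → GoodTrees.meet x a ≤ y := fun a a' haa => by
    obtain ⟨⟨b', hb⟩, -⟩ := hmeet' a a' haa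
    exact hmax' _ _ hb (hX.meet_le_left _ _)
  have hfresh : ∀ a a', P a a' → a ∉ coneOf y x := fun a a' haa ha => by
    rw [hX.mem_coneOf_iff, hX.meet_comm] at ha
    exact absurd ha (hmxy a a' haa).not_gt
  have hyn := hX.level_lt_of_lt hyx
  have hyl := hP.level _ _ hy
  have hlev := hX.mono _ _ hyx.le
  have hxn := hX.lev_le x
  -- Such a last element differs from x, hence is in the domain and below y. So a level strictly
  -- between those of y and x has m = 0 and imposes no condition on the image of x.
  have hlow' : ∀ i < lev x, (c i).1 ≠ 0 → i ≤ lev y ∧ (i = lev y → GoodTrees.low lev i x = y) := by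
    intro i hi hci
    have hg := hX.low_isGreatest hi.le hci
    rcases hlow i (by omega) hci with h1 | ⟨b', h1⟩
    · have := hg.1.2
      rw [h1] at this
      omega
    · have h2 := hmax' _ _ h1 hg.1.1
      refine ⟨hg.1.2 ▸ hX.mono _ _ h2, fun e => le_antisymm h2 ?_⟩
      exact hg.2 ⟨hyx.le, e.symm⟩
  -- the requirements on the image of `x`
  suffices hs : ∃ x', y' < x' ∧ lev' x' = lev x ∧ (∀ a a', P a a' → a' ∉ coneOf y' x') ∧
      (lev y < lev x → (c (lev y)).1 ≠ 0 → GoodTrees.low lev' (lev y) x' = y') by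
    obtain ⟨x', hyx', hl', hfr', hlo'⟩ := hs
    have hm : ∀ a a', P a a' → GoodTrees.meet x' a' = GoodTrees.meet y' a' := by
      intro a a' haa
      have h1 : GoodTrees.meet x' a' ≤ y' := by
        have h2 := hfr' a a' haa
        rw [hY.mem_coneOf_iff, hY.meet_comm] at h2
        rcases hY.linear_below x' _ y' (hY.meet_le_left x' a') hyx'.le with h3 | h3
        · exact h3
        · rcases h3.eq_or_lt with h3 | h3
          · exact h3.ge
          · exact absurd h3 h2
      exact le_antisymm (hY.le_meet_iff.2 ⟨h1, hY.meet_le_right _ _⟩)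
        (hY.le_meet_iff.2 ⟨(hY.meet_le_left _ _).trans hyx'.le, hY.meet_le_right _ _⟩)
    have hmX : ∀ a a', P a a' → GoodTrees.meet x a = GoodTrees.meet y a := by
      intro a a' haa
      exact le_antisymm (hX.le_meet_iff.2 ⟨hmxy a a' haa, hX.meet_le_right _ _⟩)
        (hX.le_meet_iff.2 ⟨(hX.meet_le_left _ _).trans hyx.le, hX.meet_le_right _ _⟩)
    refine ⟨x', hP.insert hX hY hl'.symm ?_ ?_ ?_ ?_⟩
    · intro a a' haa
      refine iff_of_false (hnot a a' haa) fun h2 => ?_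
      have h3 := hm a a' haa
      rw [hY.meet_eq_left h2] at h3
      exact absurd (h3 ▸ hY.meet_le_left y' a') hyx'.not_ge
    · intro a a' haa
      constructor
      · intro h2
        exact ((hP.le_iff _ _ _ _ haa hy).1 (hmax' a a' haa h2)).trans hyx'.le
      · intro h2
        have h3 := hm a a' haa
        rw [hY.meet_comm, hY.meet_eq_left h2] at h3
        exact ((hP.le_iff _ _ _ _ haa hy).2 (h3 ▸ hY.meet_le_left y' a')).trans hyx.le
    · intro a a' haa
      rw [hm a a' haa, hmX a a' haa]
      exact Or.inl (hP.meet _ _ _ _ hy haa)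
    · intro i hi hci hil
      obtain ⟨h1, h2⟩ := hlow' i hil hci
      rcases h1.eq_or_lt with rfl | h1
      · rw [h2 rfl, hlo' hil hci]; exact hy
      · rw [← hX.low_eq_of_le hyx.le h1 hci, ← hY.low_eq_of_le hyx'.le (by omega) hci]
        exact hP.low _ _ i hy hi hci
  have hcb : (coneOf y '' borderAbove lev y).encard =
      (coneOf y' '' borderAbove lev' y').encard := by
    rw [hX.border_count y hyn, hY.border_count y' (hyl ▸ hyn), hyl]
  have hci : (coneOf y '' innerAbove lev y).encard =
      (coneOf y' '' innerAbove lev' y').encard := by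
    rw [hX.inner_count y hyn, hY.inner_count y' (hyl ▸ hyn), hyl]
  by_cases hkind : lev y < lev x ∧ (c (lev y)).1 ≠ 0
  · -- a border cone
    have hxb : x ∈ borderAbove lev y :=
      (hX.border_iff hyx).2 ⟨hkind.1.ne', hkind.2, (hlow' _ hkind.1 hkind.2).2 rfl⟩
    obtain ⟨w, hw, hwf⟩ := exists_fresh hX hY hP hfin hy (borderAbove lev y) (borderAbove lev' y')
      hcb (by
        rintro a a' haa hya ⟨b, hb, hbc⟩
        refine ⟨a, ?_, rfl⟩
        rw [hP.border_iff hX hY hy haa hya]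
        have hya' := (hP.lt_iff hy haa).1 hya
        rw [eq_comm, hY.coneOf_eq_iff hya'] at hbc
        refine ⟨hya', fun z hz hza e => ?_⟩
        obtain ⟨u, hu, hua, hub⟩ := hbc
        rcases hY.linear_below a' u z hua hza with h1 | h1
        · have h2 := hb.2 u hu hub
          have h3 := hY.mono _ _ h1
          have h4 := hY.mono _ _ hu.le
          omega
        · exact hb.2 z hz (h1.trans hub) e) ⟨x, hxb, rfl⟩ hfresh
    -- Every level is met below a leaf. The point of the level of x below this leaf is comparable
    -- with w and lies above `y'`, hence it is in the cone of w.
    obtain ⟨a, hwa, ha⟩ := hY.le_leaf w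
    have hal := (hY.max_iff a).1 ha
    obtain ⟨x', hx'a, hx'l⟩ : ∃ x' ≤ a, lev' x' = lev x := by
      rcases hxn.eq_or_lt with h1 | h1
      · exact ⟨a, le_rfl, by omega⟩
      · exact hY.below a _ (by omega)
    have hyx' : y' < x' := hY.level_lt (hw.1.le.trans hwa) hx'a (by omega)
    have hx'w : x' ∈ coneOf y' w := by
      rcases hY.linear_below a x' w hx'a hwa with h1 | h1
      · exact ⟨x', hyx', le_rfl, h1⟩
      · exact ⟨w, hw.1, h1, le_rfl⟩
    refine ⟨x', hyx', hx'l, fun b b' hb => ?_, fun _ _ => ?_⟩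
    · rw [hY.coneOf_eq hx'w]; exact hwf b b' hb
    · refine low_eq ⟨⟨hyx'.le, hyl.symm⟩, fun z hz => ?_⟩
      rcases hY.linear_below a z y' (hz.1.trans hx'a) (hw.1.le.trans hwa) with h1 | h1
      · exact h1
      · rcases h1.eq_or_lt with rfl | h1
        · exact le_rfl
        · exfalso
          rcases hY.linear_below a z w (hz.1.trans hx'a) hwa with h2 | h2
          · exact hw.2 z h1 h2 (hz.2.trans hyl)
          · have h3 := hw.2 w hw.1 le_rfl
            have h4 := hY.mono _ _ h2
            have h5 := hY.mono _ _ hw.1.le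
            have h6 := hz.2
            omega
  · -- an inner cone
    have hxi : ∃ u, y < u ∧ u ≤ x ∧ lev u = lev y := by
      rcases hlev.eq_or_lt with h1 | h1
      · exact ⟨x, hyx, le_rfl, h1.symm⟩
      · exact hX.exists_level_eq (by tauto) hyx
    obtain ⟨u, hyu, hux, hul⟩ := hxi
    obtain ⟨w, hw, hwf⟩ := exists_fresh hX hY hP hfin hy (x := x) (innerAbove lev y)
      (innerAbove lev' y') hci (by
        rintro a a' haa hya ⟨b, hb, hbc⟩
        have hya' := (hP.lt_iff hy haa).1 hya
        rw [eq_comm, hY.coneOf_eq_iff hya'] at hbc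
        have hnb : a ∉ borderAbove lev y := by
          rw [hP.border_iff hX hY hy haa hya]
          rintro ⟨-, h1⟩
          obtain ⟨v, hv, hva, hvb⟩ := hbc
          have h2 := hY.mono _ _ hvb
          have h3 := hY.mono _ _ hv.le
          have h4 := hb.2
          exact h1 v hv hva (by omega)
        simp only [borderAbove, Set.mem_ofPred_eq, not_and, not_forall, not_not] at hnb
        obtain ⟨z, hz, hza, hzl⟩ := hnb hya
        exact ⟨z, ⟨hz, hzl⟩, hX.coneOf_eq ⟨z, hz, le_rfl, hza⟩⟩)
      ⟨u, ⟨hyu, hul⟩, hX.coneOf_eq ⟨u, hyu, le_rfl, hux⟩⟩ hfresh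
    obtain ⟨hyw, hwl⟩ := hw
    -- The point w is on the level of y; the level of x is reached by climbing above w, which does
    -- not leave its cone.
    obtain ⟨x', hx'w, hx'l⟩ : ∃ x', w ≤ x' ∧ lev' x' = lev x := by
      rcases hlev.eq_or_lt with h1 | h1
      · exact ⟨w, le_rfl, by omega⟩
      · obtain ⟨x', h2, h3⟩ := hY.exists_above (x := w) (l := lev x) (by omega) hxn
        exact ⟨x', h2.le, h3⟩
    refine ⟨x', hyw.trans_le hx'w, hx'l, fun b b' hb => ?_, fun h1 h2 => absurd ⟨h1, h2⟩ hkind⟩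
    rw [hY.coneOf_eq (y := w) ⟨w, hyw, hx'w, le_rfl⟩]
    exact hwf b b' hb

/-- Besides the two previous situations there is only the empty matching. Then no level below that
of x can have m ≠ 0, since its last element would be in the domain, so any element of the level of x
is an admissible image. -/
theorem exists_insert (hc : IsValidSeq n c) (hX : IsLeveled n c lev)
    (hY : IsLeveled n c lev') (hP : IsMatching n c lev lev' P)
    (hfin : {a | ∃ a', P a a'}.Finite) {x : X} (hx : ∀ a', ¬ P x a')
    (hmeet : ∀ a a', P a a' → GoodTrees.meet x a = x ∨ ∃ b', P (GoodTrees.meet x a) b')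
    (hlow : ∀ i < n, (c i).1 ≠ 0 →
      GoodTrees.low lev i x = x ∨ ∃ b', P (GoodTrees.low lev i x) b') :
    ∃ x', IsMatching n c lev lev' (fun a a' => P a a' ∨ a = x ∧ a' = x') := by
  by_cases h1 : ∃ a a', P a a' ∧ x ≤ a
  · exact hP.exists_insert_below hc hX hY hfin hx hmeet hlow h1
  by_cases h2 : ∃ a a', P a a'
  · exact hP.exists_insert_above hX hY hfin hx hmeet hlow
      (fun a a' haa hxa => h1 ⟨a, a', haa, hxa⟩) h2
  obtain ⟨x', hx'⟩ := hY.exists_level (hX.lev_le x)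
  have h0 : ∀ a a', ¬ P a a' := fun a a' haa => h2 ⟨a, a', haa⟩
  refine ⟨x', hP.insert hX hY hx'.symm (fun a a' h => absurd h (h0 a a'))
    (fun a a' h => absurd h (h0 a a')) (fun a a' h => absurd h (h0 a a')) fun i hi hci hil => ?_⟩
  have h3 := hX.low_isGreatest hil.le hci
  rcases hlow i hi hci with h4 | ⟨b', h4⟩
  · have := h3.1.2
    rw [h4] at this
    omega
  · exact absurd h4 (h0 _ _)

end IsMatching

/-- Closure under meets and last elements of levels. -/
structure IsClosedSet (n : ℕ) (c : ℕ → ℕ∞ × ℕ∞) (lev : X → ℕ) (C : Set X) : Prop where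
  meet : ∀ a ∈ C, ∀ b ∈ C, meet a b ∈ C
  low : ∀ a ∈ C, ∀ i < n, (c i).1 ≠ 0 → low lev i a ∈ C

/-- The closure of a set that is closed under meets. -/
def lowClosure (n : ℕ) (c : ℕ → ℕ∞ × ℕ∞) (lev : X → ℕ) (B : Set X) : Set X :=
  {z | z ∈ B ∨ ∃ b ∈ B, ∃ i < n, (c i).1 ≠ 0 ∧ low lev i b = z}

theorem lowClosure_finite (n : ℕ) (c : ℕ → ℕ∞ × ℕ∞) (lev : X → ℕ) {B : Set X} (hB : B.Finite) :
    (lowClosure n c lev B).Finite := by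
  have h1 : ((fun q : X × ℕ => low lev q.2 q.1) '' (B ×ˢ Set.Iio n)).Finite :=
    (hB.prod (Set.finite_Iio n)).image _
  refine (hB.union h1).subset ?_
  rintro z (hz | ⟨b, hb, i, hi, -, rfl⟩)
  · exact Or.inl hz
  · exact Or.inr ⟨(b, i), ⟨hb, hi⟩, rfl⟩

/-- By `meet_of_le`, meeting with a value of `low` gives that value or an ordinary meet. Iterating
`low` gives nothing new: the lower of the two levels prevails. -/
theorem IsLeveled.isClosedSet_lowClosure {n : ℕ} {c : ℕ → ℕ∞ × ℕ∞} {lev : X → ℕ}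
    (h : IsLeveled n c lev) {B : Set X} (hB : ∀ a ∈ B, ∀ b ∈ B, GoodTrees.meet a b ∈ B) :
    IsClosedSet n c lev (lowClosure n c lev B) where
  meet := by
    have h1 : ∀ a ∈ B, ∀ i < n, (c i).1 ≠ 0 → ∀ d,
        (∀ a ∈ B, GoodTrees.meet a d ∈ lowClosure n c lev B) →
        GoodTrees.meet (GoodTrees.low lev i a) d ∈ lowClosure n c lev B := by
      intro a ha i hi hci d hd
      rcases h.meet_of_le (d := d) (low_le lev i a) with h1 | h1
      · rw [h1]; exact Or.inr ⟨a, ha, i, hi, hci, rfl⟩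
      · rw [h1]; exact hd a ha
    rintro a (ha | ⟨a, ha, i, hi, hci, rfl⟩) b (hb | ⟨b, hb, j, hj, hcj, rfl⟩)
    · exact Or.inl (hB a ha b hb)
    · rw [h.meet_comm]
      exact h1 b hb j hj hcj a fun d hd => Or.inl (hB d hd a ha)
    · exact h1 a ha i hi hci b fun d hd => Or.inl (hB d hd b hb)
    · refine h1 a ha i hi hci _ fun d hd => ?_
      rw [h.meet_comm]
      exact h1 b hb j hj hcj d fun e he => Or.inl (hB e he d hd)
  low := by
    rintro a (ha | ⟨a, ha, i, hi, hci, rfl⟩) j hj hcj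
    · exact Or.inr ⟨a, ha, j, hj, hcj, rfl⟩
    · rcases lt_or_ge (lev a) i with h1 | h1
      · rw [h.low_eq_self h1.le]
        exact Or.inr ⟨a, ha, j, hj, hcj, rfl⟩
      · have h2 := h.lev_low h1 hci
        rcases lt_or_ge j i with h3 | h3
        · rw [h.low_eq_of_le (low_le lev i a) (by omega) hcj]
          exact Or.inr ⟨a, ha, j, hj, hcj, rfl⟩
        · rw [h.low_eq_self (i := j) (by omega)]
          exact Or.inr ⟨a, ha, i, hi, hci, rfl⟩

namespace IsMatching

variable {n : ℕ} {c : ℕ → ℕ∞ × ℕ∞} {lev : X → ℕ} {lev' : Y → ℕ}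

/-- Induction on the number of missing points of C. A minimal missing point has its meets with the
domain, and its last elements, in C and below itself, so each is either the point itself or already
in the domain. This is the hypothesis of `exists_insert`. -/
theorem exists_extension_of_closed (hc : IsValidSeq n c) (hX : IsLeveled n c lev)
    (hY : IsLeveled n c lev') {C : Set X} (hC : IsClosedSet n c lev C) (hCfin : C.Finite) (k : ℕ) :
    ∀ P : X → Y → Prop, IsMatching n c lev lev' P → {a | ∃ a', P a a'}.Finite →
      {a | ∃ a', P a a'} ⊆ C → (C \ {a | ∃ a', P a a'}).ncard = k →
      ∃ Q : X → Y → Prop, IsMatching n c lev lev' Q ∧ {a | ∃ a', Q a a'}.Finite ∧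
        (∀ a a', P a a' → Q a a') ∧ ∀ a ∈ C, ∃ a', Q a a' := by
  induction k using Nat.strong_induction_on with
  | _ k ih =>
  intro P hP hfin hsub hk
  by_cases hall : ∀ a ∈ C, ∃ a', P a a'
  · exact ⟨P, hP, hfin, fun _ _ h => h, hall⟩
  obtain ⟨z, ⟨hzC, hzP⟩, hmin⟩ : ∃ m, Minimal (· ∈ C \ {a | ∃ a', P a a'}) m := by
    refine (hCfin.subset Set.sdiff_subset).exists_minimal ?_
    push Not at hall
    obtain ⟨a, ha, h⟩ := hall
    exact ⟨a, ha, fun ⟨a', h'⟩ => h a' h'⟩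
  have hbelow : ∀ w ∈ C, w ≤ z → w = z ∨ ∃ b', P w b' := by
    intro w hw hwz
    by_contra! hcon
    exact hcon.1 (le_antisymm hwz (hmin ⟨hw, fun ⟨b', hb⟩ => hcon.2 b' hb⟩ hwz))
  obtain ⟨z', hz'⟩ := hP.exists_insert hc hX hY hfin (x := z) (fun a' h => hzP ⟨a', h⟩)
    (fun a a' haa => hbelow _ (hC.meet z hzC a (hsub ⟨a', haa⟩)) (hX.meet_le_left _ _))
    (fun i hi hci => hbelow _ (hC.low z hzC i hi hci) (low_le _ _ _))
  have hdom : {a | ∃ a', P a a' ∨ a = z ∧ a' = z'} = Insert.insert z {a | ∃ a', P a a'} := by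
    ext a
    simp only [Set.mem_ofPred_eq, Set.mem_insert_iff, exists_or]
    constructor
    · rintro (h | ⟨_, h, -⟩)
      · exact Or.inr h
      · exact Or.inl h
    · rintro (h | h)
      · exact Or.inr ⟨z', h, rfl⟩
      · exact Or.inl h
  obtain ⟨Q, hQ, hQfin, hPQ, hQC⟩ := ih _ (by
      rw [← hk]
      refine Set.ncard_lt_ncard (t := C \ {a | ∃ a', P a a'}) ?_ (hCfin.subset Set.sdiff_subset)
      refine ⟨Set.sdiff_subset_sdiff_right ?_, fun hcon => ?_⟩
      · rw [hdom]; exact Set.subset_insert _ _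
      · have := hcon ⟨hzC, hzP⟩
        rw [hdom] at this
        exact this.2 (Set.mem_insert _ _)) _ hz' (by rw [hdom]; exact hfin.insert z)
    (by rw [hdom]; exact Set.insert_subset hzC hsub) rfl
  exact ⟨Q, hQ, hQfin, fun a a' h => hPQ a a' (Or.inl h), hQC⟩

/-- Finite matchings between leveled trees of the same colors extend to any further element. -/
theorem exists_extension (hc : IsValidSeq n c) (hX : IsLeveled n c lev)
    (hY : IsLeveled n c lev') {P : X → Y → Prop} (hP : IsMatching n c lev lev' P)
    (hfin : {a | ∃ a', P a a'}.Finite) (x : X) :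
    ∃ Q : X → Y → Prop, IsMatching n c lev lev' Q ∧ {a | ∃ a', Q a a'}.Finite ∧
      (∀ a a', P a a' → Q a a') ∧ ∃ x', Q x x' := by
  set A := {a | ∃ a', P a a'} with hA
  set B : Set X := A ∪ {z | z = x ∨ ∃ a ∈ A, z = GoodTrees.meet x a} with hB
  have hAm : ∀ a ∈ A, ∀ b ∈ A, GoodTrees.meet a b ∈ A := by
    rintro a ⟨a', ha⟩ b ⟨b', hb⟩
    exact ⟨_, hP.meet _ _ _ _ ha hb⟩
  have hBfin : B.Finite := by
    refine hfin.union ?_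
    refine ((hfin.image (GoodTrees.meet x)).insert x).subset ?_
    rintro z (rfl | ⟨a, ha, rfl⟩)
    · exact Set.mem_insert _ _
    · exact Or.inr ⟨a, ha, rfl⟩
  have hxa : ∀ a ∈ A, GoodTrees.meet x a ∈ B := fun a ha => Or.inr (Or.inr ⟨a, ha, rfl⟩)
  have hBm : ∀ a ∈ B, ∀ b ∈ B, GoodTrees.meet a b ∈ B := by
    have e1 : ∀ a b : X, GoodTrees.meet (GoodTrees.meet x a) (GoodTrees.meet x b) =
        GoodTrees.meet x (GoodTrees.meet a b) := fun a b => eq_of_forall_le_iff fun z => by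
      simp only [hX.le_meet_iff]; tauto
    have e2 : ∀ a b : X, GoodTrees.meet a (GoodTrees.meet x b) =
        GoodTrees.meet x (GoodTrees.meet a b) := fun a b => eq_of_forall_le_iff fun z => by
      simp only [hX.le_meet_iff]; tauto
    have e3 : ∀ b : X, GoodTrees.meet x (GoodTrees.meet x b) = GoodTrees.meet x b :=
      fun b => eq_of_forall_le_iff fun z => by simp only [hX.le_meet_iff]; tauto
    rintro a (ha | rfl | ⟨a, ha, rfl⟩) b (hb | rfl | ⟨b, hb, rfl⟩)
    · exact Or.inl (hAm a ha b hb)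
    · rw [hX.meet_comm]; exact hxa a ha
    · rw [e2]; exact hxa _ (hAm a ha b hb)
    · exact hxa b hb
    · rw [hX.meet_self]; exact Or.inr (Or.inl rfl)
    · rw [e3]; exact hxa b hb
    · rw [hX.meet_comm, e2]; exact hxa _ (hAm b hb a ha)
    · rw [hX.meet_comm, e3]; exact hxa a ha
    · rw [e1]; exact hxa _ (hAm a ha b hb)
  obtain ⟨Q, hQ, hQfin, hPQ, hQC⟩ := exists_extension_of_closed hc hX hY
    (hX.isClosedSet_lowClosure hBm) (lowClosure_finite n c lev hBfin) _ P hP hfin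
    (fun a ha => Or.inl (Or.inl ha)) rfl
  exact ⟨Q, hQ, hQfin, hPQ, hQC x (Or.inl (Or.inr (Or.inl rfl)))⟩

end IsMatching

end Matching

/-! ### Back-and-forth and quantifier elimination -/

section BackForth

universe u

variable {L : FirstOrder.Language.{0, 0}}

/-- The graph of an isomorphism between substructures. -/
structure IsPartialIso (L : FirstOrder.Language.{0, 0}) {M N : Type} [L.Structure M] [L.Structure N]
    (P : M → N → Prop) : Prop where
  eq_iff : ∀ a a' b b', P a a' → P b b' → (a = b ↔ a' = b')
  funMap : ∀ (n : ℕ) (f : L.Functions n) v w, (∀ i, P (v i) (w i)) →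
    P (Structure.funMap f v) (Structure.funMap f w)
  relMap : ∀ (n : ℕ) (R : L.Relations n) v w, (∀ i, P (v i) (w i)) →
    (Structure.RelMap R v ↔ Structure.RelMap R w)

variable {M N : Type} [L.Structure M] [L.Structure N]

theorem IsPartialIso.realize_term {P : M → N → Prop} (hP : IsPartialIso L P) {α : Type}
    {v : α → M} {w : α → N} (hvw : ∀ a, P (v a) (w a)) (t : L.Term α) :
    P (t.realize v) (t.realize w) := by
  induction t with
  | var a => exact hvw a
  | func f ts ih => exact hP.funMap _ f _ _ ih

/-- Formulas are preserved by the members of a back-and-forth system. -/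
theorem realize_iff_of_backForth (S : (M → N → Prop) → Prop)
    (hS : ∀ P, S P → IsPartialIso L P)
    (forth : ∀ P, S P → ∀ x, ∃ Q, S Q ∧ (∀ a a', P a a' → Q a a') ∧ ∃ x', Q x x')
    (back : ∀ P, S P → ∀ x', ∃ Q, S Q ∧ (∀ a a', P a a' → Q a a') ∧ ∃ x, Q x x')
    {α : Type} {n : ℕ} (φ : L.BoundedFormula α n) :
    ∀ P, S P → ∀ (v : α → M) (w : α → N) (xs : Fin n → M) (ys : Fin n → N),
      (∀ a, P (v a) (w a)) → (∀ i, P (xs i) (ys i)) → (φ.Realize v xs ↔ φ.Realize w ys) := by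
  have helim : ∀ (P : M → N → Prop) {n : ℕ} (v : α → M) (w : α → N) (xs : Fin n → M)
      (ys : Fin n → N), (∀ a, P (v a) (w a)) → (∀ i, P (xs i) (ys i)) →
      ∀ a, P (Sum.elim v xs a) (Sum.elim w ys a) := by
    rintro P n v w xs ys h1 h2 (a | a)
    · exact h1 a
    · exact h2 a
  have hsnoc : ∀ (P : M → N → Prop) {n : ℕ} (xs : Fin n → M) (ys : Fin n → N) (x : M) (y : N),
      (∀ i, P (xs i) (ys i)) → P x y → ∀ i : Fin (n + 1),
      P (Fin.snoc (α := fun _ => M) xs x i) (Fin.snoc (α := fun _ => N) ys y i) := by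
    intro P n xs ys x y h1 h2 i
    refine Fin.lastCases ?_ (fun i => ?_) i
    · simpa using h2
    · simpa using h1 i
  induction φ with
  | falsum => intro P hP v w xs ys h1 h2; rfl
  | equal t₁ t₂ =>
    intro P hP v w xs ys h1 h2
    exact (hS P hP).eq_iff _ _ _ _ ((hS P hP).realize_term (helim P v w xs ys h1 h2) t₁)
      ((hS P hP).realize_term (helim P v w xs ys h1 h2) t₂)
  | rel R ts =>
    intro P hP v w xs ys h1 h2
    exact (hS P hP).relMap _ R _ _ fun i =>
      (hS P hP).realize_term (helim P v w xs ys h1 h2) (ts i)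
  | imp φ ψ ih1 ih2 =>
    intro P hP v w xs ys h1 h2
    rw [BoundedFormula.realize_imp, BoundedFormula.realize_imp, ih1 P hP v w xs ys h1 h2,
      ih2 P hP v w xs ys h1 h2]
  | all φ ih =>
    intro P hP v w xs ys h1 h2
    rw [BoundedFormula.realize_all, BoundedFormula.realize_all]
    constructor
    · intro h y
      obtain ⟨Q, hQ, hPQ, x, hxy⟩ := back P hP y
      exact (ih Q hQ v w _ _ (fun a => hPQ _ _ (h1 a))
        (hsnoc Q xs ys x y (fun i => hPQ _ _ (h2 i)) hxy)).1 (h x)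
    · intro h x
      obtain ⟨Q, hQ, hPQ, y, hxy⟩ := forth P hP x
      exact (ih Q hQ v w _ _ (fun a => hPQ _ _ (h1 a))
        (hsnoc Q xs ys x y (fun i => hPQ _ _ (h2 i)) hxy)).2 (h y)

theorem isQF_foldr_sup {α : Type} {n : ℕ} (l : List (L.BoundedFormula α n))
    (hl : ∀ φ ∈ l, φ.IsQF) : (l.foldr (· ⊔ ·) ⊥).IsQF := by
  induction l with
  | nil => exact BoundedFormula.isQF_bot
  | cons φ l ih =>
    exact (hl φ (by simp)).sup (ih fun ψ hψ => hl ψ (by simp [hψ]))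

theorem isQF_foldr_inf {α : Type} {n : ℕ} (l : List (L.BoundedFormula α n))
    (hl : ∀ φ ∈ l, φ.IsQF) : (l.foldr (· ⊓ ·) ⊤).IsQF := by
  induction l with
  | nil => exact BoundedFormula.IsQF.top
  | cons φ l ih =>
    exact (hl φ (by simp)).inf (ih fun ψ hψ => hl ψ (by simp [hψ]))

theorem isQF_iSup {α β : Type} [Finite β] (f : β → L.Formula α)
    (hf : ∀ b, BoundedFormula.IsQF (f b)) : BoundedFormula.IsQF (Formula.iSup f) := by
  refine isQF_foldr_sup _ fun φ hφ => ?_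
  obtain ⟨b, -, rfl⟩ := List.mem_map.1 hφ
  exact hf b

theorem isQF_iInf {α β : Type} [Finite β] (f : β → L.Formula α)
    (hf : ∀ b, BoundedFormula.IsQF (f b)) : BoundedFormula.IsQF (Formula.iInf f) := by
  refine isQF_foldr_inf _ fun φ hφ => ?_
  obtain ⟨b, -, rfl⟩ := List.mem_map.1 hφ
  exact hf b

/-- A formula whose truth is determined by that of finitely many quantifier free formulas is
equivalent to a quantifier free formula. -/
theorem exists_isQF_of_determined {I : Type u} (M : I → Type) [∀ i, L.Structure (M i)] {α Δ : Type}
    [Finite Δ] (δ : Δ → L.Formula α) (hδ : ∀ d, BoundedFormula.IsQF (δ d)) (φ : L.Formula α)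
    (h : ∀ i i' (v : α → M i) (w : α → M i'), (∀ d, (δ d).Realize v ↔ (δ d).Realize w) →
      φ.Realize v → φ.Realize w) :
    ∃ ψ : L.Formula α, BoundedFormula.IsQF ψ ∧ ∀ i (v : α → M i), φ.Realize v ↔ ψ.Realize v := by
  classical
  -- `χ s` prescribes the truth value of each `δ d`. The formula sought is the disjunction of the
  -- finitely many patterns that occur together with φ.
  let χ : Set Δ → L.Formula α := fun s => Formula.iInf fun d => if d ∈ s then δ d else (δ d).not
  have hχ : ∀ s i (v : α → M i), (χ s).Realize v ↔ ∀ d, d ∈ s ↔ (δ d).Realize v := by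
    intro s i v
    simp only [χ, Formula.realize_iInf]
    refine forall_congr' fun d => ?_
    by_cases hd : d ∈ s <;> simp [hd]
  let G : Set (Set Δ) := {s | ∃ i, ∃ v : α → M i, φ.Realize v ∧ (χ s).Realize v}
  refine ⟨Formula.iSup fun s : G => χ s, isQF_iSup _ fun s => isQF_iInf _ fun d => ?_, ?_⟩
  · by_cases hd : d ∈ s.1
    · simp only [hd, if_true]; exact hδ d
    · simp only [hd, if_false]; exact (hδ d).not
  · intro i v
    rw [Formula.realize_iSup]
    constructor
    · intro hv
      have h1 : (χ {d | (δ d).Realize v}).Realize v := by rw [hχ]; intro d; rfl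
      exact ⟨⟨_, i, v, hv, h1⟩, h1⟩
    · rintro ⟨⟨s, i', w, hw, hsw⟩, hsv⟩
      refine h i' i w v (fun d => ?_) hw
      rw [hχ] at hsw hsv
      rw [← hsw d, ← hsv d]

/-- Quantifier elimination for a uniformly locally finite class of structures in which partial
isomorphisms between finite substructures preserve formulas. -/
theorem exists_isQF_of_finite_terms [Finite (Σ n, L.Functions n)] [Finite (Σ n, L.Relations n)]
    {I : Type u} (M : I → Type) [∀ i, L.Structure (M i)] {α τ : Type} [Finite τ]
    (t : τ → L.Term α) (hvar : ∀ a : α, ∃ s, ∀ i (v : α → M i), (t s).realize v = v a)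
    (hclosed : ∀ i (v : α → M i) (n : ℕ) (f : L.Functions n) (ss : Fin n → τ),
      ∃ s, Structure.funMap f (fun l => (t (ss l)).realize v) = (t s).realize v)
    (φ : L.Formula α)
    (hφ : ∀ i i' (P : M i → M i' → Prop), IsPartialIso L P → {a | ∃ a', P a a'}.Finite →
      ∀ v w, (∀ a, P (v a) (w a)) → φ.Realize v → φ.Realize w) :
    ∃ ψ : L.Formula α, BoundedFormula.IsQF ψ ∧ ∀ i (v : α → M i), φ.Realize v ↔ ψ.Realize v := by
  -- The diagram of the generated substructure: equalities between the terms, the tables of the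
  -- functions on them, and the relations.
  let Δ := (τ × τ) ⊕ (Σ q : (Σ n, L.Functions n), (Fin q.1 → τ) × τ) ⊕
    (Σ q : (Σ n, L.Relations n), (Fin q.1 → τ))
  let δ : Δ → L.Formula α := Sum.elim (fun s => (t s.1).equal (t s.2))
    (Sum.elim (fun q => (Term.func q.1.2 fun l => t (q.2.1 l)).equal (t q.2.2))
      (fun q => Relations.formula (L := L) q.1.2 fun l => t (q.2 l)))
  have hδ : ∀ d, BoundedFormula.IsQF (δ d) := by
    rintro (d | d | d)
    · exact (BoundedFormula.IsAtomic.equal _ _).isQF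
    · exact (BoundedFormula.IsAtomic.equal _ _).isQF
    · exact (BoundedFormula.IsAtomic.rel _ _).isQF
  refine exists_isQF_of_determined M δ hδ φ fun i i' v w hvw hv => ?_
  have heq : ∀ s s', (t s).realize v = (t s').realize v ↔ (t s).realize w = (t s').realize w := by
    intro s s'
    have := hvw (Sum.inl (s, s'))
    simpa only [δ, Sum.elim_inl, Formula.realize_equal] using this
  have hfun : ∀ (n : ℕ) (f : L.Functions n) (ss : Fin n → τ) s,
      Structure.funMap f (fun l => (t (ss l)).realize v) = (t s).realize v ↔
      Structure.funMap f (fun l => (t (ss l)).realize w) = (t s).realize w := by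
    intro n f ss s
    have := hvw (Sum.inr (Sum.inl ⟨⟨n, f⟩, ss, s⟩))
    simpa only [δ, Sum.elim_inl, Sum.elim_inr, Formula.realize_equal, Term.realize_func] using this
  have hrel : ∀ (n : ℕ) (R : L.Relations n) (ss : Fin n → τ),
      Structure.RelMap R (fun l => (t (ss l)).realize v) ↔
      Structure.RelMap R (fun l => (t (ss l)).realize w) := by
    intro n R ss
    have := hvw (Sum.inr (Sum.inr ⟨⟨n, R⟩, ss⟩))
    simpa only [δ, Sum.elim_inr, Formula.realize_rel] using this
  have hchoose : ∀ (n : ℕ) (x : Fin n → M i) (y : Fin n → M i'),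
      (∀ l, ∃ s, x l = (t s).realize v ∧ y l = (t s).realize w) →
      ∃ ss : Fin n → τ, x = (fun l => (t (ss l)).realize v) ∧
        y = fun l => (t (ss l)).realize w := by
    intro n x y h
    choose ss h1 h2 using h
    exact ⟨ss, funext h1, funext h2⟩
  -- Tuples with the same diagram give the partial isomorphism that sends the value of each term at
  -- v to its value at w.
  refine hφ i i' (fun a a' => ∃ s, a = (t s).realize v ∧ a' = (t s).realize w) ?_ ?_ v w ?_ hv
  · constructor
    · rintro a a' b b' ⟨s, rfl, rfl⟩ ⟨s', rfl, rfl⟩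
      exact heq s s'
    · intro n f x y hxy
      obtain ⟨ss, rfl, rfl⟩ := hchoose n x y hxy
      obtain ⟨s, hs⟩ := hclosed i v n f ss
      exact ⟨s, hs, (hfun n f ss s).1 hs⟩
    · intro n R x y hxy
      obtain ⟨ss, rfl, rfl⟩ := hchoose n x y hxy
      exact hrel n R ss
  · refine (Set.finite_range fun s => (t s).realize v).subset ?_
    rintro a ⟨a', s, rfl, -⟩
    exact ⟨s, rfl⟩
  · intro a
    obtain ⟨s, hs⟩ := hvar a
    exact ⟨s, (hs i v).symm, (hs i' w).symm⟩

end BackForth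

/-! ### Flat models -/

section Flat

/-- The level of the elements of the image of `e_j`. -/
def eLevel (c : ℕ → ℕ∞ × ℕ∞) (j : ℕ) : ℕ := if (c (j + 1)).2 = 0 then j + 1 else j

/-- The structures of the language of trees that come from a leveled tree. -/
structure IsFlat (k : ℕ) (c : ℕ → ℕ∞ × ℕ∞) (M : Type) [PartialOrder M] [(treeLang k).Structure M]
    (lev : M → ℕ) : Prop where
  leveled : IsLeveled (k + 1) c lev
  le_iff : ∀ a b : M, Structure.RelMap (L := treeLang k) TreeRel.le ![a, b] ↔ a ≤ b
  meet_eq : ∀ a b : M, Structure.funMap (L := treeLang k) TreeFunc.meet ![a, b] = meet a b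
  leaf_iff : ∀ a : M, Structure.RelMap (L := treeLang k) TreeRel.leaf ![a] ↔ IsMax a
  node_iff : ∀ a : M, Structure.RelMap (L := treeLang k) TreeRel.node ![a] ↔ ¬ IsMax a
  E_iff : ∀ (j : Fin k) (a : M),
    Structure.RelMap (L := treeLang k) (TreeRel.E j) ![a] ↔ lev a = eLevel c j
  Ege_iff : ∀ (j : Fin k) (a : M),
    Structure.RelMap (L := treeLang k) (TreeRel.Ege j) ![a] ↔ eLevel c j ≤ lev a
  e_eq : ∀ (j : Fin k) (a : M),
    Structure.funMap (L := treeLang k) (TreeFunc.e j) ![a] = low lev (eLevel c j) a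

/-- The elements of level `i` are the predecessors of those of level `i + 1`. -/
def HasPredLevel (n : ℕ) (c : ℕ → ℕ∞ × ℕ∞) (i : ℕ) : Prop :=
  i < n ∧ (c i).1 ≠ 0 ∧ (i + 1 = n ∨ (c (i + 1)).2 = 0)

/-- If μ vanishes at j + 1 the image is on that level, where m cannot vanish too. Otherwise the
image is on level j, and m = 0 there would force μ = 0 at j + 1. -/
theorem IsValidSeq.eLevel_ne_zero {k : ℕ} {c : ℕ → ℕ∞ × ℕ∞} (hc : IsValidSeq (k + 1) c) (j : Fin k) :
    (c (eLevel c j)).1 ≠ 0 := by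
  have := j.2
  unfold eLevel
  split_ifs with h
  · exact hc.ne_zero _ (by omega) h
  · exact fun h' => h (hc.succ j (by omega) h')

theorem eLevel_lt {k : ℕ} (c : ℕ → ℕ∞ × ℕ∞) (j : Fin k) : eLevel c j < k + 1 := by
  have := j.2
  unfold eLevel
  split_ifs <;> omega

/-- No covering occurs inside a level, which is either dense or an antichain. A covering therefore
enters a border cone and climbs exactly one level, to the leaves or to an antichain: on a level of
nodes with μ ≠ 0 there is no first element to cover with. -/
theorem IsLeveled.covBy_iff {X : Type} [PartialOrder X] {n : ℕ} {c : ℕ → ℕ∞ × ℕ∞} {lev : X → ℕ}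
    (h : IsLeveled n c lev) {x y : X} :
    y ⋖ x ↔ HasPredLevel n c (lev y) ∧ lev x = lev y + 1 ∧ y = low lev (lev y) x := by
  constructor
  · intro hyx
    have hn := h.level_lt_of_lt hyx.lt
    have hle := h.mono _ _ hyx.le
    have h1 : lev x ≠ lev y := by
      intro e
      by_cases h0 : (c (lev y)).2 = 0
      · exact h.not_lt_of_level_eq h0 hyx.lt e
      · obtain ⟨z, hz, hz'⟩ := h.dense y x hn h0 e hyx.lt
        exact hyx.2 hz hz'
    have hb : x ∈ borderAbove lev y := by
      refine ⟨hyx.lt, fun z hz hzx e => ?_⟩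
      rcases hzx.eq_or_lt with rfl | hzx
      · exact h1 e
      · exact hyx.2 hz hzx
    obtain ⟨-, hm, hlow⟩ := (h.border_iff hyx.lt).1 hb
    have h2 : lev x = lev y + 1 := by
      by_contra hcon
      obtain ⟨z, hz, hzl⟩ := h.below x (lev y + 1) (by omega)
      have hyz : y < z := h.level_lt hyx.le hz (by omega)
      refine hyx.2 hyz (lt_of_le_of_ne hz ?_)
      rintro rfl
      omega
    refine ⟨⟨hn, hm, ?_⟩, h2, hlow.symm⟩
    by_contra! hcon
    have := h.lev_le x
    obtain ⟨z, hz, hzl⟩ := h.no_first x (by omega) (by rw [h2]; exact hcon.2)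
    exact hyx.2 (h.level_lt hyx.le hz.le (by omega)) hz
  · rintro ⟨⟨hn, hm, hor⟩, h1, h2⟩
    have hg := h.low_isGreatest (i := lev y) (x := x) (by omega) hm
    rw [← h2] at hg
    refine ⟨lt_of_le_of_ne hg.1.1 (by rintro rfl; omega), fun z hyz hzx => ?_⟩
    have h3 := h.mono _ _ hyz.le
    have h4 := h.mono _ _ hzx.le
    rcases h3.eq_or_lt with h5 | h5
    · exact absurd hyz (hg.2 ⟨hzx.le, h5.symm⟩).not_gt
    · have h6 : lev z = lev y + 1 := by omega
      have h7 := h.level_lt_of_lt hzx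
      exact h.not_lt_of_level_eq (by rw [h6]; exact hor.resolve_left (by omega)) hzx (by omega)

theorem IsLeveled.exists_covBy_left_iff {X : Type} [PartialOrder X] {n : ℕ} {c : ℕ → ℕ∞ × ℕ∞}
    {lev : X → ℕ} (h : IsLeveled n c lev) {x : X} :
    (∃ y, y ⋖ x) ↔ ∃ i, lev x = i + 1 ∧ HasPredLevel n c i := by
  constructor
  · rintro ⟨y, hy⟩
    have := h.covBy_iff.1 hy
    exact ⟨lev y, this.2.1, this.1⟩
  · rintro ⟨i, hi, hp⟩
    refine ⟨low lev i x, h.covBy_iff.2 ?_⟩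
    rw [h.lev_low (by omega) hp.2.1]
    exact ⟨hp, hi, rfl⟩

/-- Since m ≠ 0, there is a border cone at y. A point of it on the next level covers y. -/
theorem IsLeveled.exists_covBy_right_iff {X : Type} [PartialOrder X] {n : ℕ} {c : ℕ → ℕ∞ × ℕ∞}
    {lev : X → ℕ} (h : IsLeveled n c lev) {y : X} :
    (∃ x, y ⋖ x) ↔ HasPredLevel n c (lev y) := by
  constructor
  · rintro ⟨x, hx⟩
    exact (h.covBy_iff.1 hx).1
  · intro hp
    have h1 : (coneOf y '' borderAbove lev y).Nonempty := by
      rw [← Set.encard_ne_zero, h.border_count y hp.1]; exact hp.2.1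
    obtain ⟨_, w, hw, -⟩ := h1
    have h2 := h.mono _ _ hw.1.le
    have h3 := hw.2 w hw.1 le_rfl
    obtain ⟨z, hyz, hzw, hzl⟩ : ∃ z, y < z ∧ z ≤ w ∧ lev z = lev y + 1 := by
      rcases (show lev y + 1 ≤ lev w by omega).eq_or_lt with h4 | h4
      · exact ⟨w, hw.1, le_rfl, h4.symm⟩
      · obtain ⟨z, hz, hzl⟩ := h.below w _ h4
        exact ⟨z, h.level_lt hw.1.le hz (by omega), hz, hzl⟩
    have hzb : z ∈ borderAbove lev y := ⟨hyz, fun u hu huz => hw.2 u hu (huz.trans hzw)⟩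
    exact ⟨z, h.covBy_iff.2 ⟨hp, hzl, ((h.border_iff hyz).1 hzb).2.2.symm⟩⟩

/-- The expansion by `p, D, F`. -/
@[reducible] noncomputable def plusStructure (k : ℕ) (M : Type) [(treeLang k).Structure M] :
    (treeLangPlus k).Structure M :=
  @Language.sumStructure (treeLang k) predLang M _ (predStructure k M)

/-- The predecessor function, as an interpretation of `p`. -/
noncomputable def predFn (k : ℕ) {M : Type} [(treeLang k).Structure M] (a : M) : M :=
  @Structure.funMap predLang M (predStructure k M) 1 PredFunc.p ![a]

namespace IsFlat

variable {k : ℕ} {c : ℕ → ℕ∞ × ℕ∞} {M : Type} [PartialOrder M] [(treeLang k).Structure M]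
  {lev : M → ℕ}

theorem isPred_iff (h : IsFlat k c M lev) (y x : M) : IsPred k y x ↔ y ⋖ x := by
  simp only [IsPred, h.le_iff, ← lt_iff_le_and_ne, CovBy]
  simp only [not_and]

theorem predFn_eq (h : IsFlat k c M lev) {a y : M} (hy : y ⋖ a) : predFn k a = y := by
  have h1 : ∃ y, IsPred k y a := ⟨y, (h.isPred_iff y a).2 hy⟩
  have h2 : predFn k a = h1.choose := by
    simp only [predFn]
    exact dif_pos h1
  have h3 := (h.isPred_iff _ a).1 h1.choose_spec
  rw [h2]
  have e1 := h.leveled.covBy_iff.1 h3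
  have e2 := h.leveled.covBy_iff.1 hy
  rw [e1.2.2, e2.2.2, show lev h1.choose = lev y by omega]

theorem predFn_of_not (h : IsFlat k c M lev) {a : M} (hy : ¬ ∃ y, y ⋖ a) : predFn k a = a := by
  have h1 : ¬ ∃ y, IsPred k y a := by simpa only [h.isPred_iff] using hy
  simp only [predFn]
  exact dif_neg h1

theorem predFn_eq_low (h : IsFlat k c M lev) {a : M} {i : ℕ} (hi : lev a = i + 1)
    (hp : HasPredLevel (k + 1) c i) : predFn k a = low lev i a := by
  refine h.predFn_eq (h.leveled.covBy_iff.2 ?_)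
  rw [h.leveled.lev_low (by omega) hp.2.1]
  exact ⟨hp, hi, rfl⟩

theorem predFn_eq_self (h : IsFlat k c M lev) {a : M}
    (hp : ¬ ∃ i, lev a = i + 1 ∧ HasPredLevel (k + 1) c i) : predFn k a = a :=
  h.predFn_of_not (by rwa [h.leveled.exists_covBy_left_iff])

/-- Here `e_j` overshoots: it lands on level j + 1, an antichain of nodes whose predecessors are on
level j, and p corrects this. -/
theorem low_eq_predFn_e (hc : IsValidSeq (k + 1) c) (h : IsFlat k c M lev) {j : Fin k}
    (hj : (c (j + 1)).2 = 0) (hcj : (c j).1 ≠ 0) (a : M) :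
    low lev j a = if j < lev a then predFn k (low lev (eLevel c j) a) else a := by
  have he : eLevel c j = j + 1 := by simp [eLevel, hj]
  have hlt : (j : ℕ) < k + 1 := by omega
  split_ifs with h3
  · have h4 := hc.eLevel_ne_zero j
    rw [he] at h4 ⊢
    have h5 := h.leveled.low_isGreatest (x := a) (i := j + 1) (by omega) h4
    rw [h.predFn_eq_low h5.1.2 ⟨hlt, hcj, Or.inr hj⟩]
    exact (h.leveled.low_eq_of_le h5.1.1 (by rw [h5.1.2]; omega) hcj).symm
  · exact h.leveled.low_eq_self (by omega)

theorem low_last_eq_predFn (h : IsFlat k c M lev) (hck : (c k).1 ≠ 0) (a : M) :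
    low lev k a = if k < lev a then predFn k a else a := by
  split_ifs with h3
  · have := h.leveled.lev_le a
    exact (h.predFn_eq_low (by omega) ⟨by omega, hck, Or.inl rfl⟩).symm
  · exact h.leveled.low_eq_self (by omega)

/-- The three ways of naming the last element of a level by a term: some `e_j`, p after `e_j`, or p
alone for the top level of nodes. -/
theorem eLevel_cases (k : ℕ) (c : ℕ → ℕ∞ × ℕ∞) {i : ℕ} (hi : i < k + 1) :
    (∃ j : Fin k, eLevel c j = i) ∨ (∃ j : Fin k, (j : ℕ) = i ∧ (c (j + 1)).2 = 0) ∨ i = k := by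
  rcases Nat.lt_succ_iff_lt_or_eq.1 hi with hi' | hi'
  · by_cases h2 : (c (i + 1)).2 = 0
    · exact Or.inr (Or.inl ⟨⟨i, hi'⟩, rfl, h2⟩)
    · exact Or.inl ⟨⟨i, hi'⟩, by simp [eLevel, h2]⟩
  · exact Or.inr (Or.inr hi')

omit [PartialOrder M] [(treeLang k).Structure M] in
-- If μ vanishes at i + 1, then `E_{≥,i}` already means level at least i + 1. Otherwise it means
-- level at least i, and `E_i`, which is level i, has to be removed.
theorem lt_lev_iff (a : M) (i : ℕ) (hi : i < k) : i < lev a ↔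
    (eLevel c (⟨i, hi⟩ : Fin k) ≤ lev a ∧ ((c (i + 1)).2 ≠ 0 → lev a ≠ eLevel c (⟨i, hi⟩ : Fin k))) := by
  simp only [eLevel]
  split_ifs with h0
  · simp [h0]
  · simp [h0]; omega

end IsFlat

theorem vec_one {M : Type} (v : Fin 1 → M) : v = ![v 0] := by
  ext i; fin_cases i; rfl

theorem vec_two {M : Type} (v : Fin 2 → M) : v = ![v 0, v 1] := by
  ext i; fin_cases i <;> rfl

/-! ### Matchings and partial isomorphisms of flat models -/

section TwoModels

variable {k : ℕ} {c : ℕ → ℕ∞ × ℕ∞} {M N : Type} [PartialOrder M] [(treeLang k).Structure M]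
  [PartialOrder N] [(treeLang k).Structure N] {lev : M → ℕ} {lev' : N → ℕ}

/-- All symbols are determined by the order, the levels, meets and `low`. In particular p is `low`
one level down where there is a predecessor, and the identity elsewhere. -/
theorem IsMatching.isPartialIso (hc : IsValidSeq (k + 1) c) (hM : IsFlat k c M lev)
    (hN : IsFlat k c N lev') {P : M → N → Prop} (hP : IsMatching (k + 1) c lev lev' P) :
    @IsPartialIso (treeLangPlus k) M N (plusStructure k M) (plusStructure k N) P := by
  let _ := plusStructure k M
  let _ := plusStructure k N
  constructor
  · intro a a' b b' h h'
    exact hP.eq_iff h h'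
  · rintro n (f | f) v w hvw
    · cases f with
      | meet =>
        rw [vec_two v, vec_two w]
        show P (Structure.funMap (L := treeLang k) TreeFunc.meet ![v 0, v 1])
          (Structure.funMap (L := treeLang k) TreeFunc.meet ![w 0, w 1])
        rw [hM.meet_eq, hN.meet_eq]
        exact hP.meet _ _ _ _ (hvw 0) (hvw 1)
      | e j =>
        rw [vec_one v, vec_one w]
        show P (Structure.funMap (L := treeLang k) (TreeFunc.e j) ![v 0])
          (Structure.funMap (L := treeLang k) (TreeFunc.e j) ![w 0])
        rw [hM.e_eq, hN.e_eq]
        exact hP.low _ _ _ (hvw 0) (eLevel_lt c j) (hc.eLevel_ne_zero j)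
    · cases f with
      | p =>
        rw [vec_one v, vec_one w]
        show P (predFn k (v 0)) (predFn k (w 0))
        by_cases hp : ∃ i, lev (v 0) = i + 1 ∧ HasPredLevel (k + 1) c i
        · obtain ⟨i, hi, hp⟩ := hp
          rw [hM.predFn_eq_low hi hp, hN.predFn_eq_low (by rw [← hi, hP.level _ _ (hvw 0)]) hp]
          exact hP.low _ _ i (hvw 0) hp.1 hp.2.1
        · rw [hM.predFn_eq_self hp, hN.predFn_eq_self (by rwa [← hP.level _ _ (hvw 0)])]
          exact hvw 0
  · rintro n (R | R) v w hvw
    · cases R with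
      | le =>
        rw [vec_two v, vec_two w]
        show Structure.RelMap (L := treeLang k) TreeRel.le ![v 0, v 1] ↔
          Structure.RelMap (L := treeLang k) TreeRel.le ![w 0, w 1]
        rw [hM.le_iff, hN.le_iff]
        exact hP.le_iff _ _ _ _ (hvw 0) (hvw 1)
      | leaf =>
        rw [vec_one v, vec_one w]
        show Structure.RelMap (L := treeLang k) TreeRel.leaf ![v 0] ↔
          Structure.RelMap (L := treeLang k) TreeRel.leaf ![w 0]
        rw [hM.leaf_iff, hN.leaf_iff, hM.leveled.max_iff, hN.leveled.max_iff,
          hP.level _ _ (hvw 0)]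
      | node =>
        rw [vec_one v, vec_one w]
        show Structure.RelMap (L := treeLang k) TreeRel.node ![v 0] ↔
          Structure.RelMap (L := treeLang k) TreeRel.node ![w 0]
        rw [hM.node_iff, hN.node_iff, hM.leveled.max_iff, hN.leveled.max_iff,
          hP.level _ _ (hvw 0)]
      | E j =>
        rw [vec_one v, vec_one w]
        show Structure.RelMap (L := treeLang k) (TreeRel.E j) ![v 0] ↔
          Structure.RelMap (L := treeLang k) (TreeRel.E j) ![w 0]
        rw [hM.E_iff, hN.E_iff, hP.level _ _ (hvw 0)]
      | Ege j =>
        rw [vec_one v, vec_one w]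
        show Structure.RelMap (L := treeLang k) (TreeRel.Ege j) ![v 0] ↔
          Structure.RelMap (L := treeLang k) (TreeRel.Ege j) ![w 0]
        rw [hM.Ege_iff, hN.Ege_iff, hP.level _ _ (hvw 0)]
    · cases R with
      | D =>
        show (∃ y, IsPred k y (v 0)) ↔ ∃ y, IsPred k y (w 0)
        simp only [hM.isPred_iff, hN.isPred_iff, hM.leveled.exists_covBy_left_iff,
          hN.leveled.exists_covBy_left_iff, hP.level _ _ (hvw 0)]
      | F =>
        show (∃ x, IsPred k (v 0) x) ↔ ∃ x, IsPred k (w 0) x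
        simp only [hM.isPred_iff, hN.isPred_iff, hM.leveled.exists_covBy_right_iff,
          hN.leveled.exists_covBy_right_iff, hP.level _ _ (hvw 0)]

/-- Levels are recovered from the unary predicates together with the leaves, and each value of `low`
from the functions `e_j` and p according to `IsFlat.eLevel_cases`. -/
theorem IsPartialIso.isMatching (hc : IsValidSeq (k + 1) c) (hM : IsFlat k c M lev)
    (hN : IsFlat k c N lev') {P : M → N → Prop}
    (hP : @IsPartialIso (treeLangPlus k) M N (plusStructure k M) (plusStructure k N) P) :
    IsMatching (k + 1) c lev lev' P := by
  let _ := plusStructure k M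
  let _ := plusStructure k N
  have hv1 : ∀ {a a'}, P a a' → ∀ i : Fin 1, P (![a] i) (![a'] i) := by
    intro a a' h i; fin_cases i; exact h
  have hv2 : ∀ {a a' b b'}, P a a' → P b b' → ∀ i : Fin 2, P (![a, b] i) (![a', b'] i) := by
    intro a a' b b' h h' i; fin_cases i; exacts [h, h']
  have hE : ∀ a a', P a a' → ∀ j : Fin k, lev a = eLevel c j ↔ lev' a' = eLevel c j := by
    intro a a' h j
    rw [← hM.E_iff, ← hN.E_iff]
    exact hP.relMap 1 (Sum.inl (TreeRel.E j)) _ _ (hv1 h)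
  have hEge : ∀ a a', P a a' → ∀ j : Fin k, eLevel c j ≤ lev a ↔ eLevel c j ≤ lev' a' := by
    intro a a' h j
    rw [← hM.Ege_iff, ← hN.Ege_iff]
    exact hP.relMap 1 (Sum.inl (TreeRel.Ege j)) _ _ (hv1 h)
  have hmax : ∀ a a', P a a' → (lev a = k + 1 ↔ lev' a' = k + 1) := by
    intro a a' h
    rw [← hM.leveled.max_iff, ← hN.leveled.max_iff, ← hM.leaf_iff, ← hN.leaf_iff]
    exact hP.relMap 1 (Sum.inl TreeRel.leaf) _ _ (hv1 h)
  have hlt : ∀ a a', P a a' → ∀ i, i < lev a ↔ i < lev' a' := by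
    intro a a' h i
    have h1 := hM.leveled.lev_le a
    have h2 := hN.leveled.lev_le a'
    have h3 := hmax a a' h
    rcases lt_trichotomy i k with hi | rfl | hi
    · rw [IsFlat.lt_lev_iff a i hi, IsFlat.lt_lev_iff a' i hi, hEge a a' h, ne_eq, ne_eq, ne_eq, hE a a' h]
    · omega
    · omega
  have hlev : ∀ a a', P a a' → lev a = lev' a' := fun a a' h =>
    eq_of_forall_lt_iff fun i => hlt a a' h i
  have he : ∀ a a', P a a' → ∀ j : Fin k,
      P (GoodTrees.low lev (eLevel c j) a) (GoodTrees.low lev' (eLevel c j) a') := by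
    intro a a' h j
    rw [← hM.e_eq, ← hN.e_eq]
    exact hP.funMap 1 (Sum.inl (TreeFunc.e j)) _ _ (hv1 h)
  have hp : ∀ a a', P a a' → P (predFn k a) (predFn k a') := by
    intro a a' h
    exact hP.funMap 1 (Sum.inr PredFunc.p) _ _ (hv1 h)
  refine ⟨hlev, ?_, ?_, ?_⟩
  · intro a a' b b' h h'
    rw [← hM.le_iff, ← hN.le_iff]
    exact hP.relMap 2 (Sum.inl TreeRel.le) _ _ (hv2 h h')
  · intro a a' b b' h h'
    rw [← hM.meet_eq, ← hN.meet_eq]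
    exact hP.funMap 2 (Sum.inl TreeFunc.meet) _ _ (hv2 h h')
  · intro a a' i h hi hci
    have hmem : ∀ b b', P b b' →
        P (if i < lev a then b else a) (if i < lev' a' then b' else a') := by
      intro b b' hb
      by_cases h1 : i < lev a
      · rwa [if_pos h1, if_pos ((hlt a a' h i).1 h1)]
      · rwa [if_neg h1, if_neg (mt (hlt a a' h i).2 h1)]
    rcases IsFlat.eLevel_cases k c hi with ⟨j, rfl⟩ | ⟨j, rfl, hj⟩ | rfl
    · exact he a a' h j
    · rw [hM.low_eq_predFn_e hc hj hci, hN.low_eq_predFn_e hc hj hci]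
      exact hmem _ _ (hp _ _ (he a a' h j))
    · rw [hM.low_last_eq_predFn hci, hN.low_last_eq_predFn hci]
      exact hmem _ _ (hp a a' h)

/-- Formulas are preserved by finite matchings. -/
theorem realize_iff_of_isMatching (hc : IsValidSeq (k + 1) c) (hM : IsFlat k c M lev)
    (hN : IsFlat k c N lev') {P : M → N → Prop} (hP : IsMatching (k + 1) c lev lev' P)
    (hfin : {a | ∃ a', P a a'}.Finite) {α : Type} (φ : (treeLangPlus k).Formula α) (v : α → M)
    (w : α → N) (hvw : ∀ a, P (v a) (w a)) :
    @Formula.Realize _ M (plusStructure k M) _ φ v ↔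
      @Formula.Realize _ N (plusStructure k N) _ φ w := by
  let _ := plusStructure k M
  let _ := plusStructure k N
  refine realize_iff_of_backForth
    (fun Q => IsMatching (k + 1) c lev lev' Q ∧ {a | ∃ a', Q a a'}.Finite) ?_ ?_ ?_ φ P
    ⟨hP, hfin⟩ v w _ _ hvw (fun i => i.elim0)
  · rintro Q ⟨hQ, -⟩
    exact hQ.isPartialIso hc hM hN
  · rintro Q ⟨hQ, hQf⟩ x
    obtain ⟨R, hR, hRf, hQR, hx⟩ := hQ.exists_extension hc hM.leveled hN.leveled hQf x
    exact ⟨R, ⟨hR, hRf⟩, hQR, hx⟩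
  · rintro Q ⟨hQ, hQf⟩ x
    obtain ⟨R, hR, hRf, hQR, x', hx⟩ :=
      hQ.symm.exists_extension hc hN.leveled hM.leveled (hQ.finite_range hQf) x
    exact ⟨fun a a' => R a' a, ⟨hR.symm, hR.finite_range hRf⟩, fun a a' h => hQR a' a h, x', hx⟩

/-- Flat models for the same sequence of colors satisfy the same sentences. -/
theorem IsFlat.realize_sentence_iff (hc : IsValidSeq (k + 1) c) (hM : IsFlat k c M lev)
    (hN : IsFlat k c N lev') (φ : (treeLang k).Sentence) : M ⊨ φ ↔ N ⊨ φ := by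
  -- For sentences the back-and-forth can start from the empty matching.
  have h0 : IsMatching (k + 1) c lev lev' (fun _ _ => False) := by
    constructor <;> intros <;> contradiction
  have h1 := realize_iff_of_isMatching hc hM hN h0 (by simp)
    ((LHom.sumInl : treeLang k →ᴸ treeLangPlus k).onFormula φ) (default : Empty → M) default
    (fun a => a.elim)
  let _ := predStructure k M
  let _ := predStructure k N
  have e1 := LHom.realize_onFormula (M := M) (LHom.sumInl : treeLang k →ᴸ treeLangPlus k) φ (v := default)
  have e2 := LHom.realize_onFormula (M := N) (LHom.sumInl : treeLang k →ᴸ treeLangPlus k) φ (v := default)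
  exact e1.symm.trans (h1.trans e2)

end TwoModels

/-! ### Terms that exhaust finitely generated substructures -/

section QE

variable {k : ℕ}

instance : Finite (Σ n, (treeLangPlus k).Functions n) := by
  refine Finite.of_surjective (α := (Unit ⊕ Fin k) ⊕ Unit)
    (Sum.elim (Sum.elim (fun _ => ⟨2, Sum.inl TreeFunc.meet⟩)
      (fun j => ⟨1, Sum.inl (TreeFunc.e j)⟩)) (fun _ => ⟨1, Sum.inr PredFunc.p⟩)) ?_
  rintro ⟨n, (f | f)⟩
  · cases f with
    | meet => exact ⟨Sum.inl (Sum.inl ()), rfl⟩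
    | e j => exact ⟨Sum.inl (Sum.inr j), rfl⟩
  · cases f
    exact ⟨Sum.inr (), rfl⟩

instance : Finite (Σ n, (treeLangPlus k).Relations n) := by
  refine Finite.of_surjective (α := (Fin 3 ⊕ Fin k ⊕ Fin k) ⊕ Fin 2)
    (Sum.elim (Sum.elim ![⟨2, Sum.inl TreeRel.le⟩, ⟨1, Sum.inl TreeRel.leaf⟩,
        ⟨1, Sum.inl TreeRel.node⟩]
      (Sum.elim (fun j => ⟨1, Sum.inl (TreeRel.E j)⟩) (fun j => ⟨1, Sum.inl (TreeRel.Ege j)⟩)))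
      ![⟨1, Sum.inr PredRel.D⟩, ⟨1, Sum.inr PredRel.F⟩]) ?_
  rintro ⟨n, (f | f)⟩
  · cases f with
    | le => exact ⟨Sum.inl (Sum.inl 0), rfl⟩
    | leaf => exact ⟨Sum.inl (Sum.inl 1), rfl⟩
    | node => exact ⟨Sum.inl (Sum.inl 2), rfl⟩
    | E j => exact ⟨Sum.inl (Sum.inr (Sum.inl j)), rfl⟩
    | Ege j => exact ⟨Sum.inl (Sum.inr (Sum.inr j)), rfl⟩
  · cases f with
    | D => exact ⟨Sum.inr 0, rfl⟩
    | F => exact ⟨Sum.inr 1, rfl⟩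

/-- The symbol `∧` in the language with `p, D, F`. -/
def meetSymbol (k : ℕ) : (treeLangPlus k).Functions 2 := Sum.inl TreeFunc.meet

/-- The symbol `e_i` in the language with `p, D, F`. -/
def eSymbol {k : ℕ} (i : Fin k) : (treeLangPlus k).Functions 1 := Sum.inl (TreeFunc.e i)

/-- The symbol `p` in the language with `p, D, F`. -/
def pSymbol (k : ℕ) : (treeLangPlus k).Functions 1 := Sum.inr PredFunc.p

/-- The term `e_i t`, or `t` if there is no index. -/
def eTerm {k : ℕ} {α : Type} (t : (treeLangPlus k).Term α) :
    Option (Fin k) → (treeLangPlus k).Term α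
  | none => t
  | some i => Term.func (eSymbol i) ![t]

/-- The term `p t` or `t`. -/
def pTerm {k : ℕ} {α : Type} (t : (treeLangPlus k).Term α) : Bool → (treeLangPlus k).Term α
  | false => t
  | true => Term.func (pSymbol k) ![t]

/-- The terms whose values are closed under all functions. -/
def closureTerm (k j : ℕ) (s : (Fin j × Fin j) × Option (Fin k) × Bool) :
    (treeLangPlus k).Term (Fin j) :=
  pTerm (eTerm (Term.func (meetSymbol k) ![Term.var s.1.1, Term.var s.1.2]) s.2.1) s.2.2

variable {c : ℕ → ℕ∞ × ℕ∞} {M : Type} [PartialOrder M] [(treeLang k).Structure M]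
  {lev : M → ℕ}

/-- The values of the terms `eTerm`. -/
noncomputable def eVal (c : ℕ → ℕ∞ × ℕ∞) (lev : M → ℕ) (x : M) : Option (Fin k) → M
  | none => x
  | some i => low lev (eLevel c i) x

/-- The values of the terms `pTerm`. -/
noncomputable def pVal (k : ℕ) {M : Type} [(treeLang k).Structure M] (x : M) : Bool → M
  | false => x
  | true => predFn k x

theorem IsFlat.realize_closureTerm (h : IsFlat k c M lev) {j : ℕ} (v : Fin j → M)
    (s : (Fin j × Fin j) × Option (Fin k) × Bool) :
    @Term.realize _ M (plusStructure k M) _ v (closureTerm k j s) =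
      pVal k (eVal c lev (meet (v s.1.1) (v s.1.2)) s.2.1) s.2.2 := by
  let _ := plusStructure k M
  have h0 : ∀ t t' : (treeLangPlus k).Term (Fin j),
      Term.realize v (Term.func (meetSymbol k) ![t, t']) = meet (t.realize v) (t'.realize v) :=
    fun t t' => (congrArg (Structure.funMap (L := treeLang k) TreeFunc.meet) (vec_two _)).trans
      (h.meet_eq _ _)
  have h1 : ∀ i (t : (treeLangPlus k).Term (Fin j)),
      Term.realize v (Term.func (eSymbol i) ![t]) = low lev (eLevel c i) (t.realize v) :=
    fun i t => (congrArg (Structure.funMap (L := treeLang k) (TreeFunc.e i)) (vec_one _)).trans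
      (h.e_eq _ _)
  have h2 : ∀ (t : (treeLangPlus k).Term (Fin j)),
      Term.realize v (Term.func (pSymbol k) ![t]) = predFn k (t.realize v) :=
    fun t => congrArg (@Structure.funMap predLang M (predStructure k M) 1 PredFunc.p) (vec_one fun l => (![t] l).realize v)
  obtain ⟨⟨a, b⟩, o, q⟩ := s
  rcases o with - | i <;> rcases q with - | - <;>
    simp only [closureTerm, eTerm, pTerm, eVal, pVal, h0, h1, h2, Term.realize_var]

theorem IsClosedSet.predFn_mem (h : IsFlat k c M lev) {C : Set M}
    (hC : IsClosedSet (k + 1) c lev C) {a : M} (ha : a ∈ C) : predFn k a ∈ C := by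
  by_cases hp : ∃ i, lev a = i + 1 ∧ HasPredLevel (k + 1) c i
  · obtain ⟨i, hi, hp⟩ := hp
    rw [h.predFn_eq_low hi hp]
    exact hC.low a ha i hp.1 hp.2.1
  · rwa [h.predFn_eq_self hp]

theorem IsClosedSet.funMap_mem (hc : IsValidSeq (k + 1) c) (h : IsFlat k c M lev) {C : Set M}
    (hC : IsClosedSet (k + 1) c lev C) {n : ℕ} (f : (treeLangPlus k).Functions n) (w : Fin n → M)
    (hw : ∀ l, w l ∈ C) : @Structure.funMap _ M (plusStructure k M) _ f w ∈ C := by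
  rcases f with f | f
  · cases f with
    | meet =>
      rw [vec_two w]
      show Structure.funMap (L := treeLang k) TreeFunc.meet ![w 0, w 1] ∈ C
      rw [h.meet_eq]
      exact hC.meet _ (hw 0) _ (hw 1)
    | e j =>
      rw [vec_one w]
      show Structure.funMap (L := treeLang k) (TreeFunc.e j) ![w 0] ∈ C
      rw [h.e_eq]
      exact hC.low _ (hw 0) _ (eLevel_lt c j) (hc.eLevel_ne_zero j)
  · cases f
    rw [vec_one w]
    show predFn k (w 0) ∈ C
    exact hC.predFn_mem h (hw 0)

/-- Binary meets suffice: applying the dichotomy `meet_of_le` twice reduces a meet of four elements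
to a meet of two of them. -/
theorem IsFlat.meet_mem_range (h : IsFlat k c M lev) {j : ℕ} (v : Fin j → M) :
    ∀ a ∈ Set.range (fun ab : Fin j × Fin j => meet (v ab.1) (v ab.2)),
    ∀ b ∈ Set.range (fun ab : Fin j × Fin j => meet (v ab.1) (v ab.2)),
      meet a b ∈ Set.range (fun ab : Fin j × Fin j => meet (v ab.1) (v ab.2)) := by
  rintro _ ⟨⟨a, b⟩, rfl⟩ _ ⟨⟨d, e⟩, rfl⟩
  simp only
  have hl := h.leveled
  rcases hl.meet_of_le (d := meet (v d) (v e)) (hl.meet_le_left (v a) (v b)) with h1 | h1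
  · exact ⟨(a, b), h1.symm⟩
  · rw [h1, hl.meet_comm]
    rcases hl.meet_of_le (d := v a) (hl.meet_le_left (v d) (v e)) with h2 | h2
    · exact ⟨(d, e), h2.symm⟩
    · exact ⟨(d, a), h2.symm⟩

/-- The values of these terms are closed under meets and `low`, hence under all functions. This
makes flat models uniformly locally finite. -/
theorem IsFlat.range_closureTerm (hc : IsValidSeq (k + 1) c) (h : IsFlat k c M lev) {j : ℕ}
    (v : Fin j → M) :
    Set.range (fun s => @Term.realize _ M (plusStructure k M) _ v (closureTerm k j s)) =
      lowClosure (k + 1) c lev (Set.range fun ab : Fin j × Fin j => meet (v ab.1) (v ab.2)) := by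
  have hC := h.leveled.isClosedSet_lowClosure (h.meet_mem_range v)
  ext x
  simp only [h.realize_closureTerm, Set.mem_range]
  constructor
  · rintro ⟨⟨ab, o, q⟩, rfl⟩
    have h0 : meet (v ab.1) (v ab.2) ∈ lowClosure (k + 1) c lev
        (Set.range fun ab : Fin j × Fin j => meet (v ab.1) (v ab.2)) := Or.inl ⟨ab, rfl⟩
    have h1 : eVal c lev (meet (v ab.1) (v ab.2)) o ∈ lowClosure (k + 1) c lev
        (Set.range fun ab : Fin j × Fin j => meet (v ab.1) (v ab.2)) := by
      rcases o with - | i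
      · exact h0
      · exact hC.low _ h0 _ (eLevel_lt c i) (hc.eLevel_ne_zero i)
    rcases q with - | -
    · exact h1
    · exact hC.predFn_mem h h1
  · rintro (⟨ab, rfl⟩ | ⟨_, ⟨ab, rfl⟩, i, hi, hci, rfl⟩)
    · exact ⟨⟨ab, none, false⟩, rfl⟩
    · rcases IsFlat.eLevel_cases k c hi with ⟨l, rfl⟩ | ⟨l, rfl, hl⟩ | rfl
      · exact ⟨⟨ab, some l, false⟩, rfl⟩
      · rw [h.low_eq_predFn_e hc hl hci]
        split_ifs
        · exact ⟨⟨ab, some l, true⟩, rfl⟩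
        · exact ⟨⟨ab, none, false⟩, rfl⟩
      · rw [h.low_last_eq_predFn hci]
        split_ifs
        · exact ⟨⟨ab, none, true⟩, rfl⟩
        · exact ⟨⟨ab, none, false⟩, rfl⟩

/-- Quantifier elimination for flat models. -/
theorem exists_isQF_of_isFlat (hc : IsValidSeq (k + 1) c) {j : ℕ}
    (φ : (treeLangPlus k).Formula (Fin j)) :
    ∃ ψ : (treeLangPlus k).Formula (Fin j), BoundedFormula.IsQF ψ ∧
      ∀ (M : Type) [PartialOrder M] [(treeLang k).Structure M] (lev : M → ℕ), IsFlat k c M lev →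
        ∀ v : Fin j → M, @Formula.Realize _ M (plusStructure k M) _ φ v ↔
          @Formula.Realize _ M (plusStructure k M) _ ψ v := by
  -- All flat models are indexed together, so that the quantifier free formula found does not depend
  -- on the model.
  let I := Σ' (M : Type) (_ : PartialOrder M) (_ : (treeLang k).Structure M) (lev : M → ℕ),
    IsFlat k c M lev
  let str : ∀ i : I, (treeLangPlus k).Structure i.1 := fun i => @plusStructure k i.1 i.2.2.1
  suffices key : ∃ ψ : (treeLangPlus k).Formula (Fin j), BoundedFormula.IsQF ψ ∧
      ∀ (i : I) (v : Fin j → i.1), φ.Realize v ↔ ψ.Realize v by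
    obtain ⟨ψ, hψ, h⟩ := key
    exact ⟨ψ, hψ, fun M _ _ lev hM v => h ⟨M, _, _, lev, hM⟩ v⟩
  refine exists_isQF_of_finite_terms (fun i : I => i.1) (closureTerm k j) ?_ ?_ φ ?_
  · rintro a
    refine ⟨((a, a), none, false), ?_⟩
    rintro ⟨M, _, _, lev, hM⟩ v
    exact (hM.realize_closureTerm v _).trans (hM.leveled.meet_self _)
  · rintro ⟨M, _, _, lev, hM⟩ v n f ss
    have hr := hM.range_closureTerm hc v
    have hC := hM.leveled.isClosedSet_lowClosure (hM.meet_mem_range v)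
    rw [← hr] at hC
    suffices hs : @Structure.funMap _ M (plusStructure k M) _ f
        (fun l => @Term.realize _ M (plusStructure k M) _ v (closureTerm k j (ss l))) ∈
        Set.range (fun s => @Term.realize _ M (plusStructure k M) _ v (closureTerm k j s)) by
      obtain ⟨s, hs⟩ := hs
      exact ⟨s, hs.symm⟩
    exact hC.funMap_mem hc hM f _ fun l => ⟨ss l, rfl⟩
  · rintro ⟨M, _, _, lev, hM⟩ ⟨N, _, _, lev', hN⟩ P hP hfin v w hvw
    exact (realize_iff_of_isMatching hc hM hN (IsPartialIso.isMatching hc hM hN hP) hfin φ v w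
      hvw).1

end QE

end Flat

/-! ### Flat models are axiomatizable -/

section Axioms

variable {k : ℕ} {c : ℕ → ℕ∞ × ℕ∞}

/-- A property of structures that is expressed by a set of sentences. -/
def Axiomatizable (L : FirstOrder.Language.{0, 0}) (P : ∀ (M : Type) [L.Structure M], Prop) : Prop :=
  ∃ T : L.Theory, ∀ (M : Type) [L.Structure M], M ⊨ T ↔ P M

namespace Axiomatizable

variable {L : FirstOrder.Language.{0, 0}}

theorem of_sentence {P : ∀ (M : Type) [L.Structure M], Prop} (φ : L.Sentence)
    (h : ∀ (M : Type) [L.Structure M], M ⊨ φ ↔ P M) : Axiomatizable L P :=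
  ⟨{φ}, fun M _ => by rw [Theory.model_singleton_iff, h]⟩

theorem and {P Q : ∀ (M : Type) [L.Structure M], Prop} (hP : Axiomatizable L P)
    (hQ : Axiomatizable L Q) : Axiomatizable L (fun M _ => P M ∧ Q M) := by
  obtain ⟨T, hT⟩ := hP
  obtain ⟨T', hT'⟩ := hQ
  exact ⟨T ∪ T', fun M _ => by rw [Theory.model_union_iff, hT, hT']⟩

theorem all {ι : Sort*} {P : ι → ∀ (M : Type) [L.Structure M], Prop}
    (h : ∀ i, Axiomatizable L (P i)) : Axiomatizable L (fun M _ => ∀ i, P i M) := by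
  choose T hT using h
  refine ⟨⋃ i, T i, fun M _ => ?_⟩
  simp only [← hT, Theory.model_iff, Set.mem_iUnion]
  exact ⟨fun h i φ hφ => h φ ⟨i, hφ⟩, fun h φ ⟨i, hφ⟩ => h i φ hφ⟩

/-- A theory defined as the set of sentences true throughout a class contains the axioms of any
axiomatizable property of that class. So the property passes to arbitrary models of the theory. -/
theorem of_model {P : ∀ (M : Type) [L.Structure M], Prop} (hP : Axiomatizable L P) {T : L.Theory}
    (hT : ∀ φ : L.Sentence, (∀ (M : Type) [L.Structure M], P M → M ⊨ φ) → φ ∈ T) (M : Type)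
    [L.Structure M] (hM : M ⊨ T) : P M := by
  obtain ⟨S, hS⟩ := hP
  refine (hS M).1 ((Theory.model_iff S).2 fun φ hφ => ?_)
  exact hM.realize_of_mem φ (hT φ fun N _ hN => ((hS N).2 hN).realize_of_mem φ hφ)

end Axiomatizable

/-! ### First-order axioms for flatness -/

section Raw

variable {M : Type} [(treeLang k).Structure M]

/-- The interpretation of `≤`. -/
def rle (k : ℕ) {M : Type} [(treeLang k).Structure M] (a b : M) : Prop :=
  Structure.RelMap (L := treeLang k) TreeRel.le ![a, b]

/-- The interpretation of `L`. -/
def rleaf (k : ℕ) {M : Type} [(treeLang k).Structure M] (a : M) : Prop :=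
  Structure.RelMap (L := treeLang k) TreeRel.leaf ![a]

/-- The interpretation of `N`. -/
def rnode (k : ℕ) {M : Type} [(treeLang k).Structure M] (a : M) : Prop :=
  Structure.RelMap (L := treeLang k) TreeRel.node ![a]

/-- The interpretation of `E_j`. -/
def rE (j : Fin k) (a : M) : Prop := Structure.RelMap (L := treeLang k) (TreeRel.E j) ![a]

/-- The interpretation of `E_{≥,j}`. -/
def rEge (j : Fin k) (a : M) : Prop := Structure.RelMap (L := treeLang k) (TreeRel.Ege j) ![a]

/-- The interpretation of `∧`. -/
def rmeet (k : ℕ) {M : Type} [(treeLang k).Structure M] (a b : M) : M :=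
  Structure.funMap (L := treeLang k) TreeFunc.meet ![a, b]

/-- The interpretation of `e_j`. -/
def re (j : Fin k) (a : M) : M := Structure.funMap (L := treeLang k) (TreeFunc.e j) ![a]

/-- Being of level at least `i`. -/
def rG (k : ℕ) (c : ℕ → ℕ∞ × ℕ∞) (i : ℕ) {M : Type} [(treeLang k).Structure M] (a : M) : Prop :=
  match i with
  | 0 => True
  | i + 1 => if h : i < k then rEge ⟨i, h⟩ a ∧ ((c (i + 1)).2 ≠ 0 → ¬ rE ⟨i, h⟩ a)
      else i = k ∧ rleaf k a

/-- Being of level `i`. -/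
def rLv (k : ℕ) (c : ℕ → ℕ∞ × ℕ∞) (i : ℕ) {M : Type} [(treeLang k).Structure M] (a : M) : Prop :=
  rG k c i a ∧ ¬ rG k c (i + 1) a

section Formulas

variable {α : Type} {n : ℕ} (t s : (treeLang k).Term (α ⊕ Fin n)) (v : α → M) (xs : Fin n → M)

/-- The formula `t ≤ s`. -/
def fle : (treeLang k).BoundedFormula α n :=
  Relations.boundedFormula₂ (L := treeLang k) TreeRel.le t s

/-- The formula `L t`. -/
def fleaf : (treeLang k).BoundedFormula α n :=
  Relations.boundedFormula₁ (L := treeLang k) TreeRel.leaf t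

/-- The formula `N t`. -/
def fnode : (treeLang k).BoundedFormula α n :=
  Relations.boundedFormula₁ (L := treeLang k) TreeRel.node t

/-- The formula `E_j t`. -/
def fE (j : Fin k) : (treeLang k).BoundedFormula α n :=
  Relations.boundedFormula₁ (L := treeLang k) (TreeRel.E j) t

/-- The formula `E_{≥,j} t`. -/
def fEge (j : Fin k) : (treeLang k).BoundedFormula α n :=
  Relations.boundedFormula₁ (L := treeLang k) (TreeRel.Ege j) t

/-- The term `t ∧ s`. -/
def tmeet : (treeLang k).Term (α ⊕ Fin n) := Functions.apply₂ (L := treeLang k) TreeFunc.meet t s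

/-- The term `e_j t`. -/
def te (j : Fin k) : (treeLang k).Term (α ⊕ Fin n) :=
  Functions.apply₁ (L := treeLang k) (TreeFunc.e j) t

/-- The formula for being of level at least `i`. -/
noncomputable def fG (c : ℕ → ℕ∞ × ℕ∞) (i : ℕ) : (treeLang k).BoundedFormula α n :=
  match i with
  | 0 => ⊤
  | i + 1 => if h : i < k then fEge t ⟨i, h⟩ ⊓ (if (c (i + 1)).2 = 0 then ⊤ else ∼(fE t ⟨i, h⟩))
      else if i = k then fleaf t else ⊥

/-- The formula for being of level `i`. -/
noncomputable def fLv (c : ℕ → ℕ∞ × ℕ∞) (i : ℕ) : (treeLang k).BoundedFormula α n :=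
  fG t c i ⊓ ∼(fG t c (i + 1))

@[simp] theorem realize_fle : (fle t s).Realize v xs ↔
    rle k (t.realize (Sum.elim v xs)) (s.realize (Sum.elim v xs)) :=
  BoundedFormula.realize_rel₂

@[simp] theorem realize_fleaf : (fleaf t).Realize v xs ↔ rleaf k (t.realize (Sum.elim v xs)) :=
  BoundedFormula.realize_rel₁

@[simp] theorem realize_fnode : (fnode t).Realize v xs ↔ rnode k (t.realize (Sum.elim v xs)) :=
  BoundedFormula.realize_rel₁

@[simp] theorem realize_fE (j : Fin k) : (fE t j).Realize v xs ↔
    rE j (t.realize (Sum.elim v xs)) :=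
  BoundedFormula.realize_rel₁

@[simp] theorem realize_fEge (j : Fin k) : (fEge t j).Realize v xs ↔
    rEge j (t.realize (Sum.elim v xs)) :=
  BoundedFormula.realize_rel₁

@[simp] theorem realize_tmeet : (tmeet t s).realize (Sum.elim v xs) =
    rmeet k (t.realize (Sum.elim v xs)) (s.realize (Sum.elim v xs)) :=
  Term.realize_functions_apply₂

@[simp] theorem realize_te (j : Fin k) : (te t j).realize (Sum.elim v xs) =
    re j (t.realize (Sum.elim v xs)) :=
  Term.realize_functions_apply₁

@[simp] theorem realize_fG (c : ℕ → ℕ∞ × ℕ∞) (i : ℕ) : (fG t c i).Realize v xs ↔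
    rG k c i (t.realize (Sum.elim v xs)) := by
  rcases i with - | i
  · simp [fG, rG]
  · simp only [fG, rG]
    split_ifs with h1 h2 h2 <;> simp [h2]

@[simp] theorem realize_fLv (c : ℕ → ℕ∞ × ℕ∞) (i : ℕ) : (fLv t c i).Realize v xs ↔
    rLv k c i (t.realize (Sum.elim v xs)) := by
  simp [fLv, rLv]

end Formulas

/-- The cones at an element of level `i` that are represented by elements satisfying `B` are exactly
`m` in number. -/
def rCount (k : ℕ) (c : ℕ → ℕ∞ × ℕ∞) (i : ℕ) (m : ℕ∞) (M : Type) [(treeLang k).Structure M]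
    (B : M → M → Prop) : Prop :=
  ∀ (q : ℕ) (x : M), rLv k c i x → ((∃ w : Fin q → M,
    (∀ a, (rle k x (w a) ∧ x ≠ w a) ∧ B x (w a)) ∧
    ∀ a b, a ≠ b → ¬ ∃ z, (rle k x z ∧ x ≠ z) ∧ rle k z (w a) ∧ rle k z (w b)) ↔ (q : ℕ∞) ≤ m)

/-- The properties of flat models, without an order and a level function. -/
def RawFlat (k : ℕ) (c : ℕ → ℕ∞ × ℕ∞) (M : Type) [(treeLang k).Structure M] : Prop :=
  (∀ x : M, rle k x x) ∧
  (∀ x y : M, rle k x y → rle k y x → x = y) ∧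
  (∀ x y z : M, rle k x y → rle k y z → rle k x z) ∧
  (∃ x : M, rle k x x) ∧
  (∀ x y z : M, rle k y x → rle k z x → rle k y z ∨ rle k z y) ∧
  (∀ x y : M, rle k (rmeet k x y) x ∧ rle k (rmeet k x y) y) ∧
  (∀ x y z : M, rle k z x → rle k z y → rle k z (rmeet k x y)) ∧
  (∀ x : M, rleaf k x ↔ ∀ y, rle k x y → rle k y x) ∧
  (∀ x : M, rnode k x ↔ ¬ rleaf k x) ∧
  (∀ x : M, ∃ y, rle k x y ∧ rleaf k y) ∧
  (∀ i, ∀ x y : M, rle k x y → rG k c i x → rG k c i y) ∧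
  (∀ i, ∀ x : M, rG k c (i + 1) x → rG k c i x) ∧
  (∀ i, ∀ x : M, rG k c (i + 1) x → ∃ y, rle k y x ∧ rLv k c i y) ∧
  (∀ i, i < k + 1 → (c i).2 ≠ 0 → ∀ x : M, rLv k c i x → ∃ y, (rle k y x ∧ y ≠ x) ∧ rLv k c i y) ∧
  (∀ i, i < k + 1 → (c i).2 ≠ 0 → ∀ x y : M, rLv k c i x → rLv k c i y → rle k x y → x ≠ y →
    ∃ z, (rle k x z ∧ x ≠ z) ∧ rle k z y ∧ z ≠ y) ∧
  (∀ i, (c i).1 ≠ 0 → ∀ x : M, rG k c (i + 1) x →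
    ∃ y, (rle k y x ∧ rLv k c i y) ∧ ∀ z, rle k z x → rLv k c i z → rle k z y) ∧
  (∀ i, i < k + 1 → rCount k c i (c i).1 M
    (fun x y => ∀ z, rle k x z → x ≠ z → rle k z y → ¬ rLv k c i z)) ∧
  (∀ i, i < k + 1 → rCount k c i (c i).2 M (fun _ y => rLv k c i y)) ∧
  (∀ j : Fin k, ∀ x : M, rE j x ↔ rLv k c (eLevel c j) x) ∧
  (∀ j : Fin k, ∀ x : M, rEge j x ↔ rG k c (eLevel c j) x) ∧
  (∀ j : Fin k, ∀ x : M, rG k c (eLevel c j) x → (rle k (re j x) x ∧ rLv k c (eLevel c j) (re j x)) ∧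
    ∀ z, rle k z x → rLv k c (eLevel c j) z → rle k z (re j x)) ∧
  (∀ j : Fin k, ∀ x : M, ¬ rG k c (eLevel c j) x → re j x = x)

/-- A count that may be infinite is fixed by one sentence for each natural q, saying that q distinct
cones exist if and only if q ≤ m. -/
theorem axiomatizable_rCount (c : ℕ → ℕ∞ × ℕ∞) (i : ℕ) (m : ℕ∞)
    (B : ∀ (M : Type) [(treeLang k).Structure M], M → M → Prop)
    (β : ∀ {α : Type}, α → α → (treeLang k).Formula α)
    (hβ : ∀ (M : Type) [(treeLang k).Structure M] {α : Type} (x y : α) (v : α → M),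
      (β x y).Realize v ↔ B M (v x) (v y)) :
    Axiomatizable (treeLang k) (fun M _ => rCount k c i m M (B M)) := by
  refine Axiomatizable.all fun q => ?_
  let x {n : ℕ} : (treeLang k).Term ((Unit ⊕ Fin q) ⊕ Fin n) := Term.var (Sum.inl (Sum.inl ()))
  let w {n : ℕ} (a : Fin q) : (treeLang k).Term ((Unit ⊕ Fin q) ⊕ Fin n) :=
    Term.var (Sum.inl (Sum.inr a))
  let χ₁ : (treeLang k).Formula (Unit ⊕ Fin q) := Formula.iInf fun a : Fin q =>
    (fle x (w a) ⊓ ∼(x =' w a)) ⊓ β (Sum.inl ()) (Sum.inr a)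
  let χ₂ : (treeLang k).Formula (Unit ⊕ Fin q) := Formula.iInf fun ab : {ab : Fin q × Fin q // ab.1 ≠ ab.2} =>
    ∼(∃' ((fle x &0 ⊓ ∼(x =' &0)) ⊓ (fle &0 (w ab.1.1) ⊓ fle &0 (w ab.1.2))))
  -- The comparison of q with m does not depend on the structure, so it enters as a constant truth
  -- value.
  let ψ : (treeLang k).Formula Unit := (fLv (Term.var (Sum.inl ())) c i).imp
    ((Formula.iExs (Fin q) (χ₁ ⊓ χ₂)).iff (if (q : ℕ∞) ≤ m then ⊤ else ⊥))
  refine Axiomatizable.of_sentence (Formula.iAlls Unit (ψ.relabel Sum.inr)) fun M _ => ?_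
  have h1 : ∀ u : Unit ⊕ Fin q → M, χ₁.Realize u ↔ ∀ a,
      (rle k (u (Sum.inl ())) (u (Sum.inr a)) ∧ u (Sum.inl ()) ≠ u (Sum.inr a)) ∧
        B M (u (Sum.inl ())) (u (Sum.inr a)) := by
    intro u
    rw [Formula.realize_iInf]
    refine forall_congr' fun a => ?_
    rw [Formula.realize_inf, hβ]
    simp [Formula.Realize, x, w]
  have h2 : ∀ u : Unit ⊕ Fin q → M, χ₂.Realize u ↔ ∀ a b, a ≠ b →
      ¬ ∃ z, (rle k (u (Sum.inl ())) z ∧ u (Sum.inl ()) ≠ z) ∧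
        rle k z (u (Sum.inr a)) ∧ rle k z (u (Sum.inr b)) := by
    intro u
    rw [Formula.realize_iInf]
    simp [Formula.Realize, x, w, Fin.snoc]
  have h3 : ∀ v : Unit → M, ψ.Realize v ↔ (rLv k c i (v ()) → ((∃ u : Fin q → M,
      (χ₁ ⊓ χ₂).Realize (Sum.elim v u)) ↔ (q : ℕ∞) ≤ m)) := by
    intro v
    have e1 : Formula.Realize (fLv (Term.var (Sum.inl ())) c i : (treeLang k).Formula Unit) v ↔
        rLv k c i (v ()) := by simp [Formula.Realize]
    rw [Formula.realize_imp, e1, Formula.realize_iff, Formula.realize_iExs]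
    by_cases hq : (q : ℕ∞) ≤ m <;> simp [hq]
  rw [Sentence.Realize, Formula.realize_iAlls]
  simp only [Formula.realize_relabel, h3, Formula.realize_inf, h1, h2]
  simp only [Function.comp_def, Sum.elim_inl, Sum.elim_inr]
  exact ⟨fun h x => h (fun _ => x), fun h v => h (v ())⟩

theorem axiomatizable_rawFlat (k : ℕ) (c : ℕ → ℕ∞ × ℕ∞) :
    Axiomatizable (treeLang k) (fun M _ => RawFlat k c M) := by
  have hB : Axiomatizable (treeLang k) (fun M _ => ∀ i, i < k + 1 → rCount k c i (c i).1 M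
      (fun x y => ∀ z, rle k x z → x ≠ z → rle k z y → ¬ rLv k c i z)) := by
    refine Axiomatizable.all fun i => Axiomatizable.all fun _ => axiomatizable_rCount c i _
      (fun M _ x y => ∀ z, rle k x z → x ≠ z → rle k z y → ¬ rLv k c i z)
      (fun x y => ∀' (fle (Term.var (Sum.inl x)) &0 ⟹ ∼(Term.var (Sum.inl x) =' &0) ⟹
        fle &0 (Term.var (Sum.inl y)) ⟹ ∼(fLv &0 c i))) ?_
    intro M _ α x y v
    simp [Formula.Realize, Fin.snoc]
  have hI : Axiomatizable (treeLang k) (fun M _ => ∀ i, i < k + 1 → rCount k c i (c i).2 M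
      (fun _ y => rLv k c i y)) := by
    refine Axiomatizable.all fun i => Axiomatizable.all fun _ => axiomatizable_rCount c i _
      (fun M _ x y => rLv k c i y) (fun x y => fLv (Term.var (Sum.inl y)) c i) ?_
    intro M _ α x y v
    simp [Formula.Realize]
  refine .and ?_ (.and ?_ (.and ?_ (.and ?_ (.and ?_ (.and ?_ (.and ?_ (.and ?_ (.and ?_ (.and ?_
    (.and ?_ (.and ?_ (.and ?_ (.and ?_ (.and ?_ (.and ?_ (.and hB (.and hI (.and ?_ (.and ?_
    (.and ?_ ?_))))))))))))))))))))
  · exact .of_sentence (∀' fle &0 &0) fun M _ => by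
      simp [Sentence.Realize, Formula.Realize, Fin.snoc]
  · exact .of_sentence (∀' ∀' (fle &0 &1 ⟹ fle &1 &0 ⟹ &0 =' &1)) fun M _ => by
      simp [Sentence.Realize, Formula.Realize, Fin.snoc]
  · exact .of_sentence (∀' ∀' ∀' (fle &0 &1 ⟹ fle &1 &2 ⟹ fle &0 &2)) fun M _ => by
      simp [Sentence.Realize, Formula.Realize, Fin.snoc]
  · exact .of_sentence (∃' fle &0 &0) fun M _ => by
      simp [Sentence.Realize, Formula.Realize, Fin.snoc]
  · exact .of_sentence (∀' ∀' ∀' (fle &1 &0 ⟹ fle &2 &0 ⟹ fle &1 &2 ⊔ fle &2 &1)) fun M _ => by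
      simp [Sentence.Realize, Formula.Realize, Fin.snoc]
  · exact .of_sentence (∀' ∀' (fle (tmeet &0 &1) &0 ⊓ fle (tmeet &0 &1) &1)) fun M _ => by
      simp [Sentence.Realize, Formula.Realize, Fin.snoc]
  · exact .of_sentence (∀' ∀' ∀' (fle &2 &0 ⟹ fle &2 &1 ⟹ fle &2 (tmeet &0 &1))) fun M _ => by
      simp [Sentence.Realize, Formula.Realize, Fin.snoc]
  · exact .of_sentence (∀' (fleaf &0 ⇔ ∀' (fle &0 &1 ⟹ fle &1 &0))) fun M _ => by
      simp [Sentence.Realize, Formula.Realize, Fin.snoc]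
  · exact .of_sentence (∀' (fnode &0 ⇔ ∼(fleaf &0))) fun M _ => by
      simp [Sentence.Realize, Formula.Realize, Fin.snoc]
  · exact .of_sentence (∀' ∃' (fle &0 &1 ⊓ fleaf &1)) fun M _ => by
      simp [Sentence.Realize, Formula.Realize, Fin.snoc]
  · exact .all fun i => .of_sentence (∀' ∀' (fle &0 &1 ⟹ fG &0 c i ⟹ fG &1 c i)) fun M _ => by
      simp [Sentence.Realize, Formula.Realize, Fin.snoc]
  · exact .all fun i => .of_sentence (∀' (fG &0 c (i + 1) ⟹ fG &0 c i)) fun M _ => by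
      simp [Sentence.Realize, Formula.Realize, Fin.snoc]
  · exact .all fun i => .of_sentence (∀' (fG &0 c (i + 1) ⟹ ∃' (fle &1 &0 ⊓ fLv &1 c i)))
      fun M _ => by simp [Sentence.Realize, Formula.Realize, Fin.snoc]
  · exact .all fun i => .all fun _ => .all fun _ => .of_sentence
      (∀' (fLv &0 c i ⟹ ∃' ((fle &1 &0 ⊓ ∼(&1 =' &0)) ⊓ fLv &1 c i))) fun M _ => by
      simp [Sentence.Realize, Formula.Realize, Fin.snoc]
  · exact .all fun i => .all fun _ => .all fun _ => .of_sentence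
      (∀' ∀' (fLv &0 c i ⟹ fLv &1 c i ⟹ fle &0 &1 ⟹ ∼(&0 =' &1) ⟹
        ∃' ((fle &0 &2 ⊓ ∼(&0 =' &2)) ⊓ (fle &2 &1 ⊓ ∼(&2 =' &1))))) fun M _ => by
      simp [Sentence.Realize, Formula.Realize, Fin.snoc]
  · exact .all fun i => .all fun _ => .of_sentence
      (∀' (fG &0 c (i + 1) ⟹ ∃' ((fle &1 &0 ⊓ fLv &1 c i) ⊓
        ∀' (fle &2 &0 ⟹ fLv &2 c i ⟹ fle &2 &1)))) fun M _ => by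
      simp [Sentence.Realize, Formula.Realize, Fin.snoc]
  · exact .all fun j => .of_sentence (∀' (fE &0 j ⇔ fLv &0 c (eLevel c j))) fun M _ => by
      simp [Sentence.Realize, Formula.Realize, Fin.snoc]
  · exact .all fun j => .of_sentence (∀' (fEge &0 j ⇔ fG &0 c (eLevel c j))) fun M _ => by
      simp [Sentence.Realize, Formula.Realize, Fin.snoc]
  · exact .all fun j => .of_sentence (∀' (fG &0 c (eLevel c j) ⟹
      (fle (te &0 j) &0 ⊓ fLv (te &0 j) c (eLevel c j)) ⊓
        ∀' (fle &1 &0 ⟹ fLv &1 c (eLevel c j) ⟹ fle &1 (te &0 j)))) fun M _ => by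
      simp [Sentence.Realize, Formula.Realize, Fin.snoc]
  · exact .all fun j => .of_sentence (∀' (∼(fG &0 c (eLevel c j)) ⟹ te &0 j =' &0)) fun M _ => by
      simp [Sentence.Realize, Formula.Realize, Fin.snoc]

end Raw

/-- Distinct cones at x are disjoint, so choosing q of them amounts to choosing representatives that
pairwise have no common lower bound strictly above x. This form is first order. -/
theorem natCast_le_encard_iff {X : Type} [PartialOrder X]
    (hlin : ∀ x y z : X, y ≤ x → z ≤ x → y ≤ z ∨ z ≤ y) (x : X) (S : Set X) (hS : ∀ y ∈ S, x < y)
    (q : ℕ) : (q : ℕ∞) ≤ (coneOf x '' S).encard ↔ ∃ w : Fin q → X, (∀ a, w a ∈ S) ∧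
      ∀ a b, a ≠ b → ¬ ∃ z, x < z ∧ z ≤ w a ∧ z ≤ w b := by
  constructor
  · intro h
    obtain ⟨t, ht, htq⟩ := Set.exists_subset_encard_eq h
    have htf : t.Finite := Set.finite_of_encard_eq_coe htq
    have hcard : Nat.card t = q := by
      rw [Nat.card_coe_set_eq, Set.ncard, htq, ENat.toNat_natCast]
    have := htf.to_subtype
    let f : t ≃ Fin q := Finite.equivFinOfCardEq hcard
    choose g hg hgx using fun C : t => ht C.2
    refine ⟨fun a => g (f.symm a), fun a => hg _, fun a b hab hz => hab ?_⟩
    have h1 : g (f.symm a) ∈ coneOf x (g (f.symm b)) := hz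
    have h2 := coneOf_eq_of_mem hlin h1
    rw [hgx, hgx] at h2
    exact f.symm.injective (Subtype.ext h2)
  · rintro ⟨w, hw, hne⟩
    have hinj : Function.Injective fun a => coneOf x (w a) := by
      intro a b hab
      by_contra hcon
      have h1 : w a ∈ coneOf x (w a) := mem_coneOf_self (hS _ (hw a))
      have hab' : coneOf x (w a) = coneOf x (w b) := hab
      rw [hab'] at h1
      exact hne a b hcon h1
    have h1 : (Set.range fun a => coneOf x (w a)).encard = q := by
      rw [← Set.image_univ, hinj.encard_image, Set.encard_univ]
      simp
    rw [← h1]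
    refine Set.encard_le_encard ?_
    rintro _ ⟨a, rfl⟩
    exact ⟨w a, hw a, rfl⟩

theorem encard_eq_iff_forall {α : Type*} (s : Set α) (m : ℕ∞) :
    s.encard = m ↔ ∀ q : ℕ, (q : ℕ∞) ≤ s.encard ↔ (q : ℕ∞) ≤ m := by
  constructor
  · rintro rfl q; rfl
  · intro h
    refine le_antisymm ?_ ?_ <;> refine ENat.forall_natCast_le_iff_le.1 fun q hq => ?_
    · exact (h q).1 hq
    · exact (h q).2 hq

theorem rCount_iff {M : Type} [PartialOrder M] [(treeLang k).Structure M] {c : ℕ → ℕ∞ × ℕ∞}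
    {lev : M → ℕ} (hle : ∀ a b : M, rle k a b ↔ a ≤ b)
    (hlv : ∀ i (a : M), rLv k c i a ↔ lev a = i)
    (hlin : ∀ x y z : M, y ≤ x → z ≤ x → y ≤ z ∨ z ≤ y) (i : ℕ) (m : ℕ∞)
    (B : M → M → Prop) : rCount k c i m M B ↔
      ∀ x : M, lev x = i → (coneOf x '' {y | x < y ∧ B x y}).encard = m := by
  simp only [rCount, hle, hlv, ← lt_iff_le_and_ne]
  rw [forall_comm]
  refine forall_congr' fun x => ?_
  rw [forall_comm]
  refine forall_congr' fun _ => ?_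
  rw [encard_eq_iff_forall]
  refine forall_congr' fun q => ?_
  rw [natCast_le_encard_iff hlin x _ fun y hy => hy.1]
  rfl

/-- Once an order and a level function agree with the raw predicates, the clauses correspond one by
one. The bound on levels is built into `rG`: index k + 1 means being a leaf, and higher indices are
impossible. -/
theorem rawFlat_iff {M : Type} [PartialOrder M] [(treeLang k).Structure M] {c : ℕ → ℕ∞ × ℕ∞}
    {lev : M → ℕ} (hle : ∀ a b : M, rle k a b ↔ a ≤ b)
    (hG : ∀ i (a : M), rG k c i a ↔ i ≤ lev a) (hc : IsValidSeq (k + 1) c) :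
    RawFlat k c M ↔ IsFlat k c M lev := by
  have hlv : ∀ i (a : M), rLv k c i a ↔ lev a = i := by
    intro i a
    rw [rLv, hG, hG]; omega
  have hleaf : ∀ a : M, rleaf k a ↔ k < lev a := by
    intro a
    have := hG (k + 1) a
    simpa [rG] using this
  have hlev : ∀ a : M, lev a ≤ k + 1 := by
    intro a
    by_contra hcon
    have := (hG (k + 2) a).2 (by omega)
    simp [rG] at this
  constructor
  · rintro ⟨h1, h2, h3, h4, h5, h6, h7, h8, h9, h10, h11, h12, h13, h14, h15, h16, h17, h18, h19,
      h20, h21, h22⟩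
    simp only [hle, hlv, hG] at h1 h2 h3 h4 h5 h6 h7 h8 h9 h10 h11 h12 h13 h14 h15 h16 h17 h18
    simp only [hle, hlv, hG] at h19 h20 h21 h22
    have hmax : ∀ x : M, IsMax x ↔ rleaf k x := fun x => (h8 x).symm
    have hglb : ∀ x y : M, IsGLB {x, y} (rmeet k x y) := fun x y => by
      refine ⟨?_, fun z hz => h7 x y z (hz (by simp)) (hz (by simp))⟩
      rintro z (rfl | rfl)
      exacts [(h6 _ _).1, (h6 _ _).2]
    have hlev' : IsLeveled (k + 1) c lev := by
      refine ⟨?_, h5, fun x y => ⟨_, hglb x y⟩, ?_, ?_, hlev, ?_, ?_, ?_, ?_, ?_, ?_, ?_⟩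
      · obtain ⟨x, -⟩ := h4
        exact ⟨x⟩
      · intro x
        obtain ⟨y, hy, hy'⟩ := h10 x
        exact ⟨y, hy, (hmax y).2 hy'⟩
      · intro x y hxy
        exact h11 _ x y hxy le_rfl
      · intro x
        rw [hmax, hleaf]
        have := hlev x
        omega
      · intro x i hi
        exact h13 i x hi
      · intro x hx hc
        obtain ⟨y, hy, hy'⟩ := h14 _ hx hc x rfl
        exact ⟨y, lt_of_le_of_ne hy.1 hy.2, hy'⟩
      · intro x y hx hc hxy hlt
        obtain ⟨z, hz, hz'⟩ := h15 _ hx hc x y rfl hxy hlt.le hlt.ne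
        exact ⟨z, lt_of_le_of_ne hz.1 hz.2, lt_of_le_of_ne hz'.1 hz'.2⟩
      · intro x i hi hci
        obtain ⟨y, hy, hy'⟩ := h16 i hci x hi
        exact ⟨y, hy, fun z hz => hy' z hz.1 hz.2⟩
      · intro x hx
        have := (rCount_iff hle hlv h5 _ _ _).1 (h17 (lev x) hx) x rfl
        rw [← this]
        congr 2
        ext y
        refine and_congr_right fun hxy => forall_congr' fun z => ?_
        exact ⟨fun h a b d => h (lt_of_le_of_ne a b) d, fun h a b => h a.le a.ne b⟩
      · intro x hx
        have := (rCount_iff hle hlv h5 _ _ _).1 (h18 (lev x) hx) x rfl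
        rw [← this]
        rfl
    have hself : ∀ x i, lev x ≤ i → low lev i x = x := fun x i => hlev'.low_eq_self
    refine ⟨hlev', hle, ?_, ?_, ?_, ?_, ?_, ?_⟩
    · intro a b
      exact (hglb a b).unique (hlev'.meet_isGLB a b)
    · intro a
      exact (hmax a).symm
    · intro a
      rw [hmax]
      exact h9 a
    · intro j a
      exact h19 j a
    · intro j a
      exact h20 j a
    · intro j a
      by_cases h : eLevel c j ≤ lev a
      · exact (low_eq ⟨(h21 j a h).1, fun z hz => (h21 j a h).2 z hz.1 hz.2⟩).symm
      · rw [hself _ _ (by omega)]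
        exact h22 j a h
  · intro h
    have hl := h.leveled
    have hmeet : ∀ x y : M, rmeet k x y = meet x y := h.meet_eq
    have hmax : ∀ x : M, rleaf k x ↔ IsMax x := h.leaf_iff
    have hnode : ∀ x : M, rnode k x ↔ ¬ IsMax x := h.node_iff
    have hE : ∀ (j : Fin k) (x : M), rE j x ↔ lev x = eLevel c j := h.E_iff
    have hEge : ∀ (j : Fin k) (x : M), rEge j x ↔ eLevel c j ≤ lev x := h.Ege_iff
    have he : ∀ (j : Fin k) (x : M), re j x = low lev (eLevel c j) x := h.e_eq
    simp only [RawFlat, rCount_iff hle hlv hl.linear_below]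
    simp only [hle, hlv, hG, hmeet, hmax, hnode, hE, hEge, he, ← lt_iff_le_and_ne]
    refine ⟨fun _ => le_rfl, fun _ _ => le_antisymm, fun _ _ _ => le_trans, ?_, hl.linear_below,
      fun x y => ⟨hl.meet_le_left x y, hl.meet_le_right x y⟩,
      fun x y z h1 h2 => hl.le_meet_iff.2 ⟨h1, h2⟩, fun x => Iff.rfl, fun _ => trivial, hl.le_leaf,
      ?_, ?_, fun i x hi => hl.below x i hi, ?_, ?_, ?_, ?_, ?_, fun _ _ => trivial,
      fun _ _ => trivial, ?_, ?_⟩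
    · obtain ⟨x⟩ := hl.nonempty
      exact ⟨x, le_rfl⟩
    · intro i x y hxy hx
      exact hx.trans (hl.mono _ _ hxy)
    · intro i x hx
      omega
    · rintro _ hi hci x rfl
      exact hl.no_first x hi hci
    · rintro _ hi hci x y rfl hy hxy hne
      obtain ⟨z, hz, hz'⟩ := hl.dense x y hi hci hy (lt_of_le_of_ne hxy hne)
      exact ⟨z, hz, hz'⟩
    · rintro i hci x hi
      obtain ⟨y, hy, hy'⟩ := hl.last x i hi hci
      exact ⟨y, hy, fun z h1 h2 => hy' ⟨h1, h2⟩⟩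
    · rintro _ hi x rfl
      rw [← hl.border_count x hi]
      congr 2
      ext y
      refine and_congr_right fun hxy => forall_congr' fun z => ?_
      exact ⟨fun h a b => h a.le a.ne b, fun h a b d => h (lt_of_le_of_ne a b) d⟩
    · rintro _ hi x rfl
      exact hl.inner_count x hi
    · intro j x hx
      have := hl.low_isGreatest hx (hc.eLevel_ne_zero j)
      exact ⟨this.1, fun z h1 h2 => this.2 ⟨h1, h2⟩⟩
    · intro j x hx
      exact hl.low_eq_self (by omega)

theorem IsFlat.rawFlat (hc : IsValidSeq (k + 1) c) {M : Type} [PartialOrder M]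
    [(treeLang k).Structure M] {lev : M → ℕ} (h : IsFlat k c M lev) : RawFlat k c M := by
  refine (rawFlat_iff h.le_iff (fun i a => ?_) hc).2 h
  have h1 := h.leveled.lev_le a
  rcases i with - | i
  · simp [rG]
  · have hE : ∀ (j : Fin k) (x : M), rE j x ↔ lev x = eLevel c j := h.E_iff
    have hEge : ∀ (j : Fin k) (x : M), rEge j x ↔ eLevel c j ≤ lev x := h.Ege_iff
    have hmax : ∀ x : M, rleaf k x ↔ IsMax x := h.leaf_iff
    simp only [rG]
    split_ifs with hi
    · rw [hE, hEge]
      exact (IsFlat.lt_lev_iff a i hi).symm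
    · rw [hmax, h.leveled.max_iff]
      omega

theorem RawFlat.exists_isFlat (hc : IsValidSeq (k + 1) c) {M : Type} [(treeLang k).Structure M]
    (h : RawFlat k c M) : ∃ (_ : PartialOrder M) (lev : M → ℕ), IsFlat k c M lev := by
  classical
  let inst : PartialOrder M :=
    { le := rle k
      le_refl := h.1
      le_trans := h.2.2.1
      le_antisymm := h.2.1 }
  have hanti : ∀ i j (x : M), i ≤ j → rG k c j x → rG k c i x := by
    intro i j x hij
    induction j, hij using Nat.le_induction with
    | base => exact fun h => h
    | succ j _ ih => exact fun hj => ih (h.2.2.2.2.2.2.2.2.2.2.2.1 j x hj)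
  -- The predicates `rG` decrease with the index, so the largest index that holds recovers all of
  -- them.
  refine ⟨inst, fun a => Nat.findGreatest (fun i => rG k c i a) (k + 1), ?_⟩
  refine (rawFlat_iff (fun _ _ => Iff.rfl) (fun i a => ?_) hc).1 h
  constructor
  · intro hi
    refine Nat.le_findGreatest ?_ hi
    by_contra hcon
    rcases i with - | i
    · omega
    · simp only [rG] at hi
      split_ifs at hi
      · omega
      · omega
  · intro hi
    refine hanti i _ a hi ?_
    exact Nat.findGreatest_spec (P := fun i => rG k c i a) (Nat.zero_le _) trivial

end Axioms

/-! ### One-colored trees are leveled -/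

section OneColored

variable {X : Type} [PartialOrder X]

open Classical in
/-- The level function of a tree with one level of nodes. -/
noncomputable def leafLev (x : X) : ℕ := if IsMax x then 1 else 0

theorem leafLev_of_isMax {x : X} (h : IsMax x) : leafLev x = 1 := if_pos h

theorem leafLev_of_not_isMax {x : X} (h : ¬ IsMax x) : leafLev x = 0 := if_neg h

theorem leafLev_eq_zero {x : X} : leafLev x = 0 ↔ ¬ IsMax x := by
  unfold leafLev; split_ifs with h <;> simp [h]

theorem leafLev_eq_one {x : X} : leafLev x = 1 ↔ IsMax x := by
  unfold leafLev; split_ifs with h <;> simp [h]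

theorem leafLev_le (x : X) : leafLev x ≤ 1 := by
  unfold leafLev; split_ifs <;> simp

theorem IsLeveled.eq_leafLev {c : ℕ → ℕ∞ × ℕ∞} {lev : X → ℕ} (h : IsLeveled 1 c lev) :
    lev = leafLev := by
  funext x
  have h1 := h.lev_le x
  have h2 := h.max_iff x
  by_cases hx : IsMax x
  · rw [leafLev_of_isMax hx]; exact h2.1 hx
  · rw [leafLev_of_not_isMax hx]
    have := mt h2.2 hx
    omega

namespace IsGoodTree

variable (h : IsGoodTree X)
include h

theorem lt_meet_iff {x y t : X} : x < meet t y ↔ t ∈ coneOf x y := by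
  have hg : IsGLB {t, y} (meet t y) := by
    have := h.has_meets t y
    rw [meet, dif_pos this]; exact this.choose_spec
  constructor
  · exact fun hx => ⟨_, hx, hg.1 (by simp), hg.1 (by simp)⟩
  · rintro ⟨z, hxz, hzt, hzy⟩
    refine hxz.trans_le (hg.2 ?_)
    rintro w (rfl | rfl)
    exacts [hzt, hzy]

theorem cone_eq (x y : X) : cone x y = coneOf x y := Set.ext fun _ => h.lt_meet_iff

omit h in
theorem borderAbove_eq {x : X} (hx : ¬ IsMax x) : borderAbove leafLev x = leavesAt x := by
  ext y
  simp only [borderAbove, leavesAt, leafLev_of_not_isMax hx, ne_eq, leafLev_eq_zero, not_not,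
    Set.mem_ofPred_eq]
  constructor
  · rintro ⟨h1, h2⟩
    exact ⟨h2 y h1 le_rfl, h1, fun z hz hzy => (h2 z hz hzy.le).not_lt hzy⟩
  · rintro ⟨h1, h2⟩
    refine ⟨h2.lt, fun z hz hzy => ?_⟩
    rcases hzy.eq_or_lt with rfl | hzy
    · exact h1
    · exact absurd hzy (h2.2 hz)

omit h in
-- The cone of a leaf that covers x contains nothing but this leaf, so different leaves give
-- different cones.
theorem encard_border {x : X} (hx : ¬ IsMax x) :
    (coneOf x '' borderAbove leafLev x).encard = (leavesAt x).encard := by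
  rw [borderAbove_eq hx]
  refine Set.InjOn.encard_image ?_
  rintro a ⟨ha, hxa⟩ b ⟨hb, hxb⟩ hab
  have h1 : a ∈ coneOf x b := by rw [← hab]; exact mem_coneOf_self hxa.lt
  obtain ⟨z, hxz, hza, hzb⟩ := h1
  have e : ∀ {d : X}, x ⋖ d → z ≤ d → z = d := fun hd hzd =>
    by_contra fun hne => hd.2 hxz (lt_of_le_of_ne hzd hne)
  rw [← e hxa hza, ← e hxb hzb]

omit h in
theorem coneOf_finite {x a : X} (hxa : x ⋖ a) (ha : IsMax a) : (coneOf x a).Finite := by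
  refine (Set.finite_singleton a).subset ?_
  rintro t ⟨z, hxz, hzt, hza⟩
  have e : z = a := by_contra fun hne => hxa.2 hxz (lt_of_le_of_ne hza hne)
  rw [e] at hzt
  exact (ha.eq_of_le hzt).symm

/-- An infinite cone contains nodes. -/
theorem exists_node_of_infinite {x y : X} (hxy : x < y) (hinf : (coneOf x y).Infinite) :
    ∃ z, x < z ∧ ¬ IsMax z ∧ coneOf x z = coneOf x y := by
  by_cases hy : IsMax y
  · have h1 : ¬ x ⋖ y := fun hc => hinf (coneOf_finite hc hy)
    obtain ⟨z, hz, hzy⟩ := (not_covBy_iff hxy).1 h1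
    exact ⟨z, hz, hzy.not_isMax, coneOf_eq_of_mem h.linear_below ⟨z, hz, le_rfl, hzy.le⟩⟩
  · exact ⟨y, hxy, hy, rfl⟩

/-- The part of the level conditions that only uses that the tree is good. -/
theorem isLeveled_of {c : ℕ → ℕ∞ × ℕ∞} (hbelow : ∀ a : X, IsMax a → ∃ y < a, True)
    (hfirst : (c 0).2 ≠ 0 → ∀ x : X, ¬ IsMax x → ∃ y, y < x)
    (hdense : (c 0).2 ≠ 0 → ∀ x y : X, ¬ IsMax y → x < y → ∃ z, x < z ∧ z < y)
    (hlast : (c 0).1 ≠ 0 → ∀ a : X, IsMax a → ∃ y, IsGreatest {z | z ≤ a ∧ ¬ IsMax z} y)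
    (hborder : ∀ x : X, ¬ IsMax x → (leavesAt x).encard = (c 0).1)
    (hinner : ∀ x : X, ¬ IsMax x →
      (coneOf x '' {y | x < y ∧ ¬ IsMax y}).encard = (c 0).2) :
    IsLeveled 1 c (leafLev : X → ℕ) := by
  have hnode : ∀ {x : X}, leafLev x < 1 → leafLev x = 0 ∧ ¬ IsMax x := fun {x} hx => by
    have : leafLev x = 0 := by omega
    exact ⟨this, leafLev_eq_zero.1 this⟩
  refine ⟨h.nonempty, h.linear_below, h.has_meets, h.leaves_everywhere, ?_, leafLev_le, ?_, ?_, ?_,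
    ?_, ?_, ?_, ?_⟩
  · intro x y hxy
    by_cases hx : IsMax x
    · rw [hx.eq_of_le hxy]
    · rw [leafLev_of_not_isMax hx]; omega
  · intro x
    exact leafLev_eq_one.symm
  · intro x i hi
    have h1 := leafLev_le x
    obtain ⟨y, hy, -⟩ := hbelow x (leafLev_eq_one.1 (by omega))
    refine ⟨y, hy.le, ?_⟩
    rw [leafLev_of_not_isMax hy.not_isMax]
    omega
  · intro x hx hc
    obtain ⟨h1, h2⟩ := hnode hx
    rw [h1] at hc ⊢
    obtain ⟨y, hy⟩ := hfirst hc x h2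
    exact ⟨y, hy, leafLev_of_not_isMax hy.not_isMax⟩
  · intro x y hx hc hyl hxy
    obtain ⟨h1, h2⟩ := hnode hx
    rw [h1] at hc hyl
    exact hdense hc x y (leafLev_eq_zero.1 hyl) hxy
  · intro x i hi hc
    have h1 := leafLev_le x
    obtain rfl : i = 0 := by omega
    simp only [leafLev_eq_zero]
    exact hlast hc x (leafLev_eq_one.1 (by omega))
  · intro x hx
    obtain ⟨h1, h2⟩ := hnode hx
    rw [encard_border h2, h1]
    exact hborder x h2
  · intro x hx
    obtain ⟨h1, h2⟩ := hnode hx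
    rw [h1, ← hinner x h2]
    simp only [innerAbove, h1, leafLev_eq_zero]

end IsGoodTree

/-- All nodes form one level. Border cones are those of the leaves covering x; inner cones are those
containing a node. There are none of the latter in type (0), and in types (1.a) and (1.b) they are
exactly the infinite cones. -/
theorem IsOneColored.isLeveled {c : ℕ → ℕ∞ × ℕ∞} (h : IsOneColored (c 0).1 (c 0).2 X) :
    IsLeveled 1 c (leafLev : X → ℕ) := by
  obtain ⟨hg, ⟨-, hμ, ⟨r, hr, hr'⟩, hm⟩ | ⟨hm, -, hbr, hcones⟩ | ⟨-, -, hbr, hcones⟩⟩ := h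
  · simp only at hr hr'
    -- The meet of a with another leaf is a node, hence is r.
    have hra : ∀ a : X, IsMax a → r < a := by
      intro a ha
      obtain ⟨b, hb, hab⟩ : ∃ b : X, IsMax b ∧ b ≠ a := by
        obtain ⟨b, b', hb, hb', hne, -⟩ := hg.node_eq_meet r hr
        by_cases e : b = a
        · exact ⟨b', hb', fun e' => hne (e.trans e'.symm)⟩
        · exact ⟨b, hb, e⟩
      obtain ⟨z, hz⟩ := hg.has_meets a b
      have hza : z ≤ a := hz.1 (by simp)
      have hzb : z ≤ b := hz.1 (by simp)
      have hlt : z < a := lt_of_le_of_ne hza (by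
        rintro rfl; exact hab (ha.eq_of_le hzb).symm)
      rw [← hr' z hlt.not_isMax]
      exact hlt
    refine hg.isLeveled_of (fun a ha => ⟨r, hra a ha, trivial⟩) (fun h0 => absurd hμ h0)
      (fun h0 => absurd hμ h0) (fun _ a ha => ⟨r, ⟨(hra a ha).le, hr⟩, fun z hz => (hr' z hz.2).le⟩)
      ?_ ?_
    · intro x hx
      rw [hr' x hx, ← hm]
      congr 1
      ext a
      exact ⟨fun h => h.1, fun h => ⟨h, hra a h, fun z hz hza => hz.ne' (hr' z hza.not_isMax)⟩⟩
    · intro x hx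
      rw [hμ, Set.encard_eq_zero, Set.image_eq_empty, Set.eq_empty_iff_forall_notMem]
      rintro y ⟨hxy, hy⟩
      rw [hr' x hx, hr' y hy] at hxy
      exact lt_irrefl _ hxy
  · refine hg.isLeveled_of (fun a ha => ?_) (fun _ x hx => ?_) (fun _ x y hy hxy => ?_)
      (fun h0 => absurd hm h0) (fun x hx => ?_) (fun x hx => ?_)
    · obtain ⟨y, hy⟩ := (hbr a ha).1
      exact ⟨y, hy, trivial⟩
    · obtain ⟨a, hxa, ha⟩ := hg.leaves_everywhere x
      obtain ⟨y, -, hy⟩ := (hbr a ha).2.1 x (lt_of_le_of_ne hxa (by rintro rfl; exact hx ha))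
      exact ⟨y, hy⟩
    · obtain ⟨a, hya, ha⟩ := hg.leaves_everywhere y
      have hya' : y < a := lt_of_le_of_ne hya (by rintro rfl; exact hy ha)
      obtain ⟨z, -, hz⟩ := (hbr a ha).2.2 x (hxy.trans hya') y hya' hxy
      exact ⟨z, hz⟩
    · rw [hm, Set.encard_eq_zero, Set.eq_empty_iff_forall_notMem]
      rintro a ⟨ha, hxa⟩
      -- A leaf covering x would give a finite cone, but in type (1.a) all cones are infinite.
      refine (hcones x hx).2 _ ⟨a, hxa.lt, rfl⟩ ?_
      rw [hg.cone_eq]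
      exact IsGoodTree.coneOf_finite hxa ha
    · rw [← (hcones x hx).1]
      congr 1
      ext C
      constructor
      · rintro ⟨y, hy, rfl⟩
        exact ⟨y, hy.1, (hg.cone_eq x y).symm⟩
      · rintro ⟨y, hy, rfl⟩
        have h1 := (hcones x hx).2 _ ⟨y, hy, rfl⟩
        rw [hg.cone_eq] at h1 ⊢
        obtain ⟨z, hz, hz', he⟩ := hg.exists_node_of_infinite hy h1
        exact ⟨z, ⟨hz, hz'⟩, he⟩
  · have hle : ∀ {x a p : X}, IsMax a → p ⋖ a → ¬ IsMax x → x ≤ a → x ≤ p := by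
      intro x a p ha hp hx hxa
      have hxa' : x < a := lt_of_le_of_ne hxa (by rintro rfl; exact hx ha)
      rcases hg.linear_below a x p hxa hp.le with h1 | h1
      · exact h1
      · rcases h1.eq_or_lt with rfl | h1
        · exact le_rfl
        · exact absurd hxa' (hp.2 h1)
    have hden : ∀ x y : X, ¬ IsMax y → x < y → ∃ z, x < z ∧ z < y := by
      intro x y hy hxy
      obtain ⟨a, hya, ha⟩ := hg.leaves_everywhere y
      obtain ⟨p, hp, hd⟩ := hbr a ha
      have hyp := hle ha hp hy hya
      obtain ⟨z, -, hz⟩ := hd.2.2 x (hxy.le.trans hyp) y hyp hxy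
      exact ⟨z, hz⟩
    refine hg.isLeveled_of (fun a ha => ?_) (fun _ x hx => ?_) (fun _ => hden)
      (fun _ a ha => ?_) (fun x hx => (hcones x hx).1) (fun x hx => ?_)
    · obtain ⟨p, hp, -⟩ := hbr a ha
      exact ⟨p, hp.lt, trivial⟩
    · obtain ⟨a, hxa, ha⟩ := hg.leaves_everywhere x
      obtain ⟨p, hp, hd⟩ := hbr a ha
      obtain ⟨y, -, hy⟩ := hd.2.1 x (hle ha hp hx hxa)
      exact ⟨y, hy⟩
    · obtain ⟨p, hp, -⟩ := hbr a ha
      exact ⟨p, ⟨hp.le, hp.lt.not_isMax⟩, fun z hz => hle ha hp hz.2 hz.1⟩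
    · rw [← (hcones x hx).2]
      congr 1
      ext C
      constructor
      · rintro ⟨y, ⟨hxy, hy⟩, rfl⟩
        refine ⟨⟨y, hxy, (hg.cone_eq x y).symm⟩, fun hfin => ?_⟩
        -- If the cone of the node y were finite, the interval from x to y would have a first
        -- element after x, against density.
        have hfin' : {z | x < z ∧ z ≤ y}.Finite :=
          hfin.subset fun z hz => ⟨z, hz.1, le_rfl, hz.2⟩
        obtain ⟨z, hz, hmin⟩ := hfin'.exists_minimal ⟨y, hxy, le_rfl⟩
        obtain ⟨w, hxw, hwz⟩ := hden x z (fun hzm => hy (hzm.eq_of_le hz.2 ▸ hzm)) hz.1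
        exact absurd (hmin ⟨hxw, hwz.le.trans hz.2⟩ hwz.le) hwz.not_ge
      · rintro ⟨⟨y, hxy, rfl⟩, hinf⟩
        rw [hg.cone_eq] at hinf ⊢
        obtain ⟨z, hz, hz', he⟩ := hg.exists_node_of_infinite hxy hinf
        exact ⟨z, ⟨hz, hz'⟩, he⟩

end OneColored

/-! ### Replacing the leaves of a leveled tree by leveled trees -/

section Fibration

variable {X Q : Type} [PartialOrder X] [PartialOrder Q]

/-- The order `X` is obtained from the order `Q` by replacing the leaves by the fibers of `π`. -/
structure IsLeafFibration (π : X → Q) : Prop where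
  surj : Function.Surjective π
  mono : ∀ x y, x ≤ y → π x ≤ π y
  lt : ∀ x y, π x < π y → x < y
  eq : ∀ x y, π x = π y → ¬ IsMax (π x) → x = y

open Classical in
/-- The level function of a tree where the leaves of a tree with `n` levels have been replaced. -/
noncomputable def fibLev (n : ℕ) (lev : Q → ℕ) (π : X → Q) (x : X) : ℕ :=
  if IsMax (π x) then n + leafLev x else lev (π x)

namespace IsLeafFibration

variable {π : X → Q} {n : ℕ} {c c' : ℕ → ℕ∞ × ℕ∞} {lev : Q → ℕ}

theorem le_of_le (hπ : IsLeafFibration π) {x y : X} (h : π x ≤ π y) (hx : ¬ IsMax (π x)) : x ≤ y := by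
  rcases h.eq_or_lt with h | h
  · exact (hπ.eq x y h hx).le
  · exact (hπ.lt x y h).le

theorem lt_iff (hπ : IsLeafFibration π) {x y : X} (hx : ¬ IsMax (π x)) : x < y ↔ π x < π y := by
  refine ⟨fun h => lt_of_le_of_ne (hπ.mono _ _ h.le) fun e => h.ne (hπ.eq _ _ e hx), hπ.lt x y⟩

theorem isMax_map (hπ : IsLeafFibration π) {x : X} (hx : IsMax x) : IsMax (π x) := by
  by_contra hcon
  obtain ⟨q, hq⟩ := not_isMax_iff.1 hcon
  obtain ⟨y, rfl⟩ := hπ.surj q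
  exact hx.not_lt (hπ.lt x y hq)

theorem isMax_fiber_iff (hπ : IsLeafFibration π) {α : Q} (hα : IsMax α) (x : {x // π x = α}) :
    IsMax x ↔ IsMax x.1 := by
  obtain ⟨x, rfl⟩ := x
  constructor
  · intro hx y hxy
    have h1 : π y = π x := (hα.eq_of_le (hπ.mono _ _ hxy)).symm
    exact hx (b := ⟨y, h1⟩) hxy
  · intro hx y hxy
    exact hx hxy

theorem leafLev_fiber (hπ : IsLeafFibration π) {α : Q} (hα : IsMax α) (x : {x // π x = α}) :
    leafLev x = leafLev x.1 := by
  unfold leafLev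
  rw [hπ.isMax_fiber_iff hα]

theorem fibLev_node {x : X} (hx : ¬ IsMax (π x)) : fibLev n lev π x = lev (π x) := if_neg hx

theorem fibLev_leaf {x : X} (hx : IsMax (π x)) : fibLev n lev π x = n + leafLev x := if_pos hx

theorem fibLev_lt_iff (hQ : IsLeveled n c lev) {x : X} {i : ℕ} (hi : i < n) :
    fibLev n lev π x = i ↔ lev (π x) = i := by
  by_cases hx : IsMax (π x)
  · rw [fibLev_leaf hx, (hQ.max_iff _).1 hx]; omega
  · rw [fibLev_node hx]

theorem lt_fibLev_iff (hQ : IsLeveled n c lev) {x : X} {i : ℕ} (hi : i < n) :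
    i < fibLev n lev π x ↔ i < lev (π x) := by
  by_cases hx : IsMax (π x)
  · rw [fibLev_leaf hx, (hQ.max_iff _).1 hx]; omega
  · rw [fibLev_node hx]

theorem fibLev_eq_iff (hQ : IsLeveled n c lev) {x : X} :
    fibLev n lev π x = n ↔ IsMax (π x) ∧ ¬ IsMax x := by
  by_cases hx : IsMax (π x)
  · rw [fibLev_leaf hx, ← leafLev_eq_zero]; simp [hx]
  · rw [fibLev_node hx, ← hQ.max_iff]; simp [hx]

theorem coneOf_eq_preimage (hπ : IsLeafFibration π)
    (hfib : ∀ α, IsMax α → ∀ x y : {x // π x = α}, ∃ z, IsGLB {x, y} z) {x y : X}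
    (hx : ¬ IsMax (π x)) : coneOf x y = π ⁻¹' coneOf (π x) (π y) := by
  ext t
  constructor
  · rintro ⟨z, hxz, hzt, hzy⟩
    exact ⟨π z, (hπ.lt_iff hx).1 hxz, hπ.mono _ _ hzt, hπ.mono _ _ hzy⟩
  · rintro ⟨q, hxq, hqt, hqy⟩
    obtain ⟨z, rfl⟩ := hπ.surj q
    by_cases hz : IsMax (π z)
    · have h1 : π t = π z := (hz.eq_of_le hqt).symm
      have h2 : π y = π z := (hz.eq_of_le hqy).symm
      -- When the common element downstairs is a leaf, an arbitrary lift need not lie below t and y.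
      -- Their meet in the fiber does, and it is above x because its projection is.
      obtain ⟨⟨w, hw⟩, hg⟩ := hfib _ hz ⟨t, h1⟩ ⟨y, h2⟩
      exact ⟨w, hπ.lt _ _ (by rw [hw]; exact hxq), hg.1 (Set.mem_insert _ _),
        hg.1 (Set.mem_insert_of_mem _ rfl)⟩
    · exact ⟨z, hπ.lt _ _ hxq, hπ.le_of_le hqt hz, hπ.le_of_le hqy hz⟩

theorem coneOf_eq_image (hπ : IsLeafFibration π) {α : Q} (hα : IsMax α) (x y : {x // π x = α}) :
    coneOf x.1 y.1 = Subtype.val '' coneOf x y := by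
  ext t
  constructor
  · rintro ⟨z, hxz, hzt, hzy⟩
    have h1 : ∀ {u : X}, x.1 ≤ u → π u = α := fun hu =>
      (hα.eq_of_le (x.2 ▸ hπ.mono _ _ hu)).symm
    exact ⟨⟨t, h1 (hxz.le.trans hzt)⟩, ⟨⟨z, h1 hxz.le⟩, hxz, hzt, hzy⟩, rfl⟩
  · rintro ⟨t, ⟨z, hxz, hzt, hzy⟩, rfl⟩
    exact ⟨z.1, hxz, hzt, hzy⟩

theorem encard_preimage (hπ : IsLeafFibration π)
    (hfib : ∀ α, IsMax α → ∀ x y : {x // π x = α}, ∃ z, IsGLB {x, y} z) {x : X}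
    (hx : ¬ IsMax (π x)) (S : Set Q) :
    (coneOf x '' (π ⁻¹' S)).encard = (coneOf (π x) '' S).encard := by
  rw [← (Set.preimage_injective.2 hπ.surj).encard_image]
  congr 1
  ext C
  constructor
  · rintro ⟨y, hy, rfl⟩
    exact ⟨_, ⟨π y, hy, rfl⟩, (hπ.coneOf_eq_preimage hfib hx).symm⟩
  · rintro ⟨_, ⟨q, hq, rfl⟩, rfl⟩
    obtain ⟨y, rfl⟩ := hπ.surj q
    exact ⟨y, hq, hπ.coneOf_eq_preimage hfib hx⟩

theorem encard_fiber (hπ : IsLeafFibration π) {x : X} (hx : IsMax (π x))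
    (S : Set {y // π y = π x}) :
    (coneOf x '' (Subtype.val '' S)).encard = (coneOf (⟨x, rfl⟩ : {y // π y = π x}) '' S).encard := by
  rw [← Subtype.val_injective.image_injective.encard_image (coneOf (⟨x, rfl⟩ : {y // π y = π x}) '' S)]
  congr 1
  simp only [Set.image_image]
  exact Set.image_congr fun y _ => hπ.coneOf_eq_image hx ⟨x, rfl⟩ y

/-- Levels below n are inherited from Q: there fibers are points and cones are preimages of cones.
Level n lives inside the fibers over leaves, which are closed upwards, so the cones of its elements
are those of the fiber. -/
theorem isLeveled (hπ : IsLeafFibration π) (hQ : IsLeveled n c lev) (hc' : c' 0 = c n)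
    (hfib : ∀ α, IsMax α → IsLeveled 1 c' (leafLev : {x // π x = α} → ℕ)) :
    IsLeveled (n + 1) c (fibLev n lev π) := by
  have hup : ∀ {x y : X}, IsMax (π x) → x ≤ y → π y = π x := fun hx hxy =>
    (hx.eq_of_le (hπ.mono _ _ hxy)).symm
  have hlevn : ∀ {x : X}, ¬ IsMax (π x) → lev (π x) < n := fun {x} hx =>
    lt_of_le_of_ne (hQ.lev_le _) (mt (hQ.max_iff _).2 hx)
  have hnm : ∀ {x : X} {i : ℕ}, i < n → lev (π x) = i → ¬ IsMax (π x) := fun {x i} hi hx hm => by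
    have := (hQ.max_iff _).1 hm
    omega
  have hglb : ∀ α, IsMax α → ∀ x y : {x // π x = α}, ∃ z, IsGLB {x, y} z :=
    fun α hα => (hfib α hα).has_meets
  have hleafmem : ∀ α, IsMax α → ∃ w : X, π w = α ∧ IsMax w := by
    intro α hα
    obtain ⟨x, rfl⟩ := hπ.surj α
    obtain ⟨⟨w, hw⟩, -, hw'⟩ := (hfib _ hα).le_leaf ⟨x, rfl⟩
    exact ⟨w, hw, (hπ.isMax_fiber_iff hα _).1 hw'⟩
  refine ⟨?_, ?_, ?_, ?_, ?_, ?_, ?_, ?_, ?_, ?_, ?_, ?_, ?_⟩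
  · obtain ⟨q⟩ := hQ.nonempty
    exact ⟨(hπ.surj q).choose⟩
  · intro x y z hyx hzx
    by_cases hy : IsMax (π y)
    · have h1 := hup hy hyx
      by_cases hz : IsMax (π z)
      · have h2 := hup hz hzx
        exact (hfib _ hy).linear_below ⟨x, h1⟩ ⟨y, rfl⟩ ⟨z, h2.symm.trans h1⟩ hyx hzx
      · have h2 : π z ≤ π y := h1 ▸ hπ.mono _ _ hzx
        exact Or.inr (hπ.le_of_le h2 hz)
    · by_cases hz : IsMax (π z)
      · have h2 := hup hz hzx
        have h1 : π y ≤ π z := h2 ▸ hπ.mono _ _ hyx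
        exact Or.inl (hπ.le_of_le h1 hy)
      · exact (hQ.linear_below _ _ _ (hπ.mono _ _ hyx) (hπ.mono _ _ hzx)).imp
          (hπ.le_of_le · hy) (hπ.le_of_le · hz)
  · intro x y
    by_cases hxy : π x = π y ∧ IsMax (π x)
    · obtain ⟨⟨w, hw⟩, hg⟩ := (hfib _ hxy.2).has_meets ⟨x, rfl⟩ ⟨y, hxy.1.symm⟩
      refine ⟨w, ?_, fun z hz => ?_⟩
      · rintro u (rfl | rfl)
        · exact hg.1 (Set.mem_insert _ _)
        · exact hg.1 (Set.mem_insert_of_mem _ rfl)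
      · have hzx : z ≤ x := hz (by simp)
        have hzy : z ≤ y := hz (by simp)
        rcases (hπ.mono _ _ hzx).eq_or_lt with h1 | h1
        · have hlb : (⟨z, h1⟩ : {u // π u = π x}) ∈ lowerBounds {⟨x, rfl⟩, ⟨y, hxy.1.symm⟩} := by
            rintro u (rfl | rfl)
            exacts [hzx, hzy]
          exact hg.2 hlb
        · exact (hπ.lt _ _ (by rw [hw]; exact h1)).le
    · obtain ⟨q, hq⟩ := hQ.has_meets (π x) (π y)
      obtain ⟨w, rfl⟩ := hπ.surj q
      have hwx : π w ≤ π x := hq.1 (by simp)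
      have hwy : π w ≤ π y := hq.1 (by simp)
      have hw : ¬ IsMax (π w) := fun hm =>
        hxy ⟨(hm.eq_of_le hwx).symm.trans (hm.eq_of_le hwy), hm.eq_of_le hwx ▸ hm⟩
      refine ⟨w, ?_, fun z hz => ?_⟩
      · rintro u (rfl | rfl)
        exacts [hπ.le_of_le hwx hw, hπ.le_of_le hwy hw]
      · have hzw : π z ≤ π w := hq.2 (by
          rintro u (rfl | rfl)
          exacts [hπ.mono _ _ (hz (by simp)), hπ.mono _ _ (hz (by simp))])
        rcases hzw.eq_or_lt with h1 | h1
        · exact (hπ.eq _ _ h1.symm hw).ge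
        · exact (hπ.lt _ _ h1).le
  · intro x
    by_cases hx : IsMax (π x)
    · obtain ⟨⟨w, hw⟩, hxw, hw'⟩ := (hfib _ hx).le_leaf ⟨x, rfl⟩
      exact ⟨w, hxw, (hπ.isMax_fiber_iff hx _).1 hw'⟩
    · obtain ⟨α, hxα, hα⟩ := hQ.le_leaf (π x)
      obtain ⟨w, rfl, hw⟩ := hleafmem α hα
      exact ⟨w, hπ.le_of_le hxα hx, hw⟩
  · intro x y hxy
    by_cases hx : IsMax (π x)
    · have h1 := hup hx hxy
      rw [fibLev_leaf hx, fibLev_leaf (h1 ▸ hx)]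
      have := (hfib _ hx).mono ⟨x, rfl⟩ ⟨y, h1⟩ hxy
      rw [hπ.leafLev_fiber hx, hπ.leafLev_fiber hx] at this
      simpa using this
    · have h1 := hlevn hx
      have h2 := hQ.mono _ _ (hπ.mono _ _ hxy)
      rw [fibLev_node hx]
      by_cases hy : IsMax (π y)
      · rw [fibLev_leaf hy]; omega
      · rwa [fibLev_node hy]
  · intro x
    by_cases hx : IsMax (π x)
    · rw [fibLev_leaf hx]
      have := leafLev_le x
      omega
    · have h1 := hlevn hx
      rw [fibLev_node hx]; omega
  · intro x
    by_cases hx : IsMax (π x)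
    · rw [fibLev_leaf hx, ← leafLev_eq_one]; omega
    · have h1 := hlevn hx
      rw [fibLev_node hx]
      exact iff_of_false (mt hπ.isMax_map hx) (by omega)
  · intro x i hi
    rcases lt_or_ge i n with hin | hin
    · rw [lt_fibLev_iff hQ hin] at hi
      obtain ⟨q, hq, hql⟩ := hQ.below _ i hi
      obtain ⟨y, rfl⟩ := hπ.surj q
      exact ⟨y, hπ.le_of_le hq (hnm hin hql), (fibLev_lt_iff hQ hin).2 hql⟩
    · have hx : IsMax (π x) := by
        by_contra hx
        have h1 := hlevn hx
        rw [fibLev_node hx] at hi; omega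
      have h1 := leafLev_le x
      rw [fibLev_leaf hx] at hi
      obtain ⟨⟨y, hy⟩, hyx, hyl⟩ := (hfib _ hx).below ⟨x, rfl⟩ 0
        (by rw [hπ.leafLev_fiber hx]; simp only; omega)
      rw [hπ.leafLev_fiber hx] at hyl
      refine ⟨y, hyx, ?_⟩
      have hyl' : leafLev y = 0 := hyl
      rw [fibLev_leaf (hy ▸ hx), hyl']
      omega
  · intro x hx hc
    rcases lt_or_ge (fibLev n lev π x) n with hin | hin
    · obtain ⟨i, hi⟩ : ∃ i, fibLev n lev π x = i := ⟨_, rfl⟩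
      rw [hi] at hin hc ⊢
      have hi' := (fibLev_lt_iff hQ hin).1 hi
      obtain ⟨q, hq, hql⟩ := hQ.no_first (π x) (by omega) (by rwa [hi'])
      obtain ⟨y, rfl⟩ := hπ.surj q
      exact ⟨y, hπ.lt _ _ hq, (fibLev_lt_iff hQ hin).2 (by omega)⟩
    · have hxn : fibLev n lev π x = n := by omega
      obtain ⟨hm, hm'⟩ := (fibLev_eq_iff hQ).1 hxn
      rw [hxn] at hc ⊢
      have hl0 : leafLev (⟨x, rfl⟩ : {y // π y = π x}) = 0 := by
        rw [hπ.leafLev_fiber hm]; exact leafLev_of_not_isMax hm'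
      obtain ⟨⟨y, hy⟩, hyx, hyl⟩ := (hfib _ hm).no_first ⟨x, rfl⟩ (by omega)
        (by rw [hl0, hc']; exact hc)
      rw [hl0, hπ.leafLev_fiber hm] at hyl
      refine ⟨y, hyx, (fibLev_eq_iff hQ).2 ⟨?_, leafLev_eq_zero.1 hyl⟩⟩
      rwa [hy]
  · intro x y hx hc hyx hxy
    rcases lt_or_ge (fibLev n lev π x) n with hin | hin
    · obtain ⟨i, hi⟩ : ∃ i, fibLev n lev π x = i := ⟨_, rfl⟩
      rw [hi] at hin hc hyx
      have hi' := (fibLev_lt_iff hQ hin).1 hi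
      have hy' := (fibLev_lt_iff hQ hin).1 hyx
      have hxm := hnm hin hi'
      obtain ⟨q, hq, hql⟩ := hQ.dense (π x) (π y) (by omega) (by rwa [hi']) (by omega)
        ((hπ.lt_iff hxm).1 hxy)
      obtain ⟨z, rfl⟩ := hπ.surj q
      exact ⟨z, hπ.lt _ _ hq, hπ.lt _ _ hql⟩
    · have hxn : fibLev n lev π x = n := by omega
      rw [hxn] at hyx hc
      obtain ⟨hm, hm'⟩ := (fibLev_eq_iff hQ).1 hxn
      obtain ⟨-, hy'⟩ := (fibLev_eq_iff hQ).1 hyx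
      have hl0 : leafLev (⟨x, rfl⟩ : {y // π y = π x}) = 0 := by
        rw [hπ.leafLev_fiber hm]; exact leafLev_of_not_isMax hm'
      have hl1 : leafLev (⟨y, hup hm hxy.le⟩ : {y // π y = π x}) = 0 := by
        rw [hπ.leafLev_fiber hm]; exact leafLev_of_not_isMax hy'
      obtain ⟨⟨z, hz⟩, hxz, hzy⟩ := (hfib _ hm).dense ⟨x, rfl⟩ ⟨y, hup hm hxy.le⟩ (by omega)
        (by rw [hl0, hc']; exact hc) (by rw [hl0, hl1]) hxy
      exact ⟨z, hxz, hzy⟩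
  · intro x i hi hc
    rcases lt_or_ge i n with hin | hin
    · rw [lt_fibLev_iff hQ hin] at hi
      obtain ⟨q, hq⟩ := hQ.last _ i hi hc
      obtain ⟨y, rfl⟩ := hπ.surj q
      refine ⟨y, ⟨hπ.le_of_le hq.1.1 (hnm hin hq.1.2), (fibLev_lt_iff hQ hin).2 hq.1.2⟩, ?_⟩
      rintro z ⟨hzx, hzl⟩
      rw [fibLev_lt_iff hQ hin] at hzl
      exact hπ.le_of_le (hq.2 ⟨hπ.mono _ _ hzx, hzl⟩) (hnm hin hzl)
    · have hx : IsMax (π x) := by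
        by_contra hx
        have h1 := hlevn hx
        rw [fibLev_node hx] at hi; omega
      have h1 := leafLev_le x
      rw [fibLev_leaf hx] at hi
      obtain rfl : i = n := by omega
      obtain ⟨⟨y, hy⟩, ⟨hyx, hyl⟩, hmax⟩ := (hfib _ hx).last ⟨x, rfl⟩ 0
        (by rw [hπ.leafLev_fiber hx]; simp only; omega) (by rwa [hc'])
      rw [hπ.leafLev_fiber hx] at hyl
      refine ⟨y, ⟨hyx, (fibLev_eq_iff hQ).2 ⟨hy ▸ hx, leafLev_eq_zero.1 hyl⟩⟩, ?_⟩
      rintro z ⟨hzx, hzl⟩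
      obtain ⟨hz, hz'⟩ := (fibLev_eq_iff hQ).1 hzl
      have hzx' : π z = π x := (hup hz hzx).symm
      have hlb : leafLev (⟨z, hzx'⟩ : {u // π u = π x}) = 0 := by
        rw [hπ.leafLev_fiber hx]
        exact leafLev_of_not_isMax hz'
      exact hmax ⟨hzx, hlb⟩
  · intro x hx
    rcases lt_or_ge (fibLev n lev π x) n with hin | hin
    · have hx' := (fibLev_lt_iff hQ hin).1 rfl
      have hxm := hnm hin hx'
      rw [← hx', ← hQ.border_count (π x) (by omega), ← hπ.encard_preimage hglb hxm]
      congr 2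
      ext y
      simp only [borderAbove, Set.mem_ofPred_eq, Set.mem_preimage, hπ.lt_iff hxm]
      refine and_congr_right fun _ => ⟨fun h q hxq hqy he => ?_, fun h z hxz hzy he => ?_⟩
      · obtain ⟨z, rfl⟩ := hπ.surj q
        have he' := he.trans hx'
        exact h z hxq (hπ.le_of_le hqy (hnm hin he')) ((fibLev_lt_iff hQ hin).2 he')
      · exact h (π z) hxz (hπ.mono _ _ hzy) (((fibLev_lt_iff hQ hin).1 he).trans hx'.symm)
    · have hxn : fibLev n lev π x = n := by omega
      obtain ⟨hm, hm'⟩ := (fibLev_eq_iff hQ).1 hxn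
      have hl0 : leafLev (⟨x, rfl⟩ : {y // π y = π x}) = 0 := by
        rw [hπ.leafLev_fiber hm]; exact leafLev_of_not_isMax hm'
      have hb := (hfib _ hm).border_count ⟨x, rfl⟩ (by omega)
      rw [hl0, hc'] at hb
      rw [hxn, ← hb, ← hπ.encard_fiber hm]
      congr 2
      ext y
      constructor
      · rintro ⟨hxy, hy⟩
        refine ⟨⟨y, hup hm hxy.le⟩, ⟨hxy, fun z hxz hzy => ?_⟩, rfl⟩
        have := hy z.1 hxz hzy
        rw [hxn, ne_eq, fibLev_eq_iff hQ] at this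
        rw [hl0, hπ.leafLev_fiber hm, ne_eq, leafLev_eq_zero]
        exact fun hz => this ⟨z.2.symm ▸ hm, hz⟩
      · rintro ⟨y, ⟨hxy, hy⟩, rfl⟩
        refine ⟨hxy, fun z hxz hzy he => ?_⟩
        rw [hxn, fibLev_eq_iff hQ] at he
        refine hy ⟨z, hup hm hxz.le⟩ hxz hzy ?_
        rw [hl0, hπ.leafLev_fiber hm, leafLev_eq_zero]
        exact he.2
  · intro x hx
    rcases lt_or_ge (fibLev n lev π x) n with hin | hin
    · have hx' := (fibLev_lt_iff hQ hin).1 rfl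
      have hxm := hnm hin hx'
      rw [← hx', ← hQ.inner_count (π x) (by omega), ← hπ.encard_preimage hglb hxm]
      congr 2
      ext y
      simp only [innerAbove, Set.mem_ofPred_eq, Set.mem_preimage, hπ.lt_iff hxm,
        fibLev_lt_iff hQ hin, hx']
    · have hxn : fibLev n lev π x = n := by omega
      obtain ⟨hm, hm'⟩ := (fibLev_eq_iff hQ).1 hxn
      have hl0 : leafLev (⟨x, rfl⟩ : {y // π y = π x}) = 0 := by
        rw [hπ.leafLev_fiber hm]; exact leafLev_of_not_isMax hm'
      have hb := (hfib _ hm).inner_count ⟨x, rfl⟩ (by omega)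
      rw [hl0, hc'] at hb
      rw [hxn, ← hb, ← hπ.encard_fiber hm]
      congr 2
      ext y
      constructor
      · rintro ⟨hxy, hy⟩
        rw [hxn, fibLev_eq_iff hQ] at hy
        refine ⟨⟨y, hup hm hxy.le⟩, ⟨hxy, ?_⟩, rfl⟩
        rw [hl0, hπ.leafLev_fiber hm, leafLev_eq_zero]
        exact hy.2
      · rintro ⟨y, ⟨hxy, hy⟩, rfl⟩
        refine ⟨hxy, ?_⟩
        rw [hl0, hπ.leafLev_fiber hm, leafLev_eq_zero] at hy
        rw [hxn, fibLev_eq_iff hQ]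
        exact ⟨y.2.symm ▸ hm, hy⟩

end IsLeafFibration

end Fibration

/-! ### Flat trees with symbols -/

/-- The symbols of a tree are interpreted according to a level function. -/
structure IsFlatTree {k : ℕ} (c : ℕ → ℕ∞ × ℕ∞) (T : ETree k) (lev : T.carrier → ℕ) : Prop where
  leveled : IsLeveled (k + 1) c lev
  mem_E : ∀ (j : Fin k) a, a ∈ T.E j ↔ lev a = eLevel c j
  mem_Ege : ∀ (j : Fin k) a, a ∈ T.Ege j ↔ eLevel c j ≤ lev a
  e_eq : ∀ (j : Fin k) a, T.e j a = low lev (eLevel c j) a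

theorem isFlat_iff_isFlatTree {k : ℕ} {c : ℕ → ℕ∞ × ℕ∞} {T : ETree k} {lev : T.carrier → ℕ} :
    IsFlat k c T.carrier lev ↔ IsFlatTree c T lev :=
  ⟨fun h => ⟨h.leveled, h.E_iff, h.Ege_iff, h.e_eq⟩, fun h => ⟨h.leveled, fun _ _ => Iff.rfl,
    fun _ _ => rfl, fun _ => Iff.rfl, fun _ => Iff.rfl, h.mem_E, h.mem_Ege, h.e_eq⟩⟩

theorem RawFlat.exists_isFlatTree {k : ℕ} {c : ℕ → ℕ∞ × ℕ∞} (hc : IsValidSeq (k + 1) c)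
    {T : ETree k} (h : RawFlat k c T.carrier) : ∃ lev, IsFlatTree c T lev := by
  obtain ⟨inst, lev, hl⟩ := h.exists_isFlat hc
  have e : inst = T.order := PartialOrder.ext fun a b => (hl.le_iff a b).symm
  subst e
  exact ⟨lev, isFlat_iff_isFlatTree.1 hl⟩

theorem IsFlatTree.rawFlat {k : ℕ} {c : ℕ → ℕ∞ × ℕ∞} (hc : IsValidSeq (k + 1) c)
    {T : ETree k} {lev : T.carrier → ℕ} (h : IsFlatTree c T lev) : RawFlat k c T.carrier :=
  (isFlat_iff_isFlatTree.2 h).rawFlat hc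

theorem IsFlatTree.of_pureTree {X : Type} [PartialOrder X] {c : ℕ → ℕ∞ × ℕ∞} {lev : X → ℕ}
    (h : IsFlatTree c (pureTree X) lev) : IsLeveled 1 c (leafLev : X → ℕ) := by
  have h1 : IsLeveled 1 c lev := h.leveled
  rwa [h1.eq_leafLev] at h1

theorem IsLeveled.isFlatTree {T : ETree 0} {c : ℕ → ℕ∞ × ℕ∞} {lev : T.carrier → ℕ}
    (h : IsLeveled 1 c lev) : IsFlatTree c T lev :=
  ⟨h, fun j => j.elim0, fun j => j.elim0, fun j => j.elim0⟩

theorem IsLeafFibration.eq_low_fibLev {X Q : Type} [PartialOrder X] [PartialOrder Q] {π : X → Q}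
    {n l : ℕ} {c : ℕ → ℕ∞ × ℕ∞} {lev : Q → ℕ} (hf : IsLeafFibration π) (hQ : IsLeveled n c lev)
    (hl : l < n) {x w : X} (hw : IsGreatest {q | q ≤ π x ∧ lev q = l} (π w)) :
    w = low (fibLev n lev π) l x := by
  have hnm : ∀ {y : X}, lev (π y) = l → ¬ IsMax (π y) := fun {y} hy hm => by
    have := (hQ.max_iff _).1 hm
    omega
  refine (low_eq ⟨⟨hf.le_of_le hw.1.1 (hnm hw.1.2), ?_⟩, fun z hz => ?_⟩).symm
  · exact (IsLeafFibration.fibLev_lt_iff hQ hl).2 hw.1.2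
  · have hz2 := (IsLeafFibration.fibLev_lt_iff hQ hl).1 hz.2
    exact hf.le_of_le (hw.2 ⟨hf.mono _ _ hz.1, hz2⟩) (hnm hz2)

theorem IsLeafFibration.le_fibLev_iff {X Q : Type} [PartialOrder X] [PartialOrder Q] {π : X → Q}
    {n l : ℕ} {c : ℕ → ℕ∞ × ℕ∞} {lev : Q → ℕ} (hQ : IsLeveled n c lev)
    (hl : l < n) {x : X} : l ≤ fibLev n lev π x ↔ l ≤ lev (π x) := by
  by_cases hx : IsMax (π x)
  · rw [fibLev_leaf hx, (hQ.max_iff _).1 hx]; omega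
  · rw [fibLev_node hx]

/-! ### The models of the extension axioms are flat -/

namespace IsExtModel

variable {k : ℕ} {Λ : ETree (k + 1)} {S : (treeLang k).Theory} {S₀ : (treeLang 0).Theory}
  {c : ℕ → ℕ∞ × ℕ∞}

section

variable (h : IsExtModel Λ S S₀)
include h

theorem meet_isGLB (x y : Λ.carrier) : IsGLB {x, y} (meet x y) := by
  have := h.base.good.has_meets x y
  rw [meet, dif_pos this]; exact this.choose_spec

theorem meet_eq_left {x y : Λ.carrier} (hxy : x ≤ y) : meet x y = x := by
  have h1 := h.meet_isGLB x y
  refine le_antisymm (h1.1 (by simp)) (h1.2 ?_)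
  rintro z (rfl | rfl)
  exacts [le_rfl, hxy]

theorem meet_le_left (x y : Λ.carrier) : meet x y ≤ x := (h.meet_isGLB x y).1 (by simp)

theorem mem_dom_iff {x : Λ.carrier} : x ∈ lastDom Λ ↔ ∃ y ∈ lastIm Λ, y ≤ x := by
  rw [h.base.dom_eq]; rfl

theorem mem_dom_of_le {x y : Λ.carrier} (hx : x ∈ lastDom Λ) (hxy : x ≤ y) : y ∈ lastDom Λ := by
  obtain ⟨z, hz, hzx⟩ := h.mem_dom_iff.1 hx
  exact h.mem_dom_iff.2 ⟨z, hz, hzx.trans hxy⟩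

theorem mem_dom_of_mem_im {x : Λ.carrier} (hx : x ∈ lastIm Λ) : x ∈ lastDom Λ :=
  h.mem_dom_iff.2 ⟨x, hx, le_rfl⟩

theorem e_mem {x : Λ.carrier} (hx : x ∈ lastDom Λ) : lastE Λ x ∈ lastIm Λ :=
  (h.base.greatest x hx).1.1

theorem le_e {x y : Λ.carrier} (hy : y ∈ lastIm Λ) (hyx : y ≤ x) : y ≤ lastE Λ x :=
  (h.base.greatest x (h.mem_dom_of_le (h.mem_dom_of_mem_im hy) hyx)).2 ⟨hy, hyx⟩

theorem e_eq_self {x : Λ.carrier} (hx : x ∈ lastIm Λ) : lastE Λ x = x :=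
  le_antisymm (h.base.le_self x (h.mem_dom_of_mem_im hx)) (h.le_e hx le_rfl)

theorem sim_symm {x y : Λ.carrier} (hxy : Sim Λ x y) : Sim Λ y x := by
  obtain ⟨_, π, hq, -⟩ := h.quot
  rw [← hq.eq_iff] at hxy ⊢
  exact hxy.symm

theorem sim_trans {x y z : Λ.carrier} (hxy : Sim Λ x y) (hyz : Sim Λ y z) : Sim Λ x z := by
  obtain ⟨_, π, hq, -⟩ := h.quot
  rw [← hq.eq_iff] at hxy hyz ⊢
  exact hxy.trans hyz

theorem not_isMax_of_mem_im {x : Λ.carrier} (hx : x ∈ lastIm Λ) : ¬ IsMax x :=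
  fun hm => (h.base.leaf_mem x hm).2 hx

/-- Above an element of the domain which is not in the image, `e` is constant. -/
theorem e_eq_of_le {x y : Λ.carrier} (hx : x ∈ lastDom Λ) (hx' : x ∉ lastIm Λ) (hxy : x ≤ y) :
    lastE Λ y = lastE Λ x ∧ y ∉ lastIm Λ := by
  have hy := h.mem_dom_of_le hx hxy
  have h1 : lastE Λ x < x := lt_of_le_of_ne (h.base.le_self x hx) fun e => hx' (e ▸ h.e_mem hx)
  have key : ∀ z ∈ lastIm Λ, z ≤ y → z ≤ x := by
    intro z hz hzy
    rcases h.base.good.linear_below y z x hzy hxy with h2 | h2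
    · exact h2
    · rcases h2.eq_or_lt with h3 | h3
      · exact h3.ge
      · exact absurd (h.base.convex _ x z (h.e_mem hx) hz h1 h3) hx'
  refine ⟨le_antisymm (h.le_e (h.e_mem hy) (key _ (h.e_mem hy) (h.base.le_self y hy)))
    (h.le_e (h.e_mem hx) (h1.le.trans hxy)), fun hy' => hx' ?_⟩
  have := le_antisymm hxy (key y hy' le_rfl)
  rwa [this]

end

/-- The elements of the classes that are the leaves of the quotient. -/
def Inner (Λ : ETree (k + 1)) (x : Λ.carrier) : Prop :=
  x ∈ lastDom Λ ∧ (Rooted Λ ∨ x ∉ lastIm Λ)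

section

variable (h : IsExtModel Λ S S₀)
include h

/-- Outside of the rooted case, a y in the image would satisfy y = e(y) = e(x) < x ∧ y, which is
absurd. -/
theorem Inner.of_sim {x y : Λ.carrier} (hx : Inner Λ x) (hxy : Sim Λ x y) : Inner Λ y := by
  rcases hxy with rfl | ⟨-, hy, he, hm⟩
  · exact hx
  · refine ⟨hy, or_iff_not_imp_left.2 fun hR hy' => ?_⟩
    rw [he, h.e_eq_self hy'] at hm
    exact absurd ((h.meet_isGLB x y).1 (by simp)) (hm hR).not_ge

/-- An element that is not inner is either outside the domain of e, or is its own value under e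
without a root; then the strict inequality in the definition of the relation cannot hold. -/
theorem eq_of_sim {x y : Λ.carrier} (hx : ¬ Inner Λ x) (hxy : Sim Λ x y) : x = y := by
  rcases hxy with rfl | ⟨hx', -, he, hm⟩
  · rfl
  · rw [Inner, not_and, not_or, not_not] at hx
    obtain ⟨hR, hx⟩ := hx hx'
    have := hm hR
    rw [h.e_eq_self hx] at this
    exact absurd (h.meet_le_left x y) this.not_ge

theorem sim_of_le_of_notMem {x y : Λ.carrier} (hx : x ∈ lastDom Λ) (hx' : x ∉ lastIm Λ)
    (hxy : x ≤ y) : Sim Λ x y := by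
  refine Or.inr ⟨hx, h.mem_dom_of_le hx hxy, (h.e_eq_of_le hx hx' hxy).1.symm, fun _ => ?_⟩
  rw [h.meet_eq_left hxy]
  exact lt_of_le_of_ne (h.base.le_self x hx) fun e => hx' (e ▸ h.e_mem hx)

variable (hS₀ : ∀ (X : Type) [PartialOrder X], (pureTree X).carrier ⊨ S₀ →
  IsLeveled 1 (fun _ => c (k + 1)) (leafLev : X → ℕ))
include hS₀

theorem isLeveled_class {x : Λ.carrier} (hx : Inner Λ x) :
    IsLeveled 1 (fun _ => c (k + 1)) (leafLev : {y : Λ.carrier // Sim Λ x y} → ℕ) :=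
  hS₀ _ (h.classes x hx.1 hx.2)

/-- If `c (k + 1)` is of type (0), a class contains no two comparable nodes. -/
theorem not_lt_of_sim (hc0 : (c (k + 1)).2 = 0) {x y z : Λ.carrier} (hx : Inner Λ x)
    (hxy : Sim Λ x y) (hxz : Sim Λ x z) (hxy' : x < y) : ¬ y < z := by
  intro hyz
  have h1 := h.isLeveled_class hS₀ hx
  have e1 : leafLev (⟨x, .inl rfl⟩ : {y : Λ.carrier // Sim Λ x y}) = 0 := by
    refine leafLev_of_not_isMax (not_isMax_of_lt (b := ⟨y, hxy⟩) hxy')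
  have e2 : leafLev (⟨y, hxy⟩ : {y : Λ.carrier // Sim Λ x y}) = 0 := by
    refine leafLev_of_not_isMax (not_isMax_of_lt (b := ⟨z, hxz⟩) hyz)
  exact h1.not_lt_of_level_eq (x := ⟨x, .inl rfl⟩) (y := ⟨y, hxy⟩) hc0 hxy' (e2.trans e1.symm)

/-- In the rooted case e(a) belongs to the class of a and is its least element, whereas μ ≠ 0 would
forbid a first node. -/
theorem snd_eq_zero_of_rooted (hR : Rooted Λ) : (c (k + 1)).2 = 0 := by
  by_contra hc0
  obtain ⟨x⟩ := h.base.good.nonempty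
  obtain ⟨a, -, ha⟩ := h.base.good.leaves_everywhere x
  obtain ⟨ha1, ha2⟩ := h.base.leaf_mem a ha
  have h1 := h.isLeveled_class hS₀ (x := a) ⟨ha1, Or.inl hR⟩
  have hea := h.e_mem ha1
  have h2 : Sim Λ a (lastE Λ a) :=
    Or.inr ⟨ha1, h.mem_dom_of_mem_im hea, (h.e_eq_self hea).symm, fun h => absurd hR h⟩
  have h3 : lastE Λ a < a := lt_of_le_of_ne (h.base.le_self a ha1) fun e => ha2 (e ▸ hea)
  have e1 : leafLev (⟨_, h2⟩ : {y : Λ.carrier // Sim Λ a y}) = 0 :=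
    leafLev_of_not_isMax (not_isMax_of_lt (b := ⟨a, .inl rfl⟩) h3)
  -- Such a y would have the same value under e as a and yet lie strictly below that value.
  obtain ⟨⟨y, hy⟩, hya, -⟩ := h1.no_first ⟨_, h2⟩ (by omega) hc0
  have hya' : y < lastE Λ a := hya
  rcases hy with rfl | ⟨-, hyd, hye, -⟩
  · exact hya'.not_gt h3
  · rw [hye] at hya'
    exact (h.base.le_self y hyd).not_gt hya'

/-- If the structure were not rooted, the classes of leaves would be closed upwards and, as μ = 0,
contain no chain of three elements. Then every leaf has a predecessor in its class and no two such
predecessors are comparable, which is rootedness itself. -/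
theorem rooted_of_snd_eq_zero (hc0 : (c (k + 1)).2 = 0) : Rooted Λ := by
  by_contra hR
  have hin : ∀ a : Λ.carrier, IsMax a → Inner Λ a := fun a ha =>
    ⟨(h.base.leaf_mem a ha).1, Or.inr (h.base.leaf_mem a ha).2⟩
  have key : ∀ a : Λ.carrier, IsMax a → ∃ r, Sim Λ a r ∧ r ⋖ a := by
    intro a ha
    have h1 := h.isLeveled_class hS₀ (hin a ha)
    have e1 : leafLev (⟨a, .inl rfl⟩ : {y : Λ.carrier // Sim Λ a y}) = 1 :=
      leafLev_of_isMax fun y hy => ha (b := y.1) hy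
    obtain ⟨⟨r, hr⟩, hra, hrl⟩ := h1.below ⟨a, .inl rfl⟩ 0 (by omega)
    have hra' : r < a := lt_of_le_of_ne hra fun e => by
      subst e; omega
    have hr' := (hin a ha).of_sim h hr
    refine ⟨r, hr, hra', fun w hrw hwa => ?_⟩
    have h2 := hr'.2.resolve_left hR
    exact h.not_lt_of_sim hS₀ hc0 hr' (h.sim_of_le_of_notMem hr'.1 h2 hrw.le) (h.sim_symm hr) hrw hwa
  have huniq : ∀ {a x r : Λ.carrier}, x ⋖ a → r ⋖ a → x = r := by
    intro a x r hx hr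
    rcases h.base.good.linear_below a x r hx.le hr.le with h1 | h1
    · exact h1.eq_or_lt.resolve_right fun h2 => hx.2 h2 hr.lt
    · exact (h1.eq_or_lt.resolve_right fun h2 => hr.2 h2 hx.lt).symm
  refine hR ⟨fun a ha => (key a ha).imp fun _ h => h.2, fun a b x y ha hb hx hy hxy => ?_⟩
  obtain ⟨r, hr, hr'⟩ := key a ha
  obtain ⟨s, hs, hs'⟩ := key b hb
  obtain rfl := huniq hx hr'
  obtain rfl := huniq hy hs'
  have hx' := (hin a ha).of_sim h hr
  have h2 := hx'.2.resolve_left hR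
  exact h.not_lt_of_sim hS₀ hc0 hx' (h.sim_of_le_of_notMem hx'.1 h2 hxy.le)
    (h.sim_of_le_of_notMem hx'.1 h2 (hxy.trans hs'.lt).le) hxy hs'.lt

theorem rooted_iff : Rooted Λ ↔ (c (k + 1)).2 = 0 :=
  ⟨h.snd_eq_zero_of_rooted hS₀, h.rooted_of_snd_eq_zero hS₀⟩

/-- In the rooted case, every element of the image is the predecessor of a leaf. -/
theorem exists_covBy_leaf (hR : Rooted Λ) {x : Λ.carrier} (hx : x ∈ lastIm Λ) {y : Λ.carrier}
    (hxy : x < y) (hy : y ∉ lastIm Λ) (hye : lastE Λ y = x) : ∃ b, IsMax b ∧ x ⋖ b := by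
  have hc0 := h.snd_eq_zero_of_rooted hS₀ hR
  have hxd := h.mem_dom_of_mem_im hx
  have hin : Inner Λ x := ⟨hxd, Or.inl hR⟩
  have hyd := h.mem_dom_of_le hxd hxy.le
  have hsim : ∀ {z : Λ.carrier}, y ≤ z → Sim Λ x z := fun {z} hyz =>
    Or.inr ⟨hxd, h.mem_dom_of_le hyd hyz, by
      rw [(h.e_eq_of_le hyd hy hyz).1, hye, h.e_eq_self hx], fun h => absurd hR h⟩
  obtain ⟨b, hyb, hb⟩ := h.base.good.leaves_everywhere y
  refine ⟨b, hb, hxy.trans_le hyb, fun w hxw hwb => ?_⟩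
  refine h.not_lt_of_sim hS₀ hc0 hin ?_ (hsim hyb) hxw hwb
  rcases h.base.good.linear_below b w y hwb.le hyb with h1 | h1
  · have hwd := h.mem_dom_of_le hxd hxw.le
    refine Or.inr ⟨hxd, hwd, ?_, fun h => absurd hR h⟩
    rw [h.e_eq_self hx]
    refine le_antisymm (h.le_e hx hxw.le) ?_
    rw [← hye]
    exact h.le_e (h.e_mem hwd) ((h.base.le_self w hwd).trans h1)
  · exact hsim h1

/-- Each element of E has a leaf in its class and is covered by a leaf, and predecessors of leaves
are incomparable in the rooted case. -/
theorem im_antichain (hR : Rooted Λ) {x y : Λ.carrier} (hx : x ∈ lastIm Λ) (hy : y ∈ lastIm Λ) :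
    ¬ x < y := by
  have key : ∀ z ∈ lastIm Λ, ∃ b, IsMax b ∧ z ⋖ b := by
    intro z hz
    have h1 := h.isLeveled_class hS₀ (x := z) ⟨h.mem_dom_of_mem_im hz, Or.inl hR⟩
    have hzd := h.mem_dom_of_mem_im hz
    have hle : ∀ {u : Λ.carrier}, Sim Λ z u → z ≤ u := by
      rintro u (rfl | ⟨-, hu, he, -⟩)
      · exact le_rfl
      · rw [← h.e_eq_self hz, he]; exact h.base.le_self u hu
    obtain ⟨u, hu⟩ : ∃ u, ∃ hu : Sim Λ z u, leafLev (⟨u, hu⟩ : {y : Λ.carrier // Sim Λ z y}) = 1 := by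
      obtain ⟨⟨u, hu⟩, h2⟩ := h1.exists_level (l := 1) le_rfl
      exact ⟨u, hu, h2⟩
    obtain ⟨hu, hul⟩ := hu
    obtain ⟨⟨r, hr⟩, hru, hrl⟩ := h1.below ⟨u, hu⟩ 0 (by omega)
    have hru' : r < u := lt_of_le_of_ne hru fun e => by subst e; omega
    have hzu : z < u := (hle hr).trans_lt hru'
    have hue : lastE Λ u = z := by
      rcases hu with rfl | ⟨-, -, he, -⟩
      · exact h.e_eq_self hz
      · rw [← he, h.e_eq_self hz]
    refine h.exists_covBy_leaf hS₀ hR hz hzu (fun hui => ?_) hue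
    rw [h.e_eq_self hui] at hue
    exact hzu.ne' hue
  obtain ⟨a, ha, hxa⟩ := key x hx
  obtain ⟨b, hb, hyb⟩ := key y hy
  exact hR.2 a b x y ha hb hxa hyb

theorem sim_of_le {x y : Λ.carrier} (hx : Inner Λ x) (hxy : x ≤ y) : Sim Λ x y := by
  by_cases hx' : x ∈ lastIm Λ
  · have hR := hx.2.resolve_right (not_not.2 hx')
    have hy := h.mem_dom_of_le hx.1 hxy
    refine Or.inr ⟨hx.1, hy, ?_, fun h => absurd hR h⟩
    rw [h.e_eq_self hx']
    exact (h.le_e hx' hxy).eq_or_lt.resolve_right (h.im_antichain hS₀ hR hx' (h.e_mem hy))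
  · exact h.sim_of_le_of_notMem hx.1 hx' hxy

omit h hS₀ in
-- Since m ≠ 0 at level k, the predecessors of the leaves of the quotient fill this whole level.
-- Fibers over nodes are points, so E is its full preimage.
theorem mem_E_last_of_not_rooted {Q : ETree k} {lev : Q.carrier → ℕ} {π : Λ.carrier → Q.carrier}
    (hc : IsValidSeq (k + 2) c) (hf : IsLeafFibration π) (hQ : IsLeveled (k + 1) c lev)
    (hc0 : (c (k + 1)).2 ≠ 0) (him : π '' lastIm Λ = {y | ∃ a, IsMax a ∧ y ⋖ a}) {x : Λ.carrier} :
    x ∈ lastIm Λ ↔ lev (π x) = k := by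
  have hk : (c k).1 ≠ 0 := fun h0 => hc0 (hc.succ k (by omega) h0)
  constructor
  · intro hx
    obtain ⟨a, ha, hxa⟩ : π x ∈ {y | ∃ a, IsMax a ∧ y ⋖ a} := him ▸ Set.mem_image_of_mem π hx
    have h1 := (hQ.covBy_iff.1 hxa).2.1
    rw [(hQ.max_iff a).1 ha] at h1
    omega
  · intro hx
    obtain ⟨a, ha⟩ := (hQ.exists_covBy_right_iff (y := π x)).2 (by
      rw [hx]; exact ⟨by omega, hk, Or.inl rfl⟩)
    have ha' : IsMax a := (hQ.max_iff a).2 (by rw [(hQ.covBy_iff.1 ha).2.1, hx])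
    obtain ⟨z, hz, hzx⟩ : π x ∈ π '' lastIm Λ := him ▸ ⟨a, ha', ha⟩
    rw [← hf.eq z x hzx (by rw [hzx]; exact not_isMax_of_lt ha.lt)]
    exact hz

section Quotient

variable {Q : ETree k} {π : Λ.carrier → Q.carrier} (hq : IsQuotient Λ Q π)
include hq

/-- Inner classes are closed upwards, so nothing in the quotient exceeds them. Any other class is a
single element that is not a leaf of Λ, and what lies above it is in another class. -/
theorem isMax_map_iff {x : Λ.carrier} : IsMax (π x) ↔ Inner Λ x := by
  constructor
  · intro hm
    by_contra hx
    have hx' : ¬ IsMax x := fun hxm => by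
      have := h.base.leaf_mem x hxm
      exact hx ⟨this.1, Or.inr this.2⟩
    obtain ⟨y, hxy⟩ := not_isMax_iff.1 hx'
    refine hm.not_lt ((hq.lt_iff (π x) (π y)).2 ⟨fun e => ?_, x, y, rfl, rfl, hxy⟩)
    exact hxy.ne (h.eq_of_sim hx ((hq.eq_iff x y).1 e))
  · intro hx
    refine isMax_iff_forall_not_lt.2 fun q hlt => ?_
    obtain ⟨hne, u, v, hu, rfl, huv⟩ := (hq.lt_iff _ _).1 hlt
    have hxu := (hq.eq_iff x u).1 hu.symm
    refine hne ((hq.eq_iff _ _).2 (h.sim_trans hxu ?_))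
    exact h.sim_of_le hS₀ (hx.of_sim h hxu) huv.le

/-- The point is that a strict inequality in the quotient holds for all representatives. The lower
class is a single x; if x lies below one member v of the upper class, then x ≤ e(v) or x = v's only
alternative, a point of E below v, which again gives x ≤ e(v). This value is below every member of
the class of v. -/
theorem isLeafFibration : IsLeafFibration π where
  surj := hq.surj
  mono x y hxy := by
    by_cases e : π x = π y
    · exact e.le
    · exact ((hq.lt_iff _ _).2 ⟨e, x, y, rfl, rfl,
        lt_of_le_of_ne hxy fun e' => e (congrArg π e')⟩).le
  lt x y hxy := by
    have hx : ¬ Inner Λ x := fun hx => ((h.isMax_map_iff hS₀ hq).2 hx).not_lt hxy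
    obtain ⟨-, u, v, hu, hv, huv⟩ := (hq.lt_iff _ _).1 hxy
    obtain rfl := h.eq_of_sim hx ((hq.eq_iff _ _).1 hu.symm)
    by_cases hy : Inner Λ y
    · have hyv := (hq.eq_iff _ _).1 hv.symm
      refine lt_of_le_of_ne ?_ fun e => hxy.ne (congrArg π e)
      rcases hyv with rfl | ⟨hyd, hvd, he, -⟩
      · exact huv.le
      rcases h.base.good.linear_below v x (lastE Λ v) huv.le (h.base.le_self v hvd) with h1 | h1
      · exact h1.trans (he ▸ h.base.le_self y hyd)
      · have hxd := h.mem_dom_of_le (h.mem_dom_of_mem_im (h.e_mem hvd)) h1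
        have hxi : x ∈ lastIm Λ := by
          by_contra hxi; exact hx ⟨hxd, Or.inr hxi⟩
        exact (h.le_e hxi huv.le).trans (he ▸ h.base.le_self y hyd)
    · rwa [h.eq_of_sim hy ((hq.eq_iff _ _).1 hv.symm)]
  eq x y hxy hx := h.eq_of_sim (mt (h.isMax_map_iff hS₀ hq).2 hx) ((hq.eq_iff x y).1 hxy)

theorem isLeveled_fiber (α : Q.carrier) (hα : IsMax α) :
    IsLeveled 1 (fun _ => c (k + 1)) (leafLev : {x // π x = α} → ℕ) := by
  obtain ⟨x, rfl⟩ := hq.surj α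
  have e : (fun y => π y = π x) = Sim Λ x :=
    funext fun y => propext (eq_comm.trans (hq.eq_iff x y))
  have h1 := h.isLeveled_class hS₀ ((h.isMax_map_iff hS₀ hq).1 hα)
  -- The fiber and the class are equal only as predicates; generalizing the predicate moves the
  -- statement between the two subtypes.
  have transfer : ∀ p q : Λ.carrier → Prop, p = q →
      IsLeveled 1 (fun _ => c (k + 1)) (leafLev : {y // p y} → ℕ) →
      IsLeveled 1 (fun _ => c (k + 1)) (leafLev : {y // q y} → ℕ) := by
    rintro p q rfl hp; exact hp
  exact transfer _ _ e.symm h1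

theorem mem_E_last (hc : IsValidSeq (k + 2) c) {lev : Q.carrier → ℕ}
    (hQ : IsLeveled (k + 1) c lev)
    (him : ¬ Rooted Λ → π '' lastIm Λ = {y | ∃ a, IsMax a ∧ y ⋖ a}) {x : Λ.carrier} :
    x ∈ lastIm Λ ↔ fibLev (k + 1) lev π x = eLevel c k := by
  have hf := h.isLeafFibration hS₀ hq
  by_cases hR : Rooted Λ
  · have hc0 := h.snd_eq_zero_of_rooted hS₀ hR
    rw [eLevel, if_pos hc0, IsLeafFibration.fibLev_eq_iff hQ, h.isMax_map_iff hS₀ hq]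
    constructor
    · exact fun hx => ⟨⟨h.mem_dom_of_mem_im hx, Or.inl hR⟩, h.not_isMax_of_mem_im hx⟩
    · rintro ⟨hx, hx'⟩
      obtain ⟨y, hxy⟩ := not_isMax_iff.1 hx'
      have hex := h.e_mem hx.1
      have hin : Inner Λ (lastE Λ x) := ⟨h.mem_dom_of_mem_im hex, Or.inl hR⟩
      have hle := h.base.le_self x hx.1
      rcases hle.eq_or_lt with h1 | h1
      · rwa [h1] at hex
      · exact absurd hxy (h.not_lt_of_sim hS₀ hc0 hin (h.sim_of_le hS₀ hin hle)
          (h.sim_of_le hS₀ hin (hle.trans hxy.le)) h1)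
  · have hc0 : (c (k + 1)).2 ≠ 0 := mt (h.rooted_iff hS₀).2 hR
    rw [eLevel, if_neg hc0, mem_E_last_of_not_rooted hc hf hQ hc0 (him hR),
      IsLeafFibration.fibLev_lt_iff hQ (by omega)]

end Quotient

/-- The models of the axioms of an extension are flat if the models of its components are. -/
theorem exists_isFlatTree (hc : IsValidSeq (k + 2) c)
    (hS : ∀ Q : ETree k, Q.carrier ⊨ S → ∃ lev, IsFlatTree c Q lev) :
    ∃ lev, IsFlatTree c Λ lev := by
  obtain ⟨Q, π, hq, hQS, hquot⟩ := h.quot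
  obtain ⟨lev, hQ⟩ := hS Q hQS
  have hf := h.isLeafFibration hS₀ hq
  have hl := hf.isLeveled hQ.leveled rfl (h.isLeveled_fiber hS₀ hq)
  have hE : ∀ x, x ∈ lastIm Λ ↔ fibLev (k + 1) lev π x = eLevel c k := fun x =>
    h.mem_E_last hS₀ hq hc hQ.leveled fun hR => (hquot hR).2
  have hne : ∀ j : Fin (k + 1), (c (eLevel c j)).1 ≠ 0 := hc.eLevel_ne_zero
  have hdom : ∀ x, x ∈ lastDom Λ ↔ eLevel c k ≤ fibLev (k + 1) lev π x := by
    intro x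
    rw [h.mem_dom_iff]
    constructor
    · rintro ⟨y, hy, hyx⟩
      rw [← (hE y).1 hy]
      exact hl.mono _ _ hyx
    · intro hx
      have := hl.low_isGreatest hx (hne (Fin.last k))
      exact ⟨_, (hE _).2 this.1.2, this.1.1⟩
  have hlt : ∀ j : Fin k, eLevel c j < k + 1 := eLevel_lt c
  have hdom' : ∀ (j : Fin k) x, x ∈ Λ.Ege j.castSucc ↔ eLevel c j ≤ fibLev (k + 1) lev π x := by
    intro j x
    rw [← hq.dom_iff, hQ.mem_Ege, IsLeafFibration.le_fibLev_iff hQ.leveled (hlt j)]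
  refine ⟨fibLev (k + 1) lev π, hl, fun j => ?_, fun j => ?_, fun j => ?_⟩
  · induction j using Fin.lastCases with
    | last => exact hE
    | cast j =>
      intro x
      rw [← hq.im_iff, hQ.mem_E, Fin.val_castSucc, IsLeafFibration.fibLev_lt_iff hQ.leveled (hlt j)]
  · induction j using Fin.lastCases with
    | last => exact hdom
    | cast j => exact hdom' j
  · induction j using Fin.lastCases with
    | last =>
      intro x
      by_cases hx : x ∈ lastDom Λ
      · have h1 := h.base.greatest x hx
        refine (low_eq ⟨⟨h1.1.2, (hE _).1 h1.1.1⟩, fun z hz => ?_⟩).symm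
        exact h1.2 ⟨(hE z).2 hz.2, hz.1⟩
      · refine (h.base.eq_self x hx).trans (hl.low_eq_self ?_).symm
        exact (not_le.1 (mt (hdom x).2 hx)).le
    | cast j =>
      intro x
      by_cases hx : x ∈ Λ.Ege j.castSucc
      · have h1 := hQ.leveled.low_isGreatest ((hQ.mem_Ege j (π x)).1 ((hq.dom_iff j x).2 hx))
          (hne j.castSucc)
        rw [← hQ.e_eq, ← hq.map_e j x hx] at h1
        exact hf.eq_low_fibLev hQ.leveled (hlt j) h1
      · refine (h.old_eq_self j x hx).trans (hl.low_eq_self ?_).symm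
        exact (not_le.1 (mt (hdom' j x).2 hx)).le

end

end IsExtModel

/-- The models of an iterated theory are flat. -/
theorem rawFlat_of_model_iterTheory {c : ℕ → ℕ∞ × ℕ∞} (k : ℕ) (hc : IsValidSeq (k + 1) c) (M : Type)
    [(treeLang k).Structure M] (hM : M ⊨ iterTheory k (fun i => c i)) : RawFlat k c M := by
  have key : ∀ (c : ℕ → ℕ∞ × ℕ∞), IsValidSeq 1 c → ∀ (M : Type) [(treeLang 0).Structure M],
      M ⊨ oneTheory (c 0) → RawFlat 0 c M := by
    intro c hc M _ hM
    -- An arbitrary model need not be one-colored. It is enough that one-colored trees are flat,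
    -- since the axioms of flatness then belong to the theory.
    have hT : ∀ φ : (treeLang 0).Sentence,
        (∀ (M : Type) [(treeLang 0).Structure M], RawFlat 0 c M → M ⊨ φ) → φ ∈ oneTheory (c 0) :=
      fun φ hφ T hT => hφ _ ((IsOneColored.isLeveled hT).isFlatTree.rawFlat hc)
    exact (axiomatizable_rawFlat 0 c).of_model hT M hM
  induction k generalizing M with
  | zero => exact key c hc M hM
  | succ k ih =>
    have hc' : IsValidSeq (k + 1) c :=
      ⟨fun i hi => hc.ne_zero i (by omega), fun i hi => hc.succ i (by omega)⟩
    have hc1 : IsValidSeq 1 (fun _ => c (k + 1)) :=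
      ⟨fun i hi => hc.ne_zero (k + 1) (by omega), fun i hi => by omega⟩
    have hT : ∀ φ : (treeLang (k + 1)).Sentence,
        (∀ (M : Type) [(treeLang (k + 1)).Structure M], RawFlat (k + 1) c M → M ⊨ φ) →
        φ ∈ iterTheory (k + 1) (fun i => c i) := by
      intro φ hφ Λ hΛ
      obtain ⟨lev, hl⟩ := hΛ.exists_isFlatTree (fun X _ hX =>
        (((key _ hc1 _ hX).exists_isFlatTree hc1).choose_spec).of_pureTree) hc fun Q hQ =>
          (ih hc' Q.carrier hQ).exists_isFlatTree hc'
      exact hφ _ (hl.rawFlat hc)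
    exact (axiomatizable_rawFlat (k + 1) c).of_model hT M hM

/-! ### Pure trees up to order isomorphism -/

theorem map_meet {X Y : Type} [PartialOrder X] [PartialOrder Y] (f : X ≃o Y) (x y : X) :
    f (meet x y) = meet (f x) (f y) := by
  have key : ∀ z, IsGLB {f x, f y} (f z) ↔ IsGLB {x, y} z := fun z => by
    rw [← f.isGLB_image', Set.image_pair]
  unfold meet
  by_cases h : ∃ z, IsGLB {x, y} z
  · have h' : ∃ z, IsGLB {f x, f y} z := ⟨_, (key _).2 h.choose_spec⟩
    rw [dif_pos h, dif_pos h']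
    exact ((key _).2 h.choose_spec).unique h'.choose_spec
  · rw [dif_neg h, dif_neg]
    rintro ⟨z, hz⟩
    exact h ⟨f.symm z, (key _).1 (by rwa [f.apply_symm_apply])⟩

/-- An order isomorphism is an isomorphism of trees without additional symbols. -/
noncomputable def pureEquiv {S T : ETree 0} (f : S.carrier ≃o T.carrier) :
    S.carrier ≃[treeLang 0] T.carrier where
  toEquiv := f.toEquiv
  map_fun' g v := by
    rcases g with _ | i
    · exact map_meet f (v 0) (v 1)
    · exact i.elim0
  map_rel' r v := by
    rcases r with _ | _ | _ | i | i
    · exact f.le_iff_le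
    · exact f.isMax_apply
    · exact not_congr f.isMax_apply
    · exact i.elim0
    · exact i.elim0

theorem IsOneColored.model {T : ETree 0} {c : ℕ∞ × ℕ∞} (h : IsOneColored c.1 c.2 T.carrier) :
    T.carrier ⊨ oneTheory c :=
  (Theory.model_iff _).2 fun _ hφ => hφ T h

theorem realize_iff_of_orderIso {S T : ETree 0} (f : S.carrier ≃o T.carrier)
    (φ : (treeLang 0).Sentence) : S.carrier ⊨ φ ↔ T.carrier ⊨ φ :=
  StrongHomClass.realize_sentence (pureEquiv f) φ

theorem model_of_orderIso {S T : ETree 0} (f : S.carrier ≃o T.carrier) {U : (treeLang 0).Theory}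
    (h : S.carrier ⊨ U) : T.carrier ⊨ U :=
  (Theory.model_iff _).2 fun φ hφ => (realize_iff_of_orderIso f φ).1 (h.realize_of_mem φ hφ)

/-- The leveled form is first order, so it holds in every model of `oneTheory`, even in one not
known to be one-colored. -/
theorem isLeveled_of_model_oneTheory {X : Type} [PartialOrder X] {c : ℕ → ℕ∞ × ℕ∞}
    (hc : IsValidSeq 1 c) (h : (pureTree X).carrier ⊨ oneTheory (c 0)) :
    IsLeveled 1 c (leafLev : X → ℕ) := by
  have h1 : RawFlat 0 c (pureTree X).carrier := rawFlat_of_model_iterTheory 0 hc _ h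
  obtain ⟨lev, hl⟩ := h1.exists_isFlatTree hc
  exact hl.of_pureTree

/-! ### The extension of a flat tree is a model of the extension axioms -/

section Ext

variable {k : ℕ} {T : ETree k} {T₀ : ETree 0}

/-- A node of `T`, in the extension. -/
def extNode (T₀ : ETree 0) (x : {x : T.carrier // ¬ IsMax x}) : (ext T T₀).carrier := Sum.inl x

/-- An element of the tree that replaces the leaf `α`. -/
def extLeaf (α : {x : T.carrier // IsMax x}) (t : T₀.carrier) : (ext T T₀).carrier := Sum.inr (α, t)

theorem ext_cases (x : (ext T T₀).carrier) :
    (∃ y, x = extNode T₀ y) ∨ ∃ α t, x = extLeaf α t := by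
  rcases x with x | x
  · exact Or.inl ⟨x, rfl⟩
  · exact Or.inr ⟨x.1, x.2, rfl⟩

/-- The projection of an extension. -/
def extProj (T : ETree k) (T₀ : ETree 0) : (ext T T₀).carrier → T.carrier
  | .inl x => x.1
  | .inr a => a.1.1

theorem extNode_le_extNode {x y : {x : T.carrier // ¬ IsMax x}} :
    extNode T₀ x ≤ extNode T₀ y ↔ x.1 ≤ y.1 := Iff.rfl

theorem extNode_le_extLeaf {x : {x : T.carrier // ¬ IsMax x}} {α : {x : T.carrier // IsMax x}}
    {t : T₀.carrier} : extNode T₀ x ≤ extLeaf α t ↔ x.1 ≤ α.1 := Iff.rfl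

theorem extLeaf_le_extLeaf {α β : {x : T.carrier // IsMax x}} {s t : T₀.carrier} :
    extLeaf α s ≤ extLeaf β t ↔ α = β ∧ s ≤ t := Iff.rfl

theorem not_extLeaf_le_extNode {x : {x : T.carrier // ¬ IsMax x}} {α : {x : T.carrier // IsMax x}}
    {t : T₀.carrier} : ¬ extLeaf α t ≤ extNode T₀ x := id

theorem isLeafFibration_extProj [Nonempty T₀.carrier] : IsLeafFibration (extProj T T₀) where
  surj x := by
    by_cases hx : IsMax x
    · exact ⟨extLeaf ⟨x, hx⟩ (Classical.arbitrary _), rfl⟩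
    · exact ⟨extNode T₀ ⟨x, hx⟩, rfl⟩
  mono x y h := by
    rcases ext_cases x with ⟨x, rfl⟩ | ⟨α, s, rfl⟩ <;> rcases ext_cases y with ⟨y, rfl⟩ | ⟨β, t, rfl⟩
    · exact h
    · exact h
    · exact (not_extLeaf_le_extNode h).elim
    · exact (congrArg Subtype.val h.1).le
  lt x y h := by
    refine lt_of_le_of_ne ?_ fun e => h.ne (congrArg _ e)
    rcases ext_cases x with ⟨x, rfl⟩ | ⟨α, s, rfl⟩
    · rcases ext_cases y with ⟨y, rfl⟩ | ⟨β, t, rfl⟩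
      · exact h.le
      · exact h.le
    · exact (α.2.not_lt h).elim
  eq x y h hx := by
    rcases ext_cases x with ⟨x, rfl⟩ | ⟨α, s, rfl⟩
    · rcases ext_cases y with ⟨y, rfl⟩ | ⟨β, t, rfl⟩
      · exact congrArg Sum.inl (Subtype.ext h)
      · exact (hx (by rw [h]; exact β.2)).elim
    · exact (hx α.2).elim

theorem isMax_extLeaf {α : {x : T.carrier // IsMax x}} {t : T₀.carrier} :
    IsMax (extLeaf α t) ↔ IsMax t := by
  constructor
  · intro h s hs
    exact (extLeaf_le_extLeaf.1 (h (extLeaf_le_extLeaf.2 ⟨rfl, hs⟩))).2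
  · intro h y hy
    rcases ext_cases y with ⟨y, rfl⟩ | ⟨β, s, rfl⟩
    · exact (not_extLeaf_le_extNode hy).elim
    · exact ⟨hy.1.symm, h hy.2⟩

/-- The fibers of the projection over the leaves. -/
def extFiberIso (α : T.carrier) (hα : IsMax α) : T₀.carrier ≃o {x // extProj T T₀ x = α} where
  toFun t := ⟨extLeaf ⟨α, hα⟩ t, rfl⟩
  invFun
    | ⟨.inl x, hx⟩ => (x.2 (show IsMax x.1 by rw [show x.1 = α from hx]; exact hα)).elim
    | ⟨.inr a, _⟩ => a.2
  left_inv t := rfl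
  right_inv := by
    rintro ⟨x | x, hx⟩
    · exact (x.2 (show IsMax x.1 by rw [show x.1 = α from hx]; exact hα)).elim
    · exact Subtype.ext (congrArg Sum.inr (Prod.ext (Subtype.ext hx.symm) rfl))
  map_rel_iff' := by
    intro s t
    exact ⟨fun h => h.2, fun h => ⟨rfl, h⟩⟩

theorem isGoodTree_ext {c : ℕ → ℕ∞ × ℕ∞} {n : ℕ} {lev : (ext T T₀).carrier → ℕ}
    (hT : IsGoodTree T.carrier) (hT₀ : IsGoodTree T₀.carrier) (h : IsLeveled n c lev) :
    IsGoodTree (ext T T₀).carrier := by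
  refine ⟨h.nonempty, h.linear_below, h.has_meets, h.le_leaf, fun x hx => ?_⟩
  rcases ext_cases x with ⟨x, rfl⟩ | ⟨α, t, rfl⟩
  · obtain ⟨a, b, ha, hb, hab, hg⟩ := hT.node_eq_meet x.1 x.2
    obtain ⟨t⟩ := hT₀.nonempty
    obtain ⟨t, -, ht⟩ := hT₀.leaves_everywhere t
    refine ⟨extLeaf ⟨a, ha⟩ t, extLeaf ⟨b, hb⟩ t, isMax_extLeaf.2 ht, isMax_extLeaf.2 ht,
      fun e => hab (congrArg (extProj T T₀) e), ?_, ?_⟩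
    · rintro z (rfl | rfl)
      · exact extNode_le_extLeaf.2 (hg.1 (by simp))
      · exact extNode_le_extLeaf.2 (hg.1 (by simp))
    · intro z hz
      have h1 : z ≤ extLeaf ⟨a, ha⟩ t := hz (Or.inl rfl)
      have h2 : z ≤ extLeaf ⟨b, hb⟩ t := hz (Or.inr rfl)
      rcases ext_cases z with ⟨z, rfl⟩ | ⟨β, s, rfl⟩
      · refine extNode_le_extNode.2 (hg.2 ?_)
        rintro u (rfl | rfl)
        exacts [h1, h2]
      · exact (hab (congrArg Subtype.val (h1.1.symm.trans h2.1))).elim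
  · obtain ⟨a, b, ha, hb, hab, hg⟩ := hT₀.node_eq_meet t (mt isMax_extLeaf.2 hx)
    refine ⟨extLeaf α a, extLeaf α b, isMax_extLeaf.2 ha, isMax_extLeaf.2 hb, ?_, ?_, ?_⟩
    · intro e
      exact hab (Prod.ext_iff.1 (Sum.inr_injective e)).2
    · rintro z (rfl | rfl)
      · exact ⟨rfl, hg.1 (by simp)⟩
      · exact ⟨rfl, hg.1 (by simp)⟩
    · intro z hz
      have h1 : z ≤ extLeaf α a := hz (Or.inl rfl)
      have h2 : z ≤ extLeaf α b := hz (Or.inr rfl)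
      rcases ext_cases z with ⟨z, rfl⟩ | ⟨β, s, rfl⟩
      · exact h1
      · refine ⟨h1.1, hg.2 ?_⟩
        rintro u (rfl | rfl)
        exacts [h1.2, h2.2]

/-! ### Levels and symbols of an extension -/

section Flat

variable {c : ℕ → ℕ∞ × ℕ∞} {lev : T.carrier → ℕ}

theorem isLeveled_ext (hc : IsValidSeq (k + 2) c) (hT : IsLeveled (k + 1) c lev)
    (hT₀ : IsOneColored (c (k + 1)).1 (c (k + 1)).2 T₀.carrier) :
    IsLeveled (k + 2) c (fibLev (k + 1) lev (extProj T T₀)) := by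
  have : Nonempty T₀.carrier := hT₀.1.nonempty
  refine isLeafFibration_extProj.isLeveled (c' := fun _ => c (k + 1)) hT rfl fun α hα => ?_
  have hc1 : IsValidSeq 1 (fun _ => c (k + 1)) :=
    ⟨fun i hi => hc.ne_zero (k + 1) (by omega), fun i hi => by omega⟩
  refine isLeveled_of_model_oneTheory hc1 ?_
  -- The fiber is a copy of `T₀`. Passing through its first-order theory, which isomorphisms
  -- preserve, avoids transporting the level conditions by hand.
  exact model_of_orderIso (S := T₀) (T := pureTree _) (extFiberIso α hα) hT₀.model

/-- With μ ≠ 0 no element is first. With μ = 0 the nodes are an antichain, so the meet of a node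
with any element is that node. -/
theorem exists_isBot_iff (h : IsLeveled 1 (fun _ => c k) (leafLev : T₀.carrier → ℕ)) :
    (∃ r : T₀.carrier, IsBot r) ↔ (c k).2 = 0 := by
  constructor
  · rintro ⟨r, hr⟩
    by_contra hc0
    have hr1 : leafLev r < 1 := by
      by_contra hr1
      obtain ⟨y, -, hy⟩ := h.below r 0 (by omega)
      have := h.mono _ _ (hr y)
      omega
    obtain ⟨y, hy, -⟩ := h.no_first r hr1 hc0
    exact hy.not_ge (hr y)
  · intro hc0
    obtain ⟨r, hr⟩ := h.exists_level (l := 0) (by omega)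
    refine ⟨r, fun x => ?_⟩
    have h1 := h.meet_le_left r x
    rcases h1.eq_or_lt with h2 | h2
    · rw [← h2]; exact h.meet_le_right r x
    · have := h.mono _ _ h1
      exact (h.not_lt_of_level_eq hc0 h2 (by omega)).elim

theorem isBot_iff (h : IsLeveled 1 (fun _ => c k) (leafLev : T₀.carrier → ℕ)) (hc0 : (c k).2 = 0)
    {r : T₀.carrier} : IsBot r ↔ ¬ IsMax r := by
  obtain ⟨s, hs⟩ := (exists_isBot_iff h).2 hc0
  have hs1 : leafLev s = 0 := by
    obtain ⟨y, hy⟩ := h.exists_level (l := 0) (by omega)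
    have := h.mono _ _ (hs y)
    omega
  rw [← leafLev_eq_zero]
  constructor
  · intro hr
    rwa [le_antisymm (hr s) (hs r)]
  · intro hr
    rwa [← (hs r).eq_or_lt.resolve_right fun h2 => h.not_lt_of_level_eq hc0 h2 (by omega)]

/-- The new function of an extension. -/
noncomputable def newE (T : ETree k) (T₀ : ETree 0) : (ext T T₀).carrier → (ext T T₀).carrier :=
  extNewE T T₀

theorem newE_extNode (x : {x : T.carrier // ¬ IsMax x}) : newE T T₀ (extNode T₀ x) = extNode T₀ x :=
  rfl

theorem newE_of_isBot {r : T₀.carrier} (hr : IsBot r) (α : {x : T.carrier // IsMax x})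
    (t : T₀.carrier) : newE T T₀ (extLeaf α t) = extLeaf α r := by
  have h : ∃ r : T₀.carrier, IsBot r := ⟨r, hr⟩
  have e : h.choose = r := le_antisymm (h.choose_spec r) (hr _)
  unfold newE extLeaf extNewE
  simp only
  rw [dif_pos h, e]

theorem newE_of_covBy (hT : IsLeveled (k + 1) c lev) (hb : ¬ ∃ r : T₀.carrier, IsBot r)
    {α : {x : T.carrier // IsMax x}} (t : T₀.carrier) {y : T.carrier} (hy : y ⋖ α.1) :
    newE T T₀ (extLeaf α t) = extNode T₀ ⟨y, not_isMax_of_lt hy.lt⟩ := by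
  have h : ∃ y : T.carrier, y ⋖ α.1 := ⟨y, hy⟩
  have e : h.choose = y := by
    have h1 := h.choose_spec
    rcases hT.linear_below _ _ _ h1.le hy.le with h2 | h2
    · exact h2.eq_or_lt.resolve_right fun h3 => h1.2 h3 hy.lt
    · exact (h2.eq_or_lt.resolve_right fun h3 => hy.2 h3 h1.lt).symm
  unfold newE extLeaf extNewE extNode
  simp only
  rw [dif_neg hb, dif_pos h]
  exact congrArg Sum.inl (Subtype.ext e)

/-- The image of the new function is exactly the level `eLevel c k`: the copies of the root if there
is one, and otherwise level k of T, whose elements are the predecessors of the leaves. The old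
functions commute with the projection. -/
theorem isFlatTree_ext (hc : IsValidSeq (k + 2) c) (hT : IsFlatTree c T lev)
    (hT₀ : IsOneColored (c (k + 1)).1 (c (k + 1)).2 T₀.carrier) :
    IsFlatTree c (ext T T₀) (fibLev (k + 1) lev (extProj T T₀)) := by
  have : Nonempty T₀.carrier := hT₀.1.nonempty
  have hf : IsLeafFibration (extProj T T₀) := isLeafFibration_extProj
  have hl := isLeveled_ext hc hT.leveled hT₀
  have h0 : IsLeveled 1 (fun _ => c (k + 1)) (leafLev : T₀.carrier → ℕ) :=
    IsOneColored.isLeveled (c := fun _ => c (k + 1)) hT₀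
  have hlt : ∀ j : Fin k, eLevel c j < k + 1 := eLevel_lt c
  have hne : ∀ j : Fin (k + 1), (c (eLevel c j)).1 ≠ 0 := hc.eLevel_ne_zero
  have hn : ∀ x : {x : T.carrier // ¬ IsMax x}, lev x.1 < k + 1 := fun x =>
    lt_of_le_of_ne (hT.leveled.lev_le _) (mt (hT.leveled.max_iff _).2 x.2)
  -- By validity, μ ≠ 0 at k + 1 forces m ≠ 0 at k, so the leaves of T do have predecessors.
  have hpred : ∀ a : T.carrier, IsMax a → (c (k + 1)).2 ≠ 0 → ∃ y, y ⋖ a ∧ lev y = k := by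
    intro a ha hc0
    have hk : (c k).1 ≠ 0 := fun h0 => hc0 (hc.succ k (by omega) h0)
    obtain ⟨y, hy⟩ := hT.leveled.exists_covBy_left_iff.2
      ⟨k, (hT.leveled.max_iff a).1 ha, by omega, hk, Or.inl rfl⟩
    have h1 := (hT.leveled.covBy_iff.1 hy).2.1
    rw [(hT.leveled.max_iff a).1 ha] at h1
    exact ⟨y, hy, by omega⟩
  have hE : ∀ y : (ext T T₀).carrier, (∃ α t, newE T T₀ (extLeaf α t) = y) ↔
      fibLev (k + 1) lev (extProj T T₀) y = eLevel c k := by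
    intro y
    unfold eLevel
    split_ifs with hc0
    · obtain ⟨r, hr⟩ := (exists_isBot_iff h0).2 hc0
      rw [IsLeafFibration.fibLev_eq_iff hT.leveled]
      constructor
      · rintro ⟨α, t, rfl⟩
        rw [newE_of_isBot hr]
        exact ⟨α.2, mt isMax_extLeaf.1 ((isBot_iff h0 hc0).1 hr)⟩
      · rintro ⟨h1, h2⟩
        rcases ext_cases y with ⟨y, rfl⟩ | ⟨α, t, rfl⟩
        · exact (y.2 h1).elim
        · exact ⟨α, t, newE_of_isBot ((isBot_iff h0 hc0).2 (mt isMax_extLeaf.2 h2)) α t⟩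
    · have hb := mt (exists_isBot_iff h0).1 hc0
      rw [IsLeafFibration.fibLev_lt_iff hT.leveled (by omega)]
      constructor
      · rintro ⟨α, t, rfl⟩
        obtain ⟨y, hy, hyl⟩ := hpred α.1 α.2 hc0
        rw [newE_of_covBy hT.leveled hb t hy]
        exact hyl
      · intro hy
        have hk : (c k).1 ≠ 0 := fun h0 => hc0 (hc.succ k (by omega) h0)
        rcases ext_cases y with ⟨y, rfl⟩ | ⟨α, t, rfl⟩
        · have hy' : lev y.1 = k := hy
          obtain ⟨a, ha⟩ := (hT.leveled.exists_covBy_right_iff (y := y.1)).2 (by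
            rw [hy']; exact ⟨by omega, hk, Or.inl rfl⟩)
          have ha' : IsMax a :=
            (hT.leveled.max_iff a).2 (by rw [(hT.leveled.covBy_iff.1 ha).2.1, hy'])
          exact ⟨⟨a, ha'⟩, Classical.arbitrary _, newE_of_covBy hT.leveled hb _ ha⟩
        · have := (hT.leveled.max_iff _).1 α.2
          have hy' : lev α.1 = k := hy
          omega
  have hE' : ∀ y : (ext T T₀).carrier, y ∈ extNewImage T T₀ ↔ ∃ α t, newE T T₀ (extLeaf α t) = y :=
    fun y => ⟨fun ⟨a, ha⟩ => ⟨a.1, a.2, ha⟩, fun ⟨α, t, h⟩ => ⟨(α, t), h⟩⟩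
  have hold : ∀ (j : Fin k) (x : (ext T T₀).carrier),
      extProj T T₀ ((ext T T₀).e j.castSucc x) = T.e j (extProj T T₀ x) := by
    intro j x
    -- The old functions never take a leaf as value, so the default branches of `extOldE` are not
    -- reached.
    have hnm : ¬ IsMax (T.e j (extProj T T₀ x)) := by
      rw [hT.e_eq]
      intro hm
      have h1 := (hT.leveled.max_iff _).1 hm
      have h2 := hlt j
      rcases le_or_gt (eLevel c j) (lev (extProj T T₀ x)) with h3 | h3
      · rw [hT.leveled.lev_low h3 (hne j.castSucc)] at h1; omega
      · rw [hT.leveled.low_eq_self h3.le] at h1; omega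
    have he : (ext T T₀).e j.castSucc = extOldE T T₀ (T.e j) := by
      simp only [ext, Fin.lastCases_castSucc]
    rw [he]
    rcases x with x | x
    · have : extOldE T T₀ (T.e j) (.inl x) = .inl ⟨T.e j x.1, hnm⟩ := dif_pos hnm
      rw [this]; rfl
    · have : extOldE T T₀ (T.e j) (.inr x) = .inl ⟨T.e j x.1.1, hnm⟩ := dif_pos hnm
      rw [this]; rfl
  refine ⟨hl, fun j => ?_, fun j => ?_, fun j => ?_⟩
  · induction j using Fin.lastCases with
    | last =>
      intro y
      have he : (ext T T₀).E (Fin.last k) = extNewImage T T₀ := by simp only [ext, Fin.lastCases_last]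
      rw [he]
      exact (hE' y).trans (hE y)
    | cast j =>
      intro y
      have he : (ext T T₀).E j.castSucc = {y | ∃ x, x.1 ∈ T.E j ∧ y = .inl x} := by
        simp only [ext, Fin.lastCases_castSucc]
      rw [he, Fin.val_castSucc, IsLeafFibration.fibLev_lt_iff hT.leveled (hlt j), ← hT.mem_E]
      constructor
      · rintro ⟨x, hx, rfl⟩; exact hx
      · intro hy
        rcases ext_cases y with ⟨y, rfl⟩ | ⟨α, t, rfl⟩
        · exact ⟨y, hy, rfl⟩
        · have h1 := (hT.mem_E j _).1 hy
          have h2 := (hT.leveled.max_iff _).1 α.2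
          have h3 := hlt j
          have h4 : lev α.1 = eLevel c j := h1
          omega
  · induction j using Fin.lastCases with
    | last =>
      intro x
      have he : (ext T T₀).Ege (Fin.last k) = {x | ∃ y ∈ extNewImage T T₀, extLE T T₀ y x} := by
        simp only [ext, Fin.lastCases_last]
      rw [he]
      constructor
      · rintro ⟨y, hy, hyx⟩
        have h1 := (hE y).1 ((hE' y).1 hy)
        have h2 := hl.mono y x hyx
        rw [h1] at h2
        exact h2
      · intro hx
        have := hl.low_isGreatest hx (hne (Fin.last k))
        exact ⟨_, (hE' _).2 ((hE _).2 this.1.2), this.1.1⟩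
    | cast j =>
      intro y
      have he : (ext T T₀).Ege j.castSucc =
          {y | (∃ x, x.1 ∈ T.Ege j ∧ y = .inl x) ∨ ∃ a, y = .inr a} := by
        simp only [ext, Fin.lastCases_castSucc]
      rw [he, Fin.val_castSucc, IsLeafFibration.le_fibLev_iff hT.leveled (hlt j), ← hT.mem_Ege]
      constructor
      · rintro (⟨x, hx, rfl⟩ | ⟨a, rfl⟩)
        · exact hx
        · rw [hT.mem_Ege]
          have h2 := (hT.leveled.max_iff _).1 a.1.2
          have h3 := hlt j
          show eLevel c j ≤ lev a.1.1
          omega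
      · intro hy
        rcases y with y | y
        · exact Or.inl ⟨y, hy, rfl⟩
        · exact Or.inr ⟨y, rfl⟩
  · induction j using Fin.lastCases with
    | last =>
      intro x
      have he : (ext T T₀).e (Fin.last k) = newE T T₀ := by
        simp only [ext, Fin.lastCases_last]; rfl
      rw [he, Fin.val_last]
      rcases ext_cases x with ⟨x, rfl⟩ | ⟨α, t, rfl⟩
      · rw [newE_extNode, hl.low_eq_self]
        have h1 : fibLev (k + 1) lev (extProj T T₀) (extNode T₀ x) = lev x.1 :=
          IsLeafFibration.fibLev_node x.2
        rw [h1]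
        have := hn x
        unfold eLevel; split_ifs <;> omega
      · have h1 := (hE _).1 ⟨α, t, rfl⟩
        by_cases hc0 : (c (k + 1)).2 = 0
        · obtain ⟨r, hr⟩ := (exists_isBot_iff h0).2 hc0
          have h2 : newE T T₀ (extLeaf α t) ≤ extLeaf α t := by
            rw [newE_of_isBot hr]; exact ⟨rfl, hr _⟩
          have hk : eLevel c k = k + 1 := if_pos hc0
          rw [hk] at h1 ⊢
          refine (low_eq ⟨⟨h2, h1⟩, fun z hz => ?_⟩).symm
          rcases hl.linear_below _ _ _ hz.1 h2 with h3 | h3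
          · exact h3
          · rcases h3.eq_or_lt with h4 | h4
            · exact h4.ge
            · refine (hl.not_lt_of_level_eq ?_ h4 (hz.2.trans h1.symm)).elim
              rw [h1]; exact hc0
        · obtain ⟨y, hy, hyl⟩ := hpred α.1 α.2 hc0
          have hk : eLevel c k = k := if_neg hc0
          rw [hk]
          refine hf.eq_low_fibLev hT.leveled (by omega) ?_
          rw [newE_of_covBy hT.leveled (mt (exists_isBot_iff h0).1 hc0) t hy]
          have h5 := (hT.leveled.covBy_iff.1 hy)
          rw [hyl] at h5
          refine ⟨⟨hy.le, hyl⟩, fun z hz => ?_⟩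
          have h6 := hT.leveled.low_isGreatest (i := k) (x := α.1) (by rw [h5.2.1]; omega) h5.1.2.1
          show z ≤ y
          rw [h5.2.2]
          exact h6.2 hz
    | cast j =>
      intro x
      have h1 := hold j x
      rw [hT.e_eq] at h1
      rw [Fin.val_castSucc]
      rcases le_or_gt (eLevel c j) (lev (extProj T T₀ x)) with h3 | h3
      · have h4 := hT.leveled.low_isGreatest h3 (hne j.castSucc)
        rw [← h1] at h4
        exact hf.eq_low_fibLev hT.leveled (hlt j) h4
      · rw [hT.leveled.low_eq_self h3.le] at h1
        have hx : ¬ IsMax (extProj T T₀ x) := fun hm => by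
          have := (hT.leveled.max_iff _).1 hm
          have := hlt j
          omega
        rw [hl.low_eq_self]
        · exact (hf.eq _ _ h1.symm hx).symm
        · rw [IsLeafFibration.fibLev_node hx]; exact h3.le

end Flat

end Ext

/-! ### The extension axioms on symbols, from flatness -/

namespace IsFlatTree

variable {k : ℕ} {c : ℕ → ℕ∞ × ℕ∞} {Λ : ETree (k + 1)} {lev : Λ.carrier → ℕ}

theorem mem_lastIm (h : IsFlatTree c Λ lev) {x : Λ.carrier} : x ∈ lastIm Λ ↔ lev x = eLevel c k :=
  h.mem_E (Fin.last k) x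

theorem mem_lastDom (h : IsFlatTree c Λ lev) {x : Λ.carrier} : x ∈ lastDom Λ ↔ eLevel c k ≤ lev x :=
  h.mem_Ege (Fin.last k) x

theorem lastE_eq (h : IsFlatTree c Λ lev) (x : Λ.carrier) : lastE Λ x = low lev (eLevel c k) x :=
  h.e_eq (Fin.last k) x

theorem baseAxioms (hc : IsValidSeq (k + 2) c) (h : IsFlatTree c Λ lev)
    (hg : IsGoodTree Λ.carrier) : BaseAxioms Λ := by
  have hne : (c (eLevel c k)).1 ≠ 0 := hc.eLevel_ne_zero (Fin.last k)
  have hgr : ∀ {x : Λ.carrier}, x ∈ lastDom Λ → IsGreatest (lastIm Λ ∩ Set.Iic x) (lastE Λ x) := by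
    intro x hx
    have h1 := h.leveled.low_isGreatest (h.mem_lastDom.1 hx) hne
    rw [h.lastE_eq]
    exact ⟨⟨h.mem_lastIm.2 h1.1.2, h1.1.1⟩, fun z hz => h1.2 ⟨hz.2, h.mem_lastIm.1 hz.1⟩⟩
  have hself : ∀ {x : Λ.carrier}, x ∈ lastIm Λ → x ∈ lastDom Λ := fun hx =>
    h.mem_lastDom.2 (h.mem_lastIm.1 hx).ge
  refine ⟨hg, fun x y z hx hz hxy hyz => ?_, ?_, ?_, fun x hx => ?_, fun a ha => ?_,
    fun x _ => ?_, fun x hx => hgr hx⟩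
  · have h1 := h.leveled.mono _ _ hxy.le
    have h2 := h.leveled.mono _ _ hyz.le
    rw [h.mem_lastIm] at hx hz ⊢
    omega
  · ext x
    constructor
    · exact fun hx => ⟨_, (hgr hx).1.1, (hgr hx).1.2⟩
    · rintro ⟨y, hy, hyx⟩
      rw [h.mem_lastDom, ← h.mem_lastIm.1 hy]
      exact h.leveled.mono _ _ hyx
  · ext x
    constructor
    · intro hx
      exact ⟨x, hself hx, le_antisymm (hgr (hself hx)).1.2 ((hgr (hself hx)).2 ⟨hx, le_rfl⟩)⟩
    · rintro ⟨y, hy, rfl⟩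
      exact (hgr hy).1.1
  · rw [h.lastE_eq]
    exact h.leveled.low_eq_self (not_le.1 (mt h.mem_lastDom.2 hx)).le
  · rw [h.mem_lastDom, h.mem_lastIm, (h.leveled.max_iff a).1 ha]
    have : eLevel c k < k + 1 + 1 := eLevel_lt c (Fin.last k)
    omega
  · rw [h.lastE_eq]
    exact low_le _ _ _

/-- If μ ≠ 0, a predecessor of a leaf has a smaller element on its own level, which is a predecessor
of a leaf too. If μ = 0, the top level of nodes is an antichain and m ≠ 0. -/
theorem rooted_iff (hc : IsValidSeq (k + 2) c) (h : IsFlatTree c Λ lev) :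
    Rooted Λ ↔ (c (k + 1)).2 = 0 := by
  have hpred : ∀ {a x : Λ.carrier}, IsMax a → x ⋖ a → lev x = k + 1 := by
    intro a x ha hx
    have h1 := (h.leveled.covBy_iff.1 hx).2.1
    rw [(h.leveled.max_iff a).1 ha] at h1
    omega
  constructor
  · rintro ⟨h1, h2⟩
    by_contra hc0
    obtain ⟨a, ha⟩ := h.leveled.exists_level (l := k + 2) le_rfl
    have ha' := (h.leveled.max_iff a).2 ha
    obtain ⟨x, hx⟩ := h1 a ha'
    have hxl := hpred ha' hx
    obtain ⟨y, hyx, hyl⟩ := h.leveled.no_first x (by omega) (by rwa [hxl])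
    obtain ⟨b, hb⟩ := h.leveled.exists_covBy_right_iff.2
      (by rw [hyl]; exact (h.leveled.covBy_iff.1 hx).1)
    have hb' : IsMax b := (h.leveled.max_iff b).2 (by
      rw [(h.leveled.covBy_iff.1 hb).2.1, hyl, hxl])
    exact h2 b a y x hb' ha' hb hx hyx
  · intro hc0
    refine ⟨fun a ha => h.leveled.exists_covBy_left_iff.2 ⟨k + 1, (h.leveled.max_iff a).1 ha,
      by omega, hc.ne_zero _ (by omega) hc0, Or.inl rfl⟩, fun a b x y ha hb hx hy hxy => ?_⟩
    have h1 := hpred ha hx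
    exact h.leveled.not_lt_of_level_eq (by rwa [h1]) hxy ((hpred hb hy).trans h1.symm)

theorem eLevel_le (c : ℕ → ℕ∞ × ℕ∞) (j : Fin k) : eLevel c j ≤ eLevel c k := by
  have := j.2
  unfold eLevel
  split_ifs <;> omega

theorem old_le (hc : IsValidSeq (k + 2) c) (h : IsFlatTree c Λ lev) (j : Fin k) {x : Λ.carrier}
    (hx : x ∈ Λ.Ege j.castSucc) : Λ.e j.castSucc x ∈ lastLe Λ := by
  have h1 := h.leveled.lev_low ((h.mem_Ege _ _).1 hx) (hc.eLevel_ne_zero j.castSucc)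
  rw [← h.e_eq, Fin.val_castSucc] at h1
  have h2 := eLevel_le c j
  rw [← h1] at h2
  rcases h2.lt_or_eq with h3 | h3
  · exact Or.inl fun h4 => h3.not_ge (h.mem_lastDom.1 h4)
  · exact Or.inr (h.mem_lastIm.2 h3)

/-- The value of the new e has level at least that of the old image, so x and e(x) have the same
last element on the old level. -/
theorem old_ge (hc : IsValidSeq (k + 2) c) (h : IsFlatTree c Λ lev) (j : Fin k) {x : Λ.carrier}
    (hx : x ∈ lastDom Λ) :
    (x ∈ Λ.Ege j.castSucc ↔ lastE Λ x ∈ Λ.Ege j.castSucc) ∧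
    (x ∈ Λ.Ege j.castSucc → Λ.e j.castSucc x = Λ.e j.castSucc (lastE Λ x)) := by
  have hne := hc.eLevel_ne_zero j.castSucc
  have hle := eLevel_le c j
  have hx' := h.mem_lastDom.1 hx
  have h1 := h.leveled.lev_low hx' (hc.eLevel_ne_zero (Fin.last k))
  rw [h.mem_Ege, h.mem_Ege, h.e_eq, h.e_eq, h.lastE_eq, Fin.val_castSucc]
  refine ⟨iff_of_true (hle.trans hx') (hle.trans h1.ge), fun _ => ?_⟩
  rcases hle.eq_or_lt with h2 | h2
  · rw [h2]
    conv_rhs => rw [← h1]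
    rw [h1]
    exact (h.leveled.low_eq_self h1.le).symm
  · exact (h.leveled.low_eq_of_le (low_le _ _ _) (h2.trans_eq h1.symm) hne).symm

end IsFlatTree

/-! ### The classes of an extension are its fibers -/

section Ext

variable {k : ℕ} {T : ETree k} {T₀ : ETree 0} {c : ℕ → ℕ∞ × ℕ∞} {lev : T.carrier → ℕ}

/-- Fibers over nodes are points. Two points of one copy of `T₀` have the same value under e, and
without a root their meet stays in the copy, above the predecessor p of the leaf replaced.
Conversely, a common root determines the copy, and so does a meet strictly above p. -/
theorem sim_ext_iff (hc : IsValidSeq (k + 2) c) (hT : IsFlatTree c T lev)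
    (hT₀ : IsOneColored (c (k + 1)).1 (c (k + 1)).2 T₀.carrier) (x y : (ext T T₀).carrier) :
    extProj T T₀ x = extProj T T₀ y ↔ Sim (ext T T₀) x y := by
  have hΛ := isFlatTree_ext hc hT hT₀
  have : Nonempty T₀.carrier := hT₀.1.nonempty
  have hf : IsLeafFibration (extProj T T₀) := isLeafFibration_extProj
  have h0 : IsLeveled 1 (fun _ => c (k + 1)) (leafLev : T₀.carrier → ℕ) :=
    IsOneColored.isLeveled (c := fun _ => c (k + 1)) hT₀
  have hn : ∀ x : {x : T.carrier // ¬ IsMax x}, lev x.1 < k + 1 := fun x =>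
    lt_of_le_of_ne (hT.leveled.lev_le _) (mt (hT.leveled.max_iff _).2 x.2)
  have hnode : ∀ x, fibLev (k + 1) lev (extProj T T₀) (extNode T₀ x) = lev x.1 := fun x =>
    IsLeafFibration.fibLev_node x.2
  have hleaf : ∀ (α : {x : T.carrier // IsMax x}) (t : T₀.carrier), extLeaf α t ∈ lastDom (ext T T₀) := by
    intro α t
    have hα : IsMax (extProj T T₀ (extLeaf α t)) := α.2
    rw [hΛ.mem_lastDom, IsLeafFibration.fibLev_leaf hα]
    have h1 : eLevel c k = k + 1 ∨ eLevel c k = k := by unfold eLevel; split_ifs <;> simp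
    omega
  have he : lastE (ext T T₀) = newE T T₀ := by
    unfold lastE; simp only [ext, Fin.lastCases_last]; rfl
  by_cases hc0 : (c (k + 1)).2 = 0
  · have hR : Rooted (ext T T₀) := (hΛ.rooted_iff hc).2 hc0
    obtain ⟨r, hr⟩ := (exists_isBot_iff h0).2 hc0
    have hnd : ∀ x, extNode T₀ x ∉ lastDom (ext T T₀) := fun x hx => by
      have h1 := hΛ.mem_lastDom.1 hx
      have h2 := hn x
      rw [hnode, show eLevel c k = k + 1 from if_pos hc0] at h1
      omega
    constructor
    · intro hxy
      rcases ext_cases x with ⟨x, rfl⟩ | ⟨α, s, rfl⟩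
      · exact Or.inl (hf.eq _ _ hxy x.2)
      · rcases ext_cases y with ⟨y, rfl⟩ | ⟨β, t, rfl⟩
        · exact Or.inl (hf.eq _ _ hxy.symm y.2).symm
        · obtain rfl : α = β := Subtype.ext hxy
          refine Or.inr ⟨hleaf _ _, hleaf _ _, ?_, fun h => absurd hR h⟩
          rw [he, newE_of_isBot hr, newE_of_isBot hr]
    · rintro (rfl | ⟨hx, hy, hxy, -⟩)
      · rfl
      rcases ext_cases x with ⟨x, rfl⟩ | ⟨α, s, rfl⟩
      · exact absurd hx (hnd x)
      · rcases ext_cases y with ⟨y, rfl⟩ | ⟨β, t, rfl⟩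
        · exact absurd hy (hnd y)
        · rw [he, newE_of_isBot hr, newE_of_isBot hr] at hxy
          have h1 : α.1 = β.1 := congrArg (extProj T T₀) hxy
          exact h1
  · have hb := mt (exists_isBot_iff h0).1 hc0
    have hk : (c k).1 ≠ 0 := fun h0 => hc0 (hc.succ k (by omega) h0)
    have hpred : ∀ α : {x : T.carrier // IsMax x}, ∃ y, y ⋖ α.1 := fun α =>
      hT.leveled.exists_covBy_left_iff.2
        ⟨k, (hT.leveled.max_iff α.1).1 α.2, by omega, hk, Or.inl rfl⟩
    constructor
    · intro hxy
      rcases ext_cases x with ⟨x, rfl⟩ | ⟨α, s, rfl⟩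
      · exact Or.inl (hf.eq _ _ hxy x.2)
      · rcases ext_cases y with ⟨y, rfl⟩ | ⟨β, t, rfl⟩
        · exact Or.inl (hf.eq _ _ hxy.symm y.2).symm
        · obtain rfl : α = β := Subtype.ext hxy
          obtain ⟨p, hp⟩ := hpred α
          refine Or.inr ⟨hleaf _ _, hleaf _ _, ?_, fun _ => ?_⟩
          · rw [he, newE_of_covBy hT.leveled hb _ hp, newE_of_covBy hT.leveled hb _ hp]
          · rw [he, newE_of_covBy hT.leveled hb _ hp]
            have h1 : extLeaf α (meet s t) ≤ meet (extLeaf α s) (extLeaf α t) :=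
              hΛ.leveled.le_meet_iff.2 ⟨⟨rfl, h0.meet_le_left s t⟩, ⟨rfl, h0.meet_le_right s t⟩⟩
            exact (hf.lt (extNode T₀ ⟨p, not_isMax_of_lt hp.lt⟩) (extLeaf α (meet s t)) hp.lt).trans_le h1
    · rintro (rfl | ⟨hx, hy, hxy, hm⟩)
      · rfl
      have hm := hm (mt (hΛ.rooted_iff hc).1 hc0)
      have hmx := hm.trans_le (hΛ.leveled.meet_le_left x y)
      have hmy := hm.trans_le (hΛ.leveled.meet_le_right x y)
      rw [he] at hm hmx hmy
      have hxy' : newE T T₀ x = newE T T₀ y := by rw [← he]; exact hxy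
      rcases ext_cases x with ⟨x, rfl⟩ | ⟨α, s, rfl⟩
      · exact (lt_irrefl _ hmx).elim
      · rcases ext_cases y with ⟨y, rfl⟩ | ⟨β, t, rfl⟩
        · rw [hxy'] at hmy
          exact (lt_irrefl _ hmy).elim
        · obtain ⟨p, hp⟩ := hpred α
          rw [newE_of_covBy hT.leveled hb _ hp] at hm
          have h1 := hΛ.leveled.meet_le_left (extLeaf α s) (extLeaf β t)
          have h2 := hΛ.leveled.meet_le_right (extLeaf α s) (extLeaf β t)
          -- A node of T strictly above p and below α is impossible since α covers p. So the meet
          -- lies in a copy of `T₀`, which must be both of the given ones.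
          rcases ext_cases (meet (extLeaf α s) (extLeaf β t)) with ⟨z, hz⟩ | ⟨γ, u, hz⟩
          · rw [hz] at hm h1
            have h3 : p < z.1 := (hf.lt_iff (not_isMax_of_lt hp.lt)).1 hm
            have h4 : z.1 ≤ α.1 := h1
            rcases h4.eq_or_lt with h5 | h5
            · exact absurd (h5 ▸ α.2) z.2
            · exact absurd h5 (hp.2 h3)
          · rw [hz] at h1 h2
            exact congrArg Subtype.val (h1.1.symm.trans h2.1)

/-- The extension of a flat tree is a model of the extension axioms. -/
theorem isExtModel_ext (hc : IsValidSeq (k + 2) c) (hT : IsFlatTree c T lev)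
    (hT₀ : IsOneColored (c (k + 1)).1 (c (k + 1)).2 T₀.carrier) (hg : IsGoodTree T.carrier)
    {S : (treeLang k).Theory} (hS : T.carrier ⊨ S) :
    IsExtModel (ext T T₀) S (oneTheory (c (k + 1))) := by
  have hΛ := isFlatTree_ext hc hT hT₀
  have : Nonempty T₀.carrier := hT₀.1.nonempty
  have hf : IsLeafFibration (extProj T T₀) := isLeafFibration_extProj
  have hsim := sim_ext_iff hc hT hT₀
  have hlt : ∀ j : Fin k, eLevel c j < k + 1 := eLevel_lt c
  refine ⟨hΛ.baseAxioms hc (isGoodTree_ext hg hT₀.1 hΛ.leveled), fun x hx hx' => ?_,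
    ⟨T, extProj T T₀, ⟨hf.surj, hsim, fun a b => ?_, fun i x => ?_, fun i x => ?_,
      fun i x hx => ?_⟩, hS, fun hR => ?_⟩, fun i x hx => ?_, fun i x _ hx => hΛ.old_le hc i hx,
      fun i x hx => hΛ.old_ge hc i hx⟩
  · have hα : IsMax (extProj T T₀ x) := by
      rw [hΛ.rooted_iff hc, hΛ.mem_lastIm] at hx'
      rw [hΛ.mem_lastDom] at hx
      by_contra hα
      have h1 := lt_of_le_of_ne (hT.leveled.lev_le _) (mt (hT.leveled.max_iff _).2 hα)
      rw [IsLeafFibration.fibLev_node hα] at hx hx'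
      unfold eLevel at hx hx'
      split_ifs at hx hx' with hc0
      · omega
      · have := hx'.resolve_left hc0
        omega
    have e : (fun y => extProj T T₀ y = extProj T T₀ x) = Sim (ext T T₀) x :=
      funext fun y => propext (eq_comm.trans (hsim x y))
    have transfer : ∀ p q : (ext T T₀).carrier → Prop, p = q →
        (pureTree {y // p y}).carrier ⊨ oneTheory (c (k + 1)) →
        (pureTree {y // q y}).carrier ⊨ oneTheory (c (k + 1)) := by
      rintro p q rfl hp; exact hp
    refine transfer _ _ e ?_
    exact model_of_orderIso (S := T₀) (T := pureTree _) (extFiberIso _ hα) hT₀.model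
  · constructor
    · intro hab
      obtain ⟨u, rfl⟩ := hf.surj a
      obtain ⟨v, rfl⟩ := hf.surj b
      exact ⟨hab.ne, u, v, rfl, rfl, hf.lt u v hab⟩
    · rintro ⟨hne, u, v, rfl, rfl, huv⟩
      exact lt_of_le_of_ne (hf.mono _ _ huv.le) hne
  · rw [hT.mem_Ege, hΛ.mem_Ege]
    exact (IsLeafFibration.le_fibLev_iff hT.leveled (hlt i)).symm
  · rw [hT.mem_E, hΛ.mem_E]
    exact (IsLeafFibration.fibLev_lt_iff hT.leveled (hlt i)).symm
  · rw [hΛ.e_eq, hT.e_eq]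
    have h1 := hT.leveled.low_isGreatest
      ((IsLeafFibration.le_fibLev_iff hT.leveled (hlt i)).1 ((hΛ.mem_Ege _ _).1 hx))
      (hc.eLevel_ne_zero i.castSucc)
    obtain ⟨w, hw⟩ := hf.surj (low lev (eLevel c i) (extProj T T₀ x))
    rw [← hw]
    refine congrArg _ (hf.eq_low_fibLev hT.leveled (hlt i) ?_).symm
    rw [hw]
    exact h1
  · have hc0 := mt (hΛ.rooted_iff hc).2 hR
    have hk : (c k).1 ≠ 0 := fun h0 => hc0 (hc.succ k (by omega) h0)
    refine ⟨fun a ha => hT.leveled.exists_covBy_left_iff.2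
      ⟨k, (hT.leveled.max_iff a).1 ha, by omega, hk, Or.inl rfl⟩, ?_⟩
    ext y
    have hy : y ∈ extProj T T₀ '' lastIm (ext T T₀) ↔ lev y = k := by
      constructor
      · rintro ⟨x, hx, rfl⟩
        rw [hΛ.mem_lastIm, show eLevel c k = k from if_neg hc0] at hx
        exact (IsLeafFibration.fibLev_lt_iff hT.leveled (by omega)).1 hx
      · intro hy
        obtain ⟨x, rfl⟩ := hf.surj y
        refine ⟨x, ?_, rfl⟩
        rw [hΛ.mem_lastIm, show eLevel c k = k from if_neg hc0]
        exact (IsLeafFibration.fibLev_lt_iff hT.leveled (by omega)).2 hy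
    rw [hy]
    constructor
    · intro hy
      obtain ⟨a, ha⟩ := (hT.leveled.exists_covBy_right_iff (y := y)).2 (by
        rw [hy]; exact ⟨by omega, hk, Or.inl rfl⟩)
      exact ⟨a, (hT.leveled.max_iff a).2 (by rw [(hT.leveled.covBy_iff.1 ha).2.1, hy]), ha⟩
    · rintro ⟨a, ha, hya⟩
      have h1 := (hT.leveled.covBy_iff.1 hya).2.1
      rw [(hT.leveled.max_iff a).1 ha] at h1
      omega
  · rw [hΛ.e_eq]
    exact hΛ.leveled.low_eq_self (not_le.1 (mt (hΛ.mem_Ege _ _).2 hx)).le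

end Ext

/-! ### Iterated extensions -/

theorem IsOneColored.fst_ne_zero {m μ : ℕ∞} {X : Type} [PartialOrder X] (h : IsOneColored m μ X)
    (hμ : μ = 0) : m ≠ 0 := by
  rintro rfl
  subst hμ
  rcases h.2 with h | h | h <;> simp at h

/-- The three properties are proved in one induction, because `isExtModel_ext` needs all of them for
the previous stage. -/
theorem iterExt_spec {c : ℕ → ℕ∞ × ℕ∞} (k : ℕ) (T : Fin (k + 1) → ETree 0)
    (h : IsColoredSeq k (fun i => c i) T) :
    IsValidSeq (k + 1) c ∧ IsGoodTree (iterExt k T).carrier ∧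
      (∃ lev, IsFlatTree c (iterExt k T) lev) ∧
      (iterExt k T).carrier ⊨ iterTheory k (fun i => c i) := by
  have hc : IsValidSeq (k + 1) c :=
    ⟨fun i hi h0 => (h.1 ⟨i, hi⟩).fst_ne_zero h0, fun i hi h0 => h.2 ⟨i, by omega⟩ h0⟩
  refine ⟨hc, ?_⟩
  induction k with
  | zero =>
    exact ⟨(h.1 0).1, ⟨_, (IsOneColored.isLeveled (h.1 0)).isFlatTree⟩, (h.1 0).model⟩
  | succ k ih =>
    have hc' : IsValidSeq (k + 1) c :=
      ⟨fun i hi => hc.ne_zero i (by omega), fun i hi => hc.succ i (by omega)⟩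
    obtain ⟨h1, ⟨lev, h2⟩, h3⟩ := ih (fun i => T i.castSucc)
      ⟨fun i => h.1 i.castSucc, fun i => h.2 i.castSucc⟩ hc'
    have h4 := h.1 (Fin.last (k + 1))
    have h5 := isFlatTree_ext hc h2 h4
    refine ⟨isGoodTree_ext h1 h4.1 h5.leveled, ⟨_, h5⟩, (Theory.model_iff _).2 fun φ hφ => ?_⟩
    exact hφ _ (isExtModel_ext hc h2 h4 h1 h3)

/-- The structures that define the theory are themselves models of it, so the theory is closed under
consequence. -/
theorem mem_iterTheory {k : ℕ} {c : Fin (k + 1) → ℕ∞ × ℕ∞} {φ : (treeLang k).Sentence}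
    (h : ∀ (M : Type) [(treeLang k).Structure M], M ⊨ iterTheory k c → M ⊨ φ) :
    φ ∈ iterTheory k c := by
  cases k with
  | zero => exact fun T hT => h _ hT.model
  | succ k => exact fun Λ hΛ => h _ ((Theory.model_iff _).2 fun ψ hψ => hψ Λ hΛ)

theorem exists_eq_restrict (k : ℕ) (c : Fin (k + 1) → ℕ∞ × ℕ∞) :
    ∃ c' : ℕ → ℕ∞ × ℕ∞, c = fun i : Fin (k + 1) => c' i :=
  ⟨fun i => if h : i < k + 1 then c ⟨i, h⟩ else (0, 0), by
    funext i
    exact (dif_pos i.2 : (if h : i.1 < k + 1 then c ⟨i.1, h⟩ else (0, 0)) = c i).symm⟩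

theorem nonempty_iterExt {k : ℕ} {c : Fin (k + 1) → ℕ∞ × ℕ∞} {T : Fin (k + 1) → ETree 0}
    (h : IsColoredSeq k c T) : Nonempty (iterExt k T).carrier := by
  obtain ⟨c, rfl⟩ := exists_eq_restrict k c
  exact (iterExt_spec k T h).2.1.nonempty

/-- An iterated theory is the complete theory of the iterated extension of trees of the same
colors. -/
theorem iterTheory_eq_completeTheory {k : ℕ} {c : Fin (k + 1) → ℕ∞ × ℕ∞} {T : Fin (k + 1) → ETree 0}
    (h : IsColoredSeq k c T) :
    iterTheory k c = (treeLang k).completeTheory (iterExt k T).carrier := by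
  obtain ⟨c, rfl⟩ := exists_eq_restrict k c
  obtain ⟨hc, -, ⟨lev, hl⟩, hm⟩ := iterExt_spec k T h
  ext φ
  refine ⟨fun hφ => hm.realize_of_mem φ hφ, fun hφ => mem_iterTheory fun M _ hM => ?_⟩
  -- Any model is flat for the same colors as the extension, hence elementarily equivalent to it.
  obtain ⟨_, lev', hl'⟩ := (rawFlat_of_model_iterTheory k hc M hM).exists_isFlat hc
  exact (hl'.realize_sentence_iff hc (isFlat_iff_isFlatTree.2 hl) φ).2 hφ

theorem eliminatesQuantifiers_iterTheory {k : ℕ} {c : Fin (k + 1) → ℕ∞ × ℕ∞}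
    {T : Fin (k + 1) → ETree 0} (h : IsColoredSeq k c T) :
    EliminatesQuantifiers (iterTheory k c) := by
  obtain ⟨c, rfl⟩ := exists_eq_restrict k c
  have hc := (iterExt_spec k T h).1
  intro j φ
  obtain ⟨ψ, hψ, hφψ⟩ := exists_isQF_of_isFlat hc φ
  refine ⟨ψ, hψ, fun M _ hM => ?_⟩
  obtain ⟨_, lev, hl⟩ := (rawFlat_of_model_iterTheory k hc M hM).exists_isFlat hc
  exact hφψ M lev hl

/-- The reduct of a tree to `{L, N, ≤, ∧}` is the pure tree. -/
theorem realize_inclLang_iff {k : ℕ} (T : ETree k) (φ : (treeLang 0).Sentence) :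
    T.carrier ⊨ (inclLang k).onSentence φ ↔ (pureTree T.carrier).carrier ⊨ φ := by
  let _ : (treeLang 0).Structure T.carrier := treeStructure (pureTree T.carrier)
  have : (inclLang k).IsExpansionOn T.carrier := by
    refine ⟨fun f v => ?_, fun r v => ?_⟩
    · rcases f with _ | i
      · rfl
      · exact i.elim0
    · rcases r with _ | _ | _ | i | i
      · rfl
      · rfl
      · rfl
      · exact i.elim0
      · exact i.elim0
  exact LHom.realize_onSentence (M := T.carrier) (inclLang k) φ

/-- A complete theory decides each translated sentence, so consequence is the same as truth in T,
and the translation does not see the additional symbols. -/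
theorem pureRestriction_completeTheory {k : ℕ} (T : ETree k) [Nonempty T.carrier] :
    pureRestriction ((treeLang k).completeTheory T.carrier) =
      (treeLang 0).completeTheory (pureTree T.carrier).carrier := by
  ext φ
  have h1 := (completeTheory.isComplete (treeLang k) T.carrier).realize_sentence_iff
    ((inclLang k).onSentence φ) T.carrier
  exact h1.symm.trans (realize_inclLang_iff T φ)

theorem IsIterExt.of_orderIso {j : ℕ} {X Y : Type} [PartialOrder X] [PartialOrder Y] (f : X ≃o Y)
    (h : IsIterExt j X) : IsIterExt j Y := by
  obtain ⟨c, T, hT, ⟨g⟩⟩ := h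
  exact ⟨c, T, hT, ⟨f.symm.trans g⟩⟩

theorem IsColored.of_orderIso {k : ℕ} {X Y : Type} [PartialOrder X] [PartialOrder Y] (f : X ≃o Y)
    (h : IsColored k X) : IsColored k Y :=
  ⟨h.1.of_orderIso f, fun j hj hY => h.2 j hj (hY.of_orderIso f.symm)⟩

end GoodTrees

/-- Here `n = k + 1 ≥ 1` is the number of colors. -/
theorem theorem6 (k : ℕ) :
    (∀ S ∈ coloredTheories k,
      S.IsComplete ∧ (pureRestriction S).IsComplete ∧ EliminatesQuantifiers S) ∧
    coloredTheories k =
      {S | ∃ c T, IsColoredSeq k c T ∧ IsColored k (iterExt k T).carrier ∧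
        S = (treeLang k).completeTheory (iterExt k T).carrier} ∧
    pureRestriction '' coloredTheories k =
      {S | ∃ (X : Type) (_ : PartialOrder X), IsColored k X ∧
        S = (treeLang 0).completeTheory (pureTree X).carrier} := by
  have main : ∀ c T, IsColoredSeq k c T → (iterTheory k c).IsComplete ∧
      pureRestriction (iterTheory k c) =
        (treeLang 0).completeTheory (pureTree (iterExt k T).carrier).carrier := by
    intro c T h
    have hne := nonempty_iterExt h
    rw [iterTheory_eq_completeTheory h]
    exact ⟨completeTheory.isComplete _ _, pureRestriction_completeTheory _⟩
  refine ⟨?_, ?_, ?_⟩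
  · rintro S ⟨c, T, h, -, rfl⟩
    have hne : Nonempty (pureTree (iterExt k T).carrier).carrier := nonempty_iterExt h
    refine ⟨(main c T h).1, ?_, eliminatesQuantifiers_iterTheory h⟩
    rw [(main c T h).2]
    exact completeTheory.isComplete _ _
  · ext S
    constructor <;> rintro ⟨c, T, h, hcol, rfl⟩
    · exact ⟨c, T, h, hcol, iterTheory_eq_completeTheory h⟩
    · exact ⟨c, T, h, hcol, (iterTheory_eq_completeTheory h).symm⟩
  · ext S
    constructor
    · rintro ⟨_, ⟨c, T, h, hcol, rfl⟩, rfl⟩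
      exact ⟨_, _, hcol, (main c T h).2⟩
    · rintro ⟨X, _, hX, rfl⟩
      obtain ⟨⟨c, T, h, ⟨f⟩⟩, -⟩ := id hX
      -- Both being colored and the pure theory are invariant under order isomorphism, so X may be
      -- replaced by the iterated extension.
      refine ⟨_, ⟨c, T, h, hX.of_orderIso f, rfl⟩, (main c T h).2.trans ?_⟩
      ext φ
      exact (realize_iff_of_orderIso (S := pureTree X)
        (T := pureTree (iterExt k T).carrier) f φ).symm
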